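/- Let $N\in\mathbb N$, let $\Omega\subset\mathbb R^N$ be open, $T>0$, $Q=\Omega\times(0,T)$ and $1\le p<\infty$, $1/p'=1-1/p$. Notation. For $d\ge 0$, $\mathrm{AP}(\mathbb R^d)$ is the Banach algebra (sup norm) of real bounded continuous functions $u$ on $\mathbb R^d$ whose translates $u(\cdot+a)$, $a\in\mathbb R^d$, form a relatively compact set; $M(u)=\lim_{r\to\infty}|B_r|^{-1}\int_{B_r}u\,dy$ is the mean value; $\mathcal K$ is the spectrum of $\mathrm{AP}(\mathbb R^d)$ (its nonzero multiplicative linear forms with the weak-$*$ topology), $\widehat u(s)=s(u)$ is the Gelfand transform, and $\beta$ is the Radon probability measure on $\mathcal K$ with $\int_{\mathcal K}\widehat u\,d\beta=M(u)$ for all $u\in \mathrm{AP}(\mathbb R^d)$. $B^p_{\mathrm{AP}}(\mathbb R^d)$ is the closure of $\mathrm{AP}(\mathbb R^d)$ for the seminorm $\|u\|_p=\limsup_{r\to\infty}\bigl(|B_r|^{-1}\int_{B_r}|u|^p\,dy\bigr)^{1/p}$, and $\mathcal B^p_{\mathrm{AP}}(\mathbb R^d)$ is its quotient by the functions of zero seminorm;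 the Gelfand transformation extends by continuity to an isometry $u\mapsto\widehat u$ of $\mathcal B^p_{\mathrm{AP}}(\mathbb R^d)$ onto $L^p(\mathcal K)$. Write $\mathcal K_y$, $\mathcal K_\tau$ for the spectra of $\mathrm{AP}(\mathbb R^N)$, $\mathrm{AP}(\mathbb R)$, with measures $ds$, $ds_0$; the spectrum of $\mathrm{AP}(\mathbb R^{N+1})$ is identified with $\mathcal K_y\times\mathcal K_\tau$, with the product measure $ds\,ds_0$. A family $(u_\varepsilon)\subset L^p(Q)$, with $\varepsilon>0$ tending to $0$ continuously or along a sequence, is said to weakly $\Sigma$-converge in $L^p(Q)$ to $u_0\in L^p(Q;\mathcal B^p_{\mathrm{AP}}(\mathbb R^{N+1}))$ if, as $\varepsilon\to0$, $$\int_Q u_\varepsilon(x,t)\,f\Bigl(x,t,\frac x\varepsilon,\frac t\varepsilon\Bigr)dx\,dt\longrightarrow\iint_{Q\times\mathcal K_y\times\mathcal K_\tau}\widehat u_0(x,t,s,s_0)\,\widehat f(x,t,s,s_0)\,dx\,dt\,ds\,ds_0$$ for every $f\in L^{p'}(Q;\mathrm{AP}(\mathbb R^{N+1}))$. Statement. Let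 $(v_\varepsilon)\subset L^p(Q)$ weakly $\Sigma$-converge in $L^p(Q)$ to $v_0\in L^p(Q;\mathcal B^p_{\mathrm{AP}}(\mathbb R^{N+1}))$, and set $w_\varepsilon(x,t)=\int_0^t v_\varepsilon(x,\tau)\,d\tau$ for a.e. $(x,t)\in Q$. Then there is $w_0\in L^p(Q;\mathcal B^p_{\mathrm{AP}}(\mathbb R^N))$ with $$\widehat w_0(x,t,s)=\int_0^t\int_{\mathcal K_\tau}\widehat v_0(x,\tau,s,r_0)\,dr_0\,d\tau\qquad\text{for a.e. }(x,t,s)\in Q\times\mathcal K_y,$$ and $(w_\varepsilon)$ is contained in $L^p(Q)$ and weakly $\Sigma$-converges in $L^p(Q)$ to $w_0$, where $w_0$ is regarded as the element of $L^p(Q;\mathcal B^p_{\mathrm{AP}}(\mathbb R^{N+1}))$ that does not depend on the microscopic time variable. -/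

import Mathlib

set_option linter.unusedSectionVars false

open MeasureTheory Filter Topology Set Metric
open scoped ENNReal BoundedContinuousFunction

namespace APSigma

section AP
variable {V : Type*} [NormedAddCommGroup V]

/-- The translate `u(· + a)`. -/
def translate (a : V) (u : V →ᵇ ℝ) : V →ᵇ ℝ := u.compContinuous (ContinuousMap.addRight a)

@[simp] theorem translate_apply (a : V) (u : V →ᵇ ℝ) (y : V) : translate a u y = u (y + a) := rfl

/-- A bounded continuous function is almost periodic if its translates form a relatively compact set
for the sup norm. -/
def IsAlmostPeriodic (u : V →ᵇ ℝ) : Prop :=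
  IsCompact (closure (range fun a : V => translate a u))

theorem isAlmostPeriodic_of_subset {u : V →ᵇ ℝ} {S : Set (V →ᵇ ℝ)} (hS : IsCompact S)
    (h : ∀ a, translate a u ∈ S) : IsAlmostPeriodic u :=
  hS.closure_of_subset (by rintro _ ⟨a, rfl⟩; exact h a)

theorem mem_orbitClosure (u : V →ᵇ ℝ) (a : V) :
    translate a u ∈ closure (range fun a : V => translate a u) :=
  subset_closure ⟨a, rfl⟩

variable (V) in
/-- The almost periodic functions, as a subalgebra of the bounded continuous functions. -/
def apSubalgebra : Subalgebra ℝ (V →ᵇ ℝ) where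
  carrier := {u | IsAlmostPeriodic u}
  mul_mem' {u v} hu hv := isAlmostPeriodic_of_subset
    ((IsCompact.prod hu hv).image (f := fun q => q.1 * q.2) (by fun_prop))
    fun a => ⟨(translate a u, translate a v),
      ⟨mem_orbitClosure u a, mem_orbitClosure v a⟩, by ext; rfl⟩
  add_mem' {u v} hu hv := isAlmostPeriodic_of_subset
    ((IsCompact.prod hu hv).image (f := fun q => q.1 + q.2) (by fun_prop))
    fun a => ⟨(translate a u, translate a v),
      ⟨mem_orbitClosure u a, mem_orbitClosure v a⟩, by ext; rfl⟩
  algebraMap_mem' c := isAlmostPeriodic_of_subset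
    (isCompact_singleton (x := algebraMap ℝ (V →ᵇ ℝ) c)) fun a => by ext; rfl

theorem dist_translate_le (a : V) (u v : V →ᵇ ℝ) : dist (translate a u) (translate a v) ≤ dist u v :=
  (BoundedContinuousFunction.dist_le dist_nonneg).2 fun y =>
    BoundedContinuousFunction.dist_coe_le_dist (f := u) (g := v) (y + a)

/-- Every translate is uniformly close to one of finitely many. -/
theorem exists_bounded_translate {u : V →ᵇ ℝ} (hu : IsAlmostPeriodic u) {η : ℝ} (hη : 0 < η) :
    ∃ F : Finset V, ∀ a : V, ∃ b ∈ F, dist (translate a u) (translate b u) < η := by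
  classical
  have ht : TotallyBounded (range fun a : V => translate a u) :=
    hu.totallyBounded.subset subset_closure
  obtain ⟨t, hts, htf, htc⟩ := (totallyBounded_iff_subset.1 ht) _ (Metric.dist_mem_uniformity hη)
  have hts' : ∀ x ∈ t, ∃ b : V, translate b u = x := fun x hx => hts hx
  choose! g hg using hts'
  refine ⟨htf.toFinset.image g, fun a => ?_⟩
  obtain ⟨x, hx, hax⟩ := mem_iUnion₂.1 (htc ⟨a, rfl⟩)
  refine ⟨g x, Finset.mem_image.2 ⟨x, htf.mem_toFinset.2 hx, rfl⟩, ?_⟩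
  rw [hg x hx]; exact hax

theorem isClosed_apSubalgebra : IsClosed (apSubalgebra V : Set (V →ᵇ ℝ)) := by
  classical
  refine isClosed_of_closure_subset fun u hu => ?_
  change IsCompact _
  refine TotallyBounded.isCompact_of_isClosed (TotallyBounded.closure ?_) isClosed_closure
  refine Metric.totallyBounded_iff.2 fun η hη => ?_
  obtain ⟨v, hv, huv⟩ := Metric.mem_closure_iff.1 hu (η / 3) (by positivity)
  obtain ⟨F, hF⟩ := exists_bounded_translate (u := v) hv (η := η / 3) (by positivity)
  refine ⟨(fun b => translate b u) '' F, F.finite_toSet.image _, ?_⟩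
  rintro _ ⟨a, rfl⟩
  obtain ⟨b, hb, hab⟩ := hF a
  refine mem_iUnion₂.2 ⟨_, ⟨b, hb, rfl⟩, ?_⟩
  have h1 := dist_translate_le a u v
  have h2 := dist_translate_le b v u
  rw [dist_comm v u] at h2
  have := dist_triangle4 (translate a u) (translate a v) (translate b v) (translate b u)
  exact Metric.mem_ball.2 (by linarith)

variable (V) in
/-- The Banach algebra `AP(V)` of almost periodic functions on `V`, with the sup norm. -/
def AP : Type _ := ↥(apSubalgebra V)

noncomputable instance : NormedCommRing (AP V) := inferInstanceAs (NormedCommRing (apSubalgebra V))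

noncomputable instance : NormedAlgebra ℝ (AP V) :=
  inferInstanceAs (NormedAlgebra ℝ (apSubalgebra V))

instance : CompleteSpace (AP V) := isClosed_apSubalgebra.completeSpace_coe

/-- An element of `AP(V)` as a bounded continuous function. -/
def AP.toBCF (u : AP V) : V →ᵇ ℝ := u.1

/-- A bounded continuous almost periodic function as an element of `AP(V)`. -/
def AP.mk (u : V →ᵇ ℝ) (hu : IsAlmostPeriodic u) : AP V := ⟨u, hu⟩

instance : CoeFun (AP V) fun _ => V → ℝ := ⟨fun u => u.toBCF⟩

theorem AP.isAlmostPeriodic (u : AP V) : IsAlmostPeriodic u.toBCF := u.2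

@[simp] theorem AP.mk_apply (u : V →ᵇ ℝ) (hu : IsAlmostPeriodic u) (y : V) : AP.mk u hu y = u y :=
  rfl

@[ext] theorem AP.ext {u v : AP V} (h : ∀ y, u y = v y) : u = v :=
  Subtype.ext (BoundedContinuousFunction.ext h)

@[simp] theorem AP.add_apply (u v : AP V) (y : V) : (u + v) y = u y + v y := rfl
@[simp] theorem AP.sub_apply (u v : AP V) (y : V) : (u - v) y = u y - v y := rfl
@[simp] theorem AP.mul_apply (u v : AP V) (y : V) : (u * v) y = u y * v y := rfl
@[simp] theorem AP.smul_apply (c : ℝ) (u : AP V) (y : V) : (c • u) y = c * u y := rfl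
@[simp] theorem AP.one_apply (y : V) : (1 : AP V) y = 1 := rfl

theorem AP.norm_def (u : AP V) : ‖u‖ = ‖u.toBCF‖ := rfl
theorem AP.dist_def (u v : AP V) : dist u v = dist u.toBCF v.toBCF := rfl

theorem AP.abs_apply_le (u : AP V) (y : V) : |u y| ≤ ‖u‖ := u.toBCF.norm_coe_le_norm y

theorem AP.norm_le (u : AP V) {C : ℝ} (hC : 0 ≤ C) (h : ∀ y, |u y| ≤ C) : ‖u‖ ≤ C :=
  (BoundedContinuousFunction.norm_le hC).2 h

instance : NormOneClass (AP V) :=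
  ⟨by rw [AP.norm_def]; exact norm_one (α := V →ᵇ ℝ)⟩

/-- An almost periodic function is uniformly continuous. -/
theorem continuous_translate {u : V →ᵇ ℝ} (hu : IsAlmostPeriodic u) :
    Continuous fun a : V => translate a u := by
  refine Metric.continuous_iff.2 fun a η hη => ?_
  obtain ⟨F, hF⟩ := exists_bounded_translate hu (η := η / 4) (by positivity)
  have key : ∀ᶠ h in 𝓝 (0 : V), ∀ b ∈ F, dist (u (b + h)) (u b) < η / 4 := by
    refine (Finset.eventually_all F).2 fun b _ => ?_
    have : Tendsto (fun h : V => u (b + h)) (𝓝 0) (𝓝 (u b)) := by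
      have h : Continuous fun h : V => u (b + h) := by fun_prop
      simpa using h.tendsto 0
    exact Metric.tendsto_nhds.1 this _ (by positivity)
  obtain ⟨δ, hδ, hk⟩ := Metric.eventually_nhds_iff.1 key
  refine ⟨δ, hδ, fun a' ha' => ?_⟩
  refine lt_of_le_of_lt ((BoundedContinuousFunction.dist_le (C := 3 * (η / 4)) (by positivity)).2 ?_)
    (by linarith)
  intro y
  obtain ⟨b, hb, hab⟩ := hF (y + a)
  have h0 := BoundedContinuousFunction.dist_coe_le_dist (f := translate (y + a) u)
    (g := translate b u) 0
  have h1 := BoundedContinuousFunction.dist_coe_le_dist (f := translate (y + a) u)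
    (g := translate b u) (a' - a)
  have h2 := hk (y := a' - a) (by simpa [dist_eq_norm] using ha') b hb
  simp only [translate_apply, zero_add] at h0 h1 ⊢
  have e1 : a' - a + (y + a) = y + a' := by abel
  rw [e1, add_comm (a' - a) b] at h1
  have := dist_triangle4 (u (y + a')) (u (b + (a' - a))) (u b) (u (y + a))
  rw [dist_comm (u b) (u (y + a))] at this
  linarith

end AP

section Mean
variable {V : Type*} [NormedAddCommGroup V] [NormedSpace ℝ V] [FiniteDimensional ℝ V]
  [MeasureSpace V] [BorelSpace V] [(volume : Measure V).IsAddHaarMeasure]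

variable (V) in
/-- The normalized Lebesgue measure `dy / |B_r|` on the ball `B_r` centred at the origin. -/
noncomputable def unifBall (r : ℝ) : Measure V :=
  (volume (ball (0 : V) r))⁻¹ • volume.restrict (ball (0 : V) r)

theorem isProbabilityMeasure_unifBall {r : ℝ} (hr : 0 < r) : IsProbabilityMeasure (unifBall V r) :=
  ⟨by
    simp only [unifBall, Measure.smul_apply, Measure.restrict_apply MeasurableSet.univ, univ_inter,
      smul_eq_mul]
    exact ENNReal.inv_mul_cancel (measure_ball_pos _ _ hr).ne' measure_ball_lt_top.ne⟩

theorem integral_unifBall (r : ℝ) (f : V → ℝ) :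
    ∫ y, f y ∂(unifBall V r) = (volume.real (ball (0 : V) r))⁻¹ * ∫ y in ball (0 : V) r, f y := by
  simp [unifBall, integral_smul_measure, Measure.real, ENNReal.toReal_inv]

theorem integrable_unifBall (u : V →ᵇ ℝ) {r : ℝ} (hr : 0 < r) : Integrable u (unifBall V r) :=
  have := isProbabilityMeasure_unifBall (V := V) hr
  u.integrable _

theorem integrableOn_ball (u : V →ᵇ ℝ) (b : V) (r : ℝ) : IntegrableOn u (ball b r) := by
  have : IsFiniteMeasure (volume.restrict (ball b r)) := ⟨by
    simpa using measure_ball_lt_top⟩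
  exact u.integrable _

theorem abs_setIntegral_sub_le (u : V →ᵇ ℝ) {b : V} {r ρ : ℝ} (hsub : ball (0 : V) ρ ⊆ ball b r) :
    |(∫ y in ball b r, u y) - ∫ y in ball (0 : V) ρ, u y|
      ≤ ‖u‖ * (volume.real (ball (0 : V) r) - volume.real (ball (0 : V) ρ)) := by
  rw [← setIntegral_sdiff measurableSet_ball (integrableOn_ball u b r) hsub]
  have h := norm_setIntegral_le_of_norm_le_const (μ := (volume : Measure V))
    (s := ball b r \ ball (0 : V) ρ) (f := u) (C := ‖u‖)
    (lt_of_le_of_lt (measure_mono sdiff_subset) measure_ball_lt_top)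
    (fun y _ => u.norm_coe_le_norm y)
  rw [Real.norm_eq_abs, measureReal_sdiff hsub measurableSet_ball] at h
  rwa [Measure.addHaar_real_ball_center volume b r] at h

theorem volume_real_ball {r : ℝ} (hr : 0 < r) : volume.real (ball (0 : V) r)
    = r ^ Module.finrank ℝ V * volume.real (ball (0 : V) 1) := by
  rw [Measure.real, Measure.addHaar_ball_of_pos volume (0 : V) hr, ENNReal.toReal_mul,
    ENNReal.toReal_ofReal (by positivity), Measure.real]

theorem abs_shift_sub_le (u : V →ᵇ ℝ) {b : V} {r L : ℝ} (hb : ‖b‖ ≤ L) (hL : 0 ≤ L) (hr : L < r) :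
    |(∫ y, u (y + b) ∂(unifBall V r)) - ∫ y, u y ∂(unifBall V r)|
      ≤ 2 * ‖u‖ * (1 - ((r - L) / r) ^ Module.finrank ℝ V) := by
  have hr0 : 0 < r := hL.trans_lt hr
  have hB : ∫ y in ball (0 : V) r, u (y + b) = ∫ y in ball b r, u y := by
    have := (measurePreserving_add_right (volume : Measure V) b).setIntegral_preimage_emb
      (measurableEmbedding_addRight b) u (ball b r)
    rw [← this]
    congr 2
    ext y; simp [dist_eq_norm]
  have hsub : ball (0 : V) (r - L) ⊆ ball b r := fun y hy => by
    simp only [mem_ball, dist_eq_norm, sub_zero] at hy ⊢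
    linarith [norm_sub_le y b]
  have hsub0 : ball (0 : V) (r - L) ⊆ ball 0 r := ball_subset_ball (by linarith)
  have h1 := abs_setIntegral_sub_le u hsub
  have h2 := abs_setIntegral_sub_le u hsub0
  have hv1 : volume.real (ball (0 : V) r) = r ^ Module.finrank ℝ V * volume.real (ball (0 : V) 1) :=
    volume_real_ball hr0
  have hv2 : volume.real (ball (0 : V) (r - L))
      = (r - L) ^ Module.finrank ℝ V * volume.real (ball (0 : V) 1) :=
    volume_real_ball (by linarith)
  have hpos : 0 < volume.real (ball (0 : V) r) :=
    ENNReal.toReal_pos (measure_ball_pos _ _ hr0).ne' measure_ball_lt_top.ne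
  rw [integral_unifBall, integral_unifBall, hB, ← mul_sub, abs_mul, abs_of_pos (inv_pos.2 hpos),
    inv_mul_le_iff₀ hpos]
  have hv : volume.real (ball (0 : V) r) - volume.real (ball (0 : V) (r - L))
      = volume.real (ball (0 : V) r) * (1 - ((r - L) / r) ^ Module.finrank ℝ V) := by
    rw [hv2, hv1, div_pow]
    have : r ^ Module.finrank ℝ V ≠ 0 := by positivity
    field_simp
  rw [hv] at h1 h2
  set I := ∫ y in ball (0 : V) (r - L), u y
  set D := 1 - ((r - L) / r) ^ Module.finrank ℝ V
  have := abs_sub_le (∫ y in ball b r, u y) I (∫ y in ball (0 : V) r, u y)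
  rw [abs_sub_comm I] at this
  linarith

/-- Averages over large balls hardly depend on the centre of the ball. -/
theorem eventually_shift {u : V →ᵇ ℝ} (hu : IsAlmostPeriodic u) {η : ℝ} (hη : 0 < η) :
    ∀ᶠ r in atTop, ∀ a : V,
      |(∫ y, u (y + a) ∂(unifBall V r)) - ∫ y, u y ∂(unifBall V r)| ≤ η := by
  obtain ⟨F, hF⟩ := exists_bounded_translate hu (η := η / 2) (by positivity)
  set L : ℝ := ∑ b ∈ F, ‖b‖
  have hL0 : 0 ≤ L := Finset.sum_nonneg fun _ _ => norm_nonneg _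
  have hlim : Tendsto (fun r : ℝ => 2 * ‖u‖ * (1 - ((r - L) / r) ^ Module.finrank ℝ V)) atTop
      (𝓝 0) := by
    have h1 : Tendsto (fun r : ℝ => (r - L) / r) atTop (𝓝 1) := by
      have : Tendsto (fun r : ℝ => 1 - L * r⁻¹) atTop (𝓝 (1 - L * 0)) :=
        tendsto_const_nhds.sub (tendsto_const_nhds.mul tendsto_inv_atTop_zero)
      rw [mul_zero, sub_zero] at this
      refine this.congr' ?_
      filter_upwards [eventually_gt_atTop 0] with r hr
      field_simp
    have h2 := ((tendsto_const_nhds (x := (1 : ℝ))).sub (h1.pow (Module.finrank ℝ V))).const_mul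
      (2 * ‖u‖)
    simpa using h2
  filter_upwards [eventually_gt_atTop L, (tendsto_order.1 hlim).2 (η / 2) (by positivity)]
    with r hr hr2 a
  have := isProbabilityMeasure_unifBall (V := V) (hL0.trans_lt hr)
  obtain ⟨b, hb, hab⟩ := hF a
  have hbL : ‖b‖ ≤ L := Finset.single_le_sum (f := fun b : V => ‖b‖) (fun _ _ => norm_nonneg _) hb
  have h1 := abs_shift_sub_le u hbL hL0 hr
  have h2 : |(∫ y, u (y + a) ∂(unifBall V r)) - ∫ y, u (y + b) ∂(unifBall V r)| ≤ η / 2 := by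
    have hi := integral_sub ((translate a u).integrable (unifBall V r))
      ((translate b u).integrable (unifBall V r))
    simp only [translate_apply] at hi
    rw [← hi, ← Real.norm_eq_abs]
    refine (norm_integral_le_of_norm_le_const (C := η / 2) (ae_of_all _ fun y => ?_)).trans ?_
    · rw [← dist_eq_norm]
      exact (BoundedContinuousFunction.dist_coe_le_dist (f := translate a u)
        (g := translate b u) y).trans hab.le
    · simp
  have := abs_sub_le (∫ y, u (y + a) ∂(unifBall V r)) (∫ y, u (y + b) ∂(unifBall V r))
    (∫ y, u y ∂(unifBall V r))
  linarith

theorem abs_mean_sub_le (u : V →ᵇ ℝ) {r R η : ℝ} (hr : 0 < r) (hR : 0 < R)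
    (h : ∀ a : V, |(∫ y, u (y + a) ∂(unifBall V r)) - ∫ y, u y ∂(unifBall V r)| ≤ η) :
    |(∫ a, ∫ y, u (y + a) ∂(unifBall V r) ∂(unifBall V R)) - ∫ y, u y ∂(unifBall V r)| ≤ η := by
  have := isProbabilityMeasure_unifBall (V := V) hr
  have := isProbabilityMeasure_unifBall (V := V) hR
  have hint : Integrable (fun q : V × V => u (q.2 + q.1)) ((unifBall V R).prod (unifBall V r)) :=
    (u.compContinuous ⟨fun q : V × V => q.2 + q.1, by fun_prop⟩).integrable _
  have hi := integral_sub hint.integral_prod_left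
    (integrable_const (μ := unifBall V R) (∫ y, u y ∂(unifBall V r)))
  rw [integral_const, probReal_univ, one_smul] at hi
  rw [← hi, ← Real.norm_eq_abs]
  refine (norm_integral_le_of_norm_le_const (C := η) (ae_of_all _ fun a => h a)).trans ?_
  simp

theorem exists_mean {u : V →ᵇ ℝ} (hu : IsAlmostPeriodic u) :
    ∃ m, Tendsto (fun r : ℝ => ∫ y, u y ∂(unifBall V r)) atTop (𝓝 m) := by
  refine cauchy_map_iff_exists_tendsto.1 (Metric.cauchy_iff.2 ⟨inferInstance, fun η hη => ?_⟩)
  obtain ⟨r₀, hr₀⟩ := eventually_atTop.1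
    ((eventually_shift hu (η := η / 3) (by positivity)).and (eventually_gt_atTop 0))
  refine ⟨_, image_mem_map (Ici_mem_atTop r₀), ?_⟩
  rintro _ ⟨r, hr, rfl⟩ _ ⟨R, hR, rfl⟩
  have h1 := hr₀ r hr
  have h2 := hr₀ R hR
  have := isProbabilityMeasure_unifBall (V := V) h1.2
  have := isProbabilityMeasure_unifBall (V := V) h2.2
  have e1 := abs_mean_sub_le u h1.2 h2.2 h1.1
  have e2 := abs_mean_sub_le u h2.2 h1.2 h2.1
  have hint : Integrable (fun q : V × V => u (q.2 + q.1)) ((unifBall V R).prod (unifBall V r)) :=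
    (u.compContinuous ⟨fun q : V × V => q.2 + q.1, by fun_prop⟩).integrable _
  rw [integral_integral_swap hint] at e1
  simp only [add_comm] at e1 e2
  rw [Real.dist_eq]
  rw [abs_le] at e1 e2
  rw [abs_lt]
  constructor <;> linarith [e1.1, e1.2, e2.1, e2.2]

/-- The mean value `M(u) = lim_{r → ∞} |B_r|⁻¹ ∫_{B_r} u(y) dy`. -/
noncomputable def meanValue (u : AP V) : ℝ :=
  limUnder atTop fun r : ℝ => ∫ y, u y ∂(unifBall V r)

theorem tendsto_meanValue (u : AP V) :
    Tendsto (fun r : ℝ => ∫ y, u y ∂(unifBall V r)) atTop (𝓝 (meanValue u)) :=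
  tendsto_nhds_limUnder (exists_mean u.isAlmostPeriodic)

theorem meanValue_add (u v : AP V) : meanValue (u + v) = meanValue u + meanValue v := by
  refine tendsto_nhds_unique (tendsto_meanValue (u + v))
    (((tendsto_meanValue u).add (tendsto_meanValue v)).congr' ?_)
  filter_upwards [eventually_gt_atTop 0] with r hr
  exact (integral_add (integrable_unifBall _ hr) (integrable_unifBall _ hr)).symm

theorem meanValue_smul (c : ℝ) (u : AP V) : meanValue (c • u) = c * meanValue u := by
  refine tendsto_nhds_unique (tendsto_meanValue (c • u))
    (((tendsto_meanValue u).const_mul c).congr fun r => ?_)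
  exact (integral_const_mul c _).symm

theorem meanValue_nonneg (u : AP V) (hu : ∀ y, 0 ≤ u y) : 0 ≤ meanValue u :=
  ge_of_tendsto' (tendsto_meanValue u) fun _ => integral_nonneg hu

theorem meanValue_one : meanValue (1 : AP V) = 1 := by
  refine tendsto_nhds_unique (tendsto_meanValue 1) (tendsto_const_nhds.congr' ?_)
  filter_upwards [eventually_gt_atTop 0] with r hr
  have := isProbabilityMeasure_unifBall (V := V) hr
  simp

end Mean

section Spectrum
variable (V : Type*) [NormedAddCommGroup V]

/-- The spectrum of `AP(V)`: its nonzero multiplicative linear forms, with the weak-* topology. -/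
abbrev BohrSpace : Type _ := WeakDual.characterSpace ℝ (AP V)

noncomputable instance : MeasurableSpace (BohrSpace V) := borel _
instance : BorelSpace (BohrSpace V) := ⟨rfl⟩

variable {V}
/-- The Dirac mass `δ_y`, `u ↦ u(y)`. -/
noncomputable def dirac (y : V) : BohrSpace V :=
  WeakDual.CharacterSpace.equivAlgHom.symm
    ({ toFun := fun u => u y
       map_one' := rfl
       map_mul' := fun _ _ => rfl
       map_zero' := rfl
       map_add' := fun _ _ => rfl
       commutes' := fun _ => rfl } : AP V →ₐ[ℝ] ℝ)

@[simp] theorem dirac_apply (y : V) (u : AP V) : dirac y u = u y := rfl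

theorem abs_character_le (s : BohrSpace V) (u : AP V) : |s u| ≤ ‖u‖ :=
  AlgHom.norm_apply_le_self (WeakDual.CharacterSpace.toAlgHom s) u

theorem gelfand_bijective : Function.Bijective (WeakDual.gelfandTransform ℝ (AP V)) := by
  set G := WeakDual.gelfandTransform ℝ (AP V) with hG
  have hnorm : ∀ u, ‖G u‖ = ‖u‖ := fun u => by
    refine le_antisymm ((ContinuousMap.norm_le _ (norm_nonneg u)).2 fun s => abs_character_le s u)
      (AP.norm_le u (norm_nonneg _) fun y => ?_)
    exact (G u).norm_coe_le_norm (dirac y)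
  have hiso : Isometry G := AddMonoidHomClass.isometry_of_norm G hnorm
  refine ⟨hiso.injective, fun φ => ?_⟩
  have hcl : IsClosed (G.range : Set C(BohrSpace V, ℝ)) := by
    rw [AlgHom.coe_range]; exact hiso.isClosedEmbedding.isClosed_range
  have htop := ContinuousMap.subalgebra_topologicalClosure_eq_top_of_separatesPoints G.range ?_
  · have : φ ∈ G.range.topologicalClosure := htop ▸ Algebra.mem_top
    rw [← SetLike.mem_coe, Subalgebra.topologicalClosure_coe, hcl.closure_eq] at this
    exact this
  · intro s r hsr
    by_contra! h
    refine hsr (Subtype.ext (ContinuousLinearMap.ext fun u => ?_))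
    exact h (G u) ⟨G u, ⟨u, rfl⟩, rfl⟩

/-- The Gelfand transformation `𝒢 : AP(V) → C(K)`, `𝒢(u)(s) = s(u)`. -/
noncomputable def gelfand : AP V ≃ₐ[ℝ] C(BohrSpace V, ℝ) :=
  AlgEquiv.ofBijective (WeakDual.gelfandTransform ℝ (AP V)) gelfand_bijective

@[simp] theorem gelfand_apply (u : AP V) (s : BohrSpace V) : gelfand u s = s u := rfl

variable [NormedSpace ℝ V] [FiniteDimensional ℝ V]
  [MeasureSpace V] [BorelSpace V] [(volume : Measure V).IsAddHaarMeasure]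

open CompactlySupported in
/-- The mean value as a positive linear functional on `C(K)`, through the Gelfand isomorphism.
Since `K` is compact, `C_c(K)` is `C(K)`. -/
noncomputable def meanFunctional : C_c(BohrSpace V, ℝ) →ₚ[ℝ] ℝ :=
  PositiveLinearMap.mk₀
    { toFun := fun φ => meanValue (gelfand.symm (φ : C(BohrSpace V, ℝ)))
      map_add' := fun φ ψ => by
        rw [← meanValue_add, ← map_add]; rfl
      map_smul' := fun c φ => by
        rw [RingHom.id_apply, smul_eq_mul, ← meanValue_smul, ← map_smul]; rfl }
    fun φ hφ => meanValue_nonneg _ fun y => by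
      have h := gelfand_apply (gelfand.symm (φ : C(BohrSpace V, ℝ))) (dirac y)
      rw [AlgEquiv.apply_symm_apply, dirac_apply] at h
      exact h ▸ hφ (dirac y)

variable (V) in
/-- The Radon probability measure `β` on `K` that represents the mean value:
`M(u) = ∫ 𝒢(u) dβ` (it is the Haar measure of the compact group `K`). -/
noncomputable def bohrMeasure : Measure (BohrSpace V) := RealRMK.rieszMeasure meanFunctional

open CompactlySupported in
theorem integral_gelfand (u : AP V) : ∫ s, gelfand u s ∂(bohrMeasure V) = meanValue u := by
  have h := RealRMK.integral_rieszMeasure (meanFunctional (V := V))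
    (CompactlySupportedContinuousMap.continuousMapEquiv (gelfand u))
  have e : meanFunctional (CompactlySupportedContinuousMap.continuousMapEquiv (gelfand u))
      = meanValue u := congrArg meanValue (gelfand.symm_apply_apply u)
  exact h.trans e

instance : IsProbabilityMeasure (bohrMeasure V) := by
  have : IsFiniteMeasure (bohrMeasure V) :=
    inferInstanceAs (IsFiniteMeasure (RealRMK.rieszMeasure meanFunctional))
  have h := integral_gelfand (1 : AP V)
  rw [meanValue_one] at h
  simp only [map_one, ContinuousMap.one_apply, integral_const, smul_eq_mul, mul_one] at h
  exact ⟨by rw [← ENNReal.toReal_eq_one_iff]; exact h⟩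

end Spectrum

section Besicovitch
variable {V : Type*} [NormedAddCommGroup V] [NormedSpace ℝ V] [FiniteDimensional ℝ V]
  [MeasureSpace V] [BorelSpace V] [(volume : Measure V).IsAddHaarMeasure]

/-- The Besicovitch seminorm
`‖u‖_p = limsup_{r → ∞} (|B_r|⁻¹ ∫_{B_r} |u(y)|^p dy)^{1/p}`, used for `1 ≤ p < ∞`. -/
noncomputable def besNorm (p : ℝ≥0∞) (u : V → ℝ) : ℝ≥0∞ :=
  limsup (fun r : ℝ => eLpNorm u p (unifBall V r)) atTop

theorem unifBall_absolutelyContinuous (r : ℝ) : unifBall V r ≪ volume :=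
  (Measure.smul_absolutelyContinuous).trans Measure.restrict_le_self.absolutelyContinuous

theorem besNorm_add_le {p : ℝ≥0∞} (hp : 1 ≤ p) {u v : V → ℝ} (hu : AEStronglyMeasurable u volume)
    (hv : AEStronglyMeasurable v volume) : besNorm p (u + v) ≤ besNorm p u + besNorm p v := by
  refine ENNReal.le_of_forall_pos_le_add fun η hη hfin => ?_
  have hη2 : (0 : ℝ≥0∞) < (η / 2 : NNReal) := by simpa [pos_iff_ne_zero] using hη.ne'
  have hu' : besNorm p u < besNorm p u + (η / 2 : NNReal) :=
    ENNReal.lt_add_right (ne_top_of_le_ne_top hfin.ne le_self_add) hη2.ne'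
  have hv' : besNorm p v < besNorm p v + (η / 2 : NNReal) :=
    ENNReal.lt_add_right (ne_top_of_le_ne_top hfin.ne le_add_self) hη2.ne'
  refine limsup_le_of_le (by isBoundedDefault) ?_
  filter_upwards [eventually_lt_of_limsup_lt hu', eventually_lt_of_limsup_lt hv'] with r h1 h2
  refine (eLpNorm_add_le (hu.mono_ac (unifBall_absolutelyContinuous r))
    (hv.mono_ac (unifBall_absolutelyContinuous r)) hp).trans ((add_le_add h1.le h2.le).trans ?_)
  rw [add_add_add_comm, ← ENNReal.coe_add, add_halves]

theorem besNorm_smul (p : ℝ≥0∞) (c : ℝ) (u : V → ℝ) : besNorm p (c • u) = ‖c‖ₑ * besNorm p u := by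
  simp only [besNorm, eLpNorm_const_smul]
  exact ENNReal.limsup_const_mul_of_ne_top enorm_ne_top

theorem besNorm_zero (p : ℝ≥0∞) : besNorm p (0 : V → ℝ) = 0 := by simp [besNorm]

theorem besNorm_AP_lt_top (p : ℝ≥0∞) (g : AP V) : besNorm p g < ∞ := by
  refine lt_of_le_of_lt (b := ENNReal.ofReal ‖g‖) (limsup_le_of_le (by isBoundedDefault) ?_)
    ENNReal.ofReal_lt_top
  filter_upwards [eventually_gt_atTop 0] with r hr
  have := isProbabilityMeasure_unifBall (V := V) hr
  simpa using eLpNorm_le_of_ae_bound (p := p) (μ := unifBall V r) (f := g) (C := ‖g‖)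
    (ae_of_all _ fun y => g.abs_apply_le y)

theorem AP.aestronglyMeasurable (g : AP V) : AEStronglyMeasurable g (volume : Measure V) :=
  g.toBCF.continuous.aestronglyMeasurable

variable (V) in
/-- The space `B^p_AP(V)` of Besicovitch almost periodic functions: the closure of `AP(V)` for the
Besicovitch seminorm. -/
noncomputable def besSubmodule (p : ℝ≥0∞) [hp : Fact (1 ≤ p)] : Submodule ℝ (V → ℝ) where
  carrier := {u | AEStronglyMeasurable u volume ∧
    ∀ η : ℝ≥0∞, 0 < η → ∃ g : AP V, besNorm p (u - ⇑g) < η}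
  zero_mem' := ⟨aestronglyMeasurable_const, fun η hη => ⟨0, by
    have : ((0 : V → ℝ) - ((0 : AP V) : V → ℝ)) = 0 := by ext y; simp; rfl
    rw [this, besNorm_zero]; exact hη⟩⟩
  add_mem' := by
    rintro u v ⟨hu, hu'⟩ ⟨hv, hv'⟩
    refine ⟨hu.add hv, fun η hη => ?_⟩
    obtain ⟨g, hg⟩ := hu' (η / 2) (ENNReal.half_pos hη.ne')
    obtain ⟨h, hh⟩ := hv' (η / 2) (ENNReal.half_pos hη.ne')
    refine ⟨g + h, ?_⟩
    have : (u + v - ((g + h : AP V) : V → ℝ)) = (u - ⇑g) + (v - ⇑h) := by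
      ext y; simp; ring
    rw [this]
    refine (besNorm_add_le hp.out (hu.sub g.aestronglyMeasurable)
      (hv.sub h.aestronglyMeasurable)).trans_lt ?_
    calc _ < η / 2 + η / 2 := ENNReal.add_lt_add hg hh
      _ = η := ENNReal.add_halves η
  smul_mem' := by
    rintro c u ⟨hu, hu'⟩
    refine ⟨hu.const_smul c, fun η hη => ?_⟩
    obtain ⟨g, hg⟩ := hu' (η / (‖c‖ₑ + 1)) (ENNReal.div_pos hη.ne' (by simp))
    refine ⟨c • g, ?_⟩
    have : (c • u - ((c • g : AP V) : V → ℝ)) = c • (u - ⇑g) := by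
      ext y; simp; ring
    rw [this, besNorm_smul]
    by_cases hc : c = 0
    · simpa [hc] using hη
    have hc' : ‖c‖ₑ ≠ 0 := by simpa using hc
    calc ‖c‖ₑ * besNorm p (u - ⇑g) < ‖c‖ₑ * (η / (‖c‖ₑ + 1)) :=
          (ENNReal.mul_lt_mul_iff_right hc' enorm_ne_top).2 hg
      _ ≤ (‖c‖ₑ + 1) * (η / (‖c‖ₑ + 1)) := by gcongr; exact le_self_add
      _ ≤ η := ENNReal.mul_div_le

theorem besNorm_lt_top {p : ℝ≥0∞} [hp : Fact (1 ≤ p)] {u : V → ℝ} (hu : u ∈ besSubmodule V p) :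
    besNorm p u < ∞ := by
  obtain ⟨g, hg⟩ := hu.2 1 one_pos
  have h := besNorm_add_le hp.out (hu.1.sub g.aestronglyMeasurable) g.aestronglyMeasurable
  rw [sub_add_cancel] at h
  exact h.trans_lt (ENNReal.add_lt_top.2 ⟨hg.trans ENNReal.one_lt_top, besNorm_AP_lt_top p g⟩)

theorem AP.mem_besSubmodule (p : ℝ≥0∞) [Fact (1 ≤ p)] (g : AP V) :
    (g : V → ℝ) ∈ besSubmodule V p :=
  ⟨g.aestronglyMeasurable, fun η hη => ⟨g, by rw [sub_self, besNorm_zero]; exact hη⟩⟩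

variable (V) in
/-- `B^p_AP(V)` as a type, with the Besicovitch seminorm. -/
def BesFun (p : ℝ≥0∞) [Fact (1 ≤ p)] : Type _ := ↥(besSubmodule V p)

noncomputable instance (p : ℝ≥0∞) [Fact (1 ≤ p)] : AddCommGroup (BesFun V p) :=
  inferInstanceAs (AddCommGroup (besSubmodule V p))

noncomputable instance (p : ℝ≥0∞) [Fact (1 ≤ p)] : Module ℝ (BesFun V p) :=
  inferInstanceAs (Module ℝ (besSubmodule V p))

noncomputable instance (p : ℝ≥0∞) [Fact (1 ≤ p)] : SeminormedAddCommGroup (BesFun V p) :=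
  AddGroupSeminorm.toSeminormedAddCommGroup
    { toFun := fun u => (besNorm p u.1).toReal
      map_zero' := by
        have : ((0 : BesFun V p).1 : V → ℝ) = 0 := rfl
        rw [this, besNorm_zero, ENNReal.toReal_zero]
      add_le' := fun u v => by
        rw [← ENNReal.toReal_add (besNorm_lt_top u.2).ne (besNorm_lt_top v.2).ne]
        exact ENNReal.toReal_mono
          (ENNReal.add_lt_top.2 ⟨besNorm_lt_top u.2, besNorm_lt_top v.2⟩).ne
          (besNorm_add_le Fact.out u.2.1 v.2.1)
      neg' := fun u => by
        have : ((-u).1 : V → ℝ) = (-1 : ℝ) • u.1 := by ext y; simp; rfl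
        rw [this, besNorm_smul]; simp }

theorem BesFun.norm_def {p : ℝ≥0∞} [Fact (1 ≤ p)] (u : BesFun V p) :
    ‖u‖ = (besNorm p u.1).toReal := rfl

noncomputable instance (p : ℝ≥0∞) [Fact (1 ≤ p)] : NormedSpace ℝ (BesFun V p) where
  norm_smul_le c u := by
    rw [BesFun.norm_def, BesFun.norm_def]
    have : ((c • u).1 : V → ℝ) = c • u.1 := rfl
    rw [this, besNorm_smul, ENNReal.toReal_mul]; simp

variable (V) in
/-- The normed space `𝓑^p_AP(V)`: the quotient of `B^p_AP(V)` by the functions of zero seminorm. -/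
abbrev Bes (p : ℝ≥0∞) [Fact (1 ≤ p)] : Type _ := SeparationQuotient (BesFun V p)

/-- The class in `𝓑^p_AP(V)` of an almost periodic function. -/
noncomputable def AP.toBes (p : ℝ≥0∞) [Fact (1 ≤ p)] (g : AP V) : Bes V p :=
  SeparationQuotient.mk (⟨g, g.mem_besSubmodule p⟩ : besSubmodule V p)

end Besicovitch

section TwoVariables
variable {V W : Type*} [NormedAddCommGroup V] [NormedAddCommGroup W]

/-- The translate `u(· + a)` of an almost periodic function. -/
def AP.shift (a : V) (u : AP V) : AP V :=
  AP.mk (translate a u.toBCF) (isAlmostPeriodic_of_subset u.isAlmostPeriodic fun b => by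
    have : translate b (translate a u.toBCF) = translate (b + a) u.toBCF := by
      ext y; simp [add_assoc]
    rw [this]; exact mem_orbitClosure _ _)

@[simp] theorem AP.shift_apply (a : V) (u : AP V) (y : V) : u.shift a y = u (y + a) := rfl

theorem AP.continuous_shift (u : AP V) : Continuous fun a : V => u.shift a :=
  Continuous.subtype_mk (continuous_translate u.isAlmostPeriodic) _

theorem AP.exists_finset_shift (u : AP V) {η : ℝ} (hη : 0 < η) :
    ∃ F : Finset V, ∀ a : V, ∃ b ∈ F, dist (u.shift a) (u.shift b) < η :=
  exists_bounded_translate u.isAlmostPeriodic hη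

/-- Continuous operations that intertwine translations preserve almost periodicity. -/
theorem isAlmostPeriodic_of_intertwine (Φ : AP V → (W →ᵇ ℝ)) (hΦ : Continuous Φ) (u : AP V)
    (h : ∀ b, ∃ a, translate b (Φ u) = Φ (u.shift a)) : IsAlmostPeriodic (Φ u) := by
  have hemb : IsClosedEmbedding (Subtype.val : AP V → (V →ᵇ ℝ)) :=
    isClosed_apSubalgebra.isClosedEmbedding_subtypeVal
  refine isAlmostPeriodic_of_subset ((hemb.isCompact_preimage u.isAlmostPeriodic).image hΦ)
    fun b => ?_
  obtain ⟨a, ha⟩ := h b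
  exact ⟨u.shift a, mem_orbitClosure _ a, ha.symm⟩

/-- The bounded continuous function `u(y, ·)`. -/
noncomputable def AP.sliceBCF (y : V) (u : AP (WithLp 2 (V × W))) : W →ᵇ ℝ :=
  u.toBCF.compContinuous ⟨fun w => WithLp.toLp 2 (y, w), by fun_prop⟩

theorem AP.dist_sliceBCF_le (y : V) (u v : AP (WithLp 2 (V × W))) :
    dist (u.sliceBCF y) (v.sliceBCF y) ≤ dist u v :=
  (BoundedContinuousFunction.dist_le dist_nonneg).2 fun _ =>
    BoundedContinuousFunction.dist_coe_le_dist (f := u.toBCF) (g := v.toBCF) _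

/-- The partial function `u(y, ·)` of an almost periodic function `u` of two variables. -/
noncomputable def AP.slice (y : V) (u : AP (WithLp 2 (V × W))) : AP W :=
  AP.mk (u.sliceBCF y) <| isAlmostPeriodic_of_intertwine _
    (LipschitzWith.mk_one (AP.dist_sliceBCF_le y)).continuous u fun b =>
      ⟨WithLp.toLp 2 (0, b), by
        ext w
        change u (WithLp.toLp 2 (y, w + b)) = u (WithLp.toLp 2 (y, w) + WithLp.toLp 2 (0, b))
        rw [← WithLp.toLp_add]; simp⟩

@[simp] theorem AP.slice_apply (y : V) (u : AP (WithLp 2 (V × W))) (w : W) :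
    u.slice y w = u (WithLp.toLp 2 (y, w)) := rfl

theorem AP.dist_slice_le (y : V) (u v : AP (WithLp 2 (V × W))) :
    dist (u.slice y) (v.slice y) ≤ dist u v := AP.dist_sliceBCF_le y u v

theorem AP.slice_shift (y a : V) (u : AP (WithLp 2 (V × W))) :
    (u.shift (WithLp.toLp 2 (a, 0))).slice y = u.slice (y + a) := by
  ext w
  change u (WithLp.toLp 2 (y, w) + WithLp.toLp 2 (a, 0)) = u (WithLp.toLp 2 (y + a, w))
  rw [← WithLp.toLp_add]; simp

theorem AP.continuous_slice (u : AP (WithLp 2 (V × W))) : Continuous fun y : V => u.slice y := by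
  have h : (fun y : V => u.slice y)
      = fun y : V => (u.shift (WithLp.toLp 2 (y, 0))).slice 0 := by
    ext1 y; rw [AP.slice_shift, zero_add]
  rw [h]
  exact (LipschitzWith.mk_one (AP.dist_slice_le (0 : V))).continuous.comp
    (u.continuous_shift.comp (by fun_prop))

theorem abs_character_sub_le (r : BohrSpace W) (u v : AP W) : |r u - r v| ≤ dist u v := by
  rw [← map_sub, dist_eq_norm]; exact abs_character_le r _

/-- The bounded continuous function `y ↦ r(u(y, ·))`. -/
noncomputable def AP.partialBCF (r : BohrSpace W) (u : AP (WithLp 2 (V × W))) : V →ᵇ ℝ :=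
  BoundedContinuousFunction.ofNormedAddCommGroup (fun y => r (u.slice y))
    ((map_continuous r).comp u.continuous_slice) ‖u‖ fun _ =>
      (abs_character_le r _).trans (AP.norm_le _ (norm_nonneg u) fun _ => u.abs_apply_le _)

@[simp] theorem AP.partialBCF_apply (r : BohrSpace W) (u : AP (WithLp 2 (V × W))) (y : V) :
    u.partialBCF r y = r (u.slice y) := rfl

/-- The almost periodic function `y ↦ r(u(y, ·))`, i.e. the Gelfand transformation of `u` with
respect to the second variable, at the character `r`. -/
noncomputable def AP.partialGelfand (r : BohrSpace W) (u : AP (WithLp 2 (V × W))) : AP V :=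
  AP.mk (u.partialBCF r) <| isAlmostPeriodic_of_intertwine _
    (LipschitzWith.mk_one fun u v => (BoundedContinuousFunction.dist_le dist_nonneg).2 fun y => by
      exact (abs_character_sub_le r _ _).trans (AP.dist_slice_le y u v)).continuous u fun b =>
      ⟨WithLp.toLp 2 (b, 0), by
        ext y
        rw [AP.partialBCF_apply, AP.slice_shift]; rfl⟩

@[simp] theorem AP.partialGelfand_apply (r : BohrSpace W) (u : AP (WithLp 2 (V × W))) (y : V) :
    u.partialGelfand r y = r (u.slice y) := rfl

theorem AP.continuous_partialGelfand (u : AP (WithLp 2 (V × W))) :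
    Continuous fun r : BohrSpace W => u.partialGelfand r := by
  refine Metric.continuous_iff'.2 fun r₀ η hη => ?_
  obtain ⟨F, hF⟩ := u.exists_finset_shift (η := η / 4) (by positivity)
  have h1 : ∀ᶠ r in 𝓝 r₀, ∀ b ∈ F, |r ((u.shift b).slice 0) - r₀ ((u.shift b).slice 0)| < η / 4 := by
    refine (Finset.eventually_all F).2 fun b _ => ?_
    have := (WeakDual.gelfandTransform ℝ (AP W) ((u.shift b).slice 0)).continuous.tendsto r₀
    exact Metric.tendsto_nhds.1 this _ (by positivity)
  filter_upwards [h1] with r hr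
  rw [dist_eq_norm]
  refine lt_of_le_of_lt (AP.norm_le _ (C := 3 * (η / 4)) (by positivity) fun y => ?_) (by linarith)
  obtain ⟨b, hb, hab⟩ := hF (WithLp.toLp 2 (y, 0))
  have e := AP.slice_shift (0 : V) y u
  rw [zero_add] at e
  have hd := (AP.dist_slice_le (0 : V) _ _).trans hab.le
  rw [e] at hd
  have k1 := (abs_character_sub_le r _ _).trans hd
  have k2 := (abs_character_sub_le r₀ _ _).trans hd
  have k3 := hr b hb
  rw [AP.sub_apply, AP.partialGelfand_apply, AP.partialGelfand_apply]
  rw [abs_le] at k1 k2 ⊢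
  rw [abs_lt] at k3
  constructor <;> linarith [k1.1, k1.2, k2.1, k2.2, k3.1, k3.2]

/-- The identification of `K_V × K_W` with the spectrum of `AP(V × W)`: the pair `(s, r)` is the
character `u ↦ s(y ↦ r(u(y, ·)))`. For `s = δ_y` and `r = δ_w` this is `δ_(y, w)`. -/
noncomputable def prodCharacter (s : BohrSpace V) (r : BohrSpace W) :
    BohrSpace (WithLp 2 (V × W)) :=
  WeakDual.CharacterSpace.equivAlgHom.symm
    ({ toFun := fun u => s (u.partialGelfand r)
       map_one' := by
         have : (1 : AP (WithLp 2 (V × W))).partialGelfand r = 1 := by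
           ext y
           have : (1 : AP (WithLp 2 (V × W))).slice y = 1 := rfl
           rw [AP.partialGelfand_apply, this, map_one, AP.one_apply]
         rw [this, map_one]
       map_mul' := fun u v => by
         have : (u * v).partialGelfand r = u.partialGelfand r * v.partialGelfand r := by
           ext y
           have : (u * v).slice y = u.slice y * v.slice y := rfl
           rw [AP.partialGelfand_apply, this, map_mul]; rfl
         rw [this, map_mul]
       map_zero' := by
         have : (0 : AP (WithLp 2 (V × W))).partialGelfand r = 0 := by
           ext y
           have : (0 : AP (WithLp 2 (V × W))).slice y = 0 := rfl
           rw [AP.partialGelfand_apply, this, map_zero]; rfl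
         rw [this, map_zero]
       map_add' := fun u v => by
         have : (u + v).partialGelfand r = u.partialGelfand r + v.partialGelfand r := by
           ext y
           have : (u + v).slice y = u.slice y + v.slice y := rfl
           rw [AP.partialGelfand_apply, this, map_add]; rfl
         rw [this, map_add]
       commutes' := fun c => by
         have : (algebraMap ℝ (AP (WithLp 2 (V × W))) c).partialGelfand r
             = algebraMap ℝ (AP V) c := by
           ext y
           have : (algebraMap ℝ (AP (WithLp 2 (V × W))) c).slice y = algebraMap ℝ (AP W) c := rfl
           rw [AP.partialGelfand_apply, this, AlgHomClass.commutes]; rfl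
         rw [this, AlgHomClass.commutes] } : AP (WithLp 2 (V × W)) →ₐ[ℝ] ℝ)

theorem prodCharacter_apply (s : BohrSpace V) (r : BohrSpace W) (u : AP (WithLp 2 (V × W))) :
    prodCharacter s r u = s (u.partialGelfand r) := rfl

theorem prodCharacter_dirac (y : V) (w : W) :
    prodCharacter (dirac y) (dirac w) = dirac (WithLp.toLp 2 (y, w)) :=
  Subtype.ext (ContinuousLinearMap.ext fun _ => rfl)

theorem continuous_prodCharacter (u : AP (WithLp 2 (V × W))) :
    Continuous fun q : BohrSpace V × BohrSpace W => prodCharacter q.1 q.2 u := by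
  refine continuous_iff_continuousAt.2 fun ⟨s₀, r₀⟩ => Metric.tendsto_nhds.2 fun η hη => ?_
  have h1 := Metric.continuous_iff'.1 u.continuous_partialGelfand r₀ (η / 2) (by positivity)
  have h2 : ∀ᶠ s in 𝓝 s₀, |s (u.partialGelfand r₀) - s₀ (u.partialGelfand r₀)| < η / 2 := by
    have := (WeakDual.gelfandTransform ℝ (AP V) (u.partialGelfand r₀)).continuous.tendsto s₀
    exact Metric.tendsto_nhds.1 this _ (by positivity)
  rw [nhds_prod_eq]
  filter_upwards [h2.prod_mk h1] with ⟨s, r⟩ ⟨hs, hr⟩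
  have h3 := abs_character_sub_le s (u.partialGelfand r) (u.partialGelfand r₀)
  have h4 := abs_sub_le (s (u.partialGelfand r)) (s (u.partialGelfand r₀)) (s₀ (u.partialGelfand r₀))
  rw [Real.dist_eq, prodCharacter_apply, prodCharacter_apply]
  simp only at hs hr ⊢
  linarith

/-- The Gelfand transform of an almost periodic function of two variables, as a continuous function
on `K_V × K_W`. -/
noncomputable def gelfandProd (u : AP (WithLp 2 (V × W))) : C(BohrSpace V × BohrSpace W, ℝ) :=
  ⟨fun q => gelfand u (prodCharacter q.1 q.2), continuous_prodCharacter u⟩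

/-- Continuous functions on a product of compact Hausdorff spaces are measurable for the product of
the Borel sigma-algebras. -/
theorem measurable_continuousMap_prod {X Y : Type*} [TopologicalSpace X] [TopologicalSpace Y]
    [CompactSpace X] [CompactSpace Y] [T2Space X] [T2Space Y] [MeasurableSpace X]
    [MeasurableSpace Y] [BorelSpace X] [BorelSpace Y] (φ : C(X × Y, ℝ)) : Measurable φ := by
  let A : Subalgebra ℝ C(X × Y, ℝ) :=
    { carrier := {φ | Measurable φ}
      mul_mem' := fun h k => Measurable.mul h k
      add_mem' := fun h k => Measurable.add h k
      algebraMap_mem' := fun _ => measurable_const }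
  have hcl : IsClosed (A : Set C(X × Y, ℝ)) := by
    refine isSeqClosed_iff_isClosed.1 fun φ ψ hφ hψ => ?_
    refine measurable_of_tendsto_metrizable (f := fun n => ⇑(φ n)) hφ (tendsto_pi_nhds.2 fun q => ?_)
    exact (continuous_eval_const q).continuousAt.tendsto.comp hψ
  have htop := ContinuousMap.subalgebra_topologicalClosure_eq_top_of_separatesPoints A ?_
  · have : φ ∈ A.topologicalClosure := htop ▸ Algebra.mem_top
    rw [← SetLike.mem_coe, Subalgebra.topologicalClosure_coe, hcl.closure_eq] at this
    exact this
  · rintro ⟨x, y⟩ ⟨x', y'⟩ hne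
    by_cases hx : x = x'
    · have hy : y ≠ y' := fun h => hne (by rw [hx, h])
      obtain ⟨f, hf0, hf1, -⟩ := exists_continuous_zero_one_of_isClosed
        (isClosed_singleton (x := y)) (isClosed_singleton (x := y')) (by simpa using hy)
      refine ⟨_, ⟨f.comp ⟨Prod.snd, continuous_snd⟩, f.continuous.measurable.comp measurable_snd,
        rfl⟩, ?_⟩
      simp [hf0 (mem_singleton y), hf1 (mem_singleton y')]
    · obtain ⟨f, hf0, hf1, -⟩ := exists_continuous_zero_one_of_isClosed
        (isClosed_singleton (x := x)) (isClosed_singleton (x := x')) (by simpa using hx)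
      refine ⟨_, ⟨f.comp ⟨Prod.fst, continuous_fst⟩, f.continuous.measurable.comp measurable_fst,
        rfl⟩, ?_⟩
      simp [hf0 (mem_singleton x), hf1 (mem_singleton x')]

theorem memLp_continuousMap_prod {X Y : Type*} [TopologicalSpace X] [TopologicalSpace Y]
    [CompactSpace X] [CompactSpace Y] [T2Space X] [T2Space Y] [MeasurableSpace X]
    [MeasurableSpace Y] [BorelSpace X] [BorelSpace Y] (φ : C(X × Y, ℝ)) (p : ℝ≥0∞)
    (μ : Measure (X × Y)) [IsFiniteMeasure μ] : MemLp φ p μ :=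
  MemLp.of_bound (measurable_continuousMap_prod φ).aestronglyMeasurable ‖φ‖
    (ae_of_all _ fun q => φ.norm_coe_le_norm q)

end TwoVariables

section ProductMean

section Uniqueness
variable {V : Type*} [NormedAddCommGroup V] [NormedSpace ℝ V] [FiniteDimensional ℝ V]
  [MeasureSpace V] [BorelSpace V] [(volume : Measure V).IsAddHaarMeasure]

theorem meanValue_shift (a : V) (u : AP V) : meanValue (u.shift a) = meanValue u := by
  refine tendsto_nhds_unique (tendsto_meanValue (u.shift a)) ?_
  have h : Tendsto (fun r : ℝ => (∫ y, u (y + a) ∂(unifBall V r)) - ∫ y, u y ∂(unifBall V r)) atTop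
      (𝓝 0) := by
    refine Metric.tendsto_nhds.2 fun η hη => ?_
    filter_upwards [eventually_shift u.isAlmostPeriodic (η := η / 2) (by positivity)] with r hr
    rw [Real.dist_eq, sub_zero]
    linarith [hr a]
  simpa using h.add (tendsto_meanValue u)

/-- Evaluation at a point as a continuous linear form on `AP(V)`. -/
noncomputable def evalCLM (y : V) : AP V →L[ℝ] ℝ :=
  (WeakDual.CharacterSpace.toAlgHom (dirac y)).toContinuousLinearMap

/-- The mean value is the only translation invariant continuous linear form with value `1` at `1`. -/
theorem eq_meanValue (L : AP V →L[ℝ] ℝ) (h1 : L 1 = 1) (hL : ∀ a u, L (u.shift a) = L u)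
    (u : AP V) : L u = meanValue u := by
  have key : ∀ η > 0, |L u - meanValue u| ≤ ‖L‖ * η + η := fun η hη => by
    obtain ⟨r, hr, hr2, hr0⟩ := ((eventually_shift u.isAlmostPeriodic hη).and
      ((Metric.tendsto_nhds.1 (tendsto_meanValue u) η hη).and (eventually_gt_atTop 0))).exists
    have := isProbabilityMeasure_unifBall (V := V) hr0
    have hint : Integrable (fun a : V => u.shift a) (unifBall V r) := by
      refine Integrable.of_bound u.continuous_shift.aestronglyMeasurable ‖u‖
        (ae_of_all _ fun a => AP.norm_le _ (norm_nonneg u) fun y => u.abs_apply_le _)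
    set w : AP V := ∫ a, u.shift a ∂(unifBall V r)
    have hLw : L w = L u := by
      rw [← L.integral_comp_comm hint]; simp [hL]
    have hw : ‖w - (∫ y, u y ∂(unifBall V r)) • (1 : AP V)‖ ≤ η := by
      refine AP.norm_le _ hη.le fun y => ?_
      have e : w y = ∫ a, u (a + y) ∂(unifBall V r) := by
        have := (evalCLM y).integral_comp_comm hint
        change _ = w y at this
        rw [← this]
        exact integral_congr_ae (ae_of_all _ fun a => congrArg u (add_comm y a))
      rw [AP.sub_apply, AP.smul_apply, AP.one_apply, mul_one, e]
      exact hr y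
    have h2 := L.le_opNorm (w - (∫ y, u y ∂(unifBall V r)) • (1 : AP V))
    rw [map_sub, map_smul, h1, smul_eq_mul, mul_one, hLw, Real.norm_eq_abs] at h2
    have h3 := mul_le_mul_of_nonneg_left hw (norm_nonneg L)
    rw [Real.dist_eq] at hr2
    linarith [abs_sub_le (L u) (∫ y, u y ∂(unifBall V r)) (meanValue u)]
  have h0 : |L u - meanValue u| ≤ 0 := by
    have ht : Tendsto (fun η : ℝ => ‖L‖ * η + η) (𝓝[>] 0) (𝓝 0) := by
      have : Continuous fun η : ℝ => ‖L‖ * η + η := by fun_prop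
      simpa using (this.tendsto 0).mono_left nhdsWithin_le_nhds
    exact ge_of_tendsto ht (eventually_mem_nhdsWithin.mono key)
  exact sub_eq_zero.1 (abs_nonpos_iff.1 h0)

end Uniqueness

variable {V W : Type*} [NormedAddCommGroup V] [InnerProductSpace ℝ V] [FiniteDimensional ℝ V]
  [MeasurableSpace V] [BorelSpace V] [NormedAddCommGroup W] [InnerProductSpace ℝ W]
  [FiniteDimensional ℝ W] [MeasurableSpace W] [BorelSpace W]

theorem integrable_gelfandProd (u : AP (WithLp 2 (V × W))) :
    Integrable (gelfandProd u) ((bohrMeasure V).prod (bohrMeasure W)) :=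
  memLp_one_iff_integrable.1 (memLp_continuousMap_prod _ _ _)

theorem integral_gelfandProd_shift_left (a : V) (u : AP (WithLp 2 (V × W))) :
    ∫ q, gelfandProd (u.shift (WithLp.toLp 2 (a, 0))) q ∂((bohrMeasure V).prod (bohrMeasure W))
      = ∫ q, gelfandProd u q ∂((bohrMeasure V).prod (bohrMeasure W)) := by
  rw [integral_prod_symm _ (integrable_gelfandProd _),
    integral_prod_symm _ (integrable_gelfandProd _)]
  refine integral_congr_ae (ae_of_all _ fun r => ?_)
  have e : (u.shift (WithLp.toLp 2 (a, 0))).partialGelfand r = (u.partialGelfand r).shift a := by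
    ext y
    rw [AP.partialGelfand_apply, AP.slice_shift]; rfl
  have h1 := integral_gelfand ((u.partialGelfand r).shift a)
  have h2 := integral_gelfand (u.partialGelfand r)
  rw [meanValue_shift, ← h2, ← e] at h1
  exact h1

theorem integral_gelfandProd_shift_right (b : W) (u : AP (WithLp 2 (V × W))) :
    ∫ q, gelfandProd (u.shift (WithLp.toLp 2 (0, b))) q ∂((bohrMeasure V).prod (bohrMeasure W))
      = ∫ q, gelfandProd u q ∂((bohrMeasure V).prod (bohrMeasure W)) := by
  have hint : ∀ v : AP (WithLp 2 (V × W)),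
      Integrable (fun r : BohrSpace W => v.partialGelfand r) (bohrMeasure W) := fun v =>
    v.continuous_partialGelfand.integrable_of_hasCompactSupport (HasCompactSupport.of_compactSpace _)
  have key : (∫ r, (u.shift (WithLp.toLp 2 (0, b))).partialGelfand r ∂(bohrMeasure W))
      = ∫ r, u.partialGelfand r ∂(bohrMeasure W) := by
    ext y
    have h : ∀ v : AP (WithLp 2 (V × W)),
        (∫ r, v.partialGelfand r ∂(bohrMeasure W)) y = meanValue (v.slice y) := fun v => by
      have := (evalCLM y).integral_comp_comm (hint v)
      rw [← integral_gelfand]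
      exact this.symm
    rw [h, h]
    have e : (u.shift (WithLp.toLp 2 (0, b))).slice y = (u.slice y).shift b := by
      ext w
      change u (WithLp.toLp 2 (y, w) + WithLp.toLp 2 (0, b)) = u (WithLp.toLp 2 (y, w + b))
      rw [← WithLp.toLp_add]; simp
    rw [e, meanValue_shift]
  rw [integral_prod _ (integrable_gelfandProd _), integral_prod _ (integrable_gelfandProd _)]
  refine integral_congr_ae (ae_of_all _ fun s => ?_)
  let S : AP V →L[ℝ] ℝ := (WeakDual.CharacterSpace.toAlgHom s).toContinuousLinearMap
  have h1 := S.integral_comp_comm (hint (u.shift (WithLp.toLp 2 (0, b))))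
  have h2 := S.integral_comp_comm (hint u)
  rw [key, ← h2] at h1
  exact h1

/-- The measure on `K_V × K_W` that represents the mean value on `AP(V × W)` is the product of the
measures on `K_V` and `K_W`. -/
theorem integral_gelfandProd (u : AP (WithLp 2 (V × W))) :
    ∫ q, gelfandProd u q ∂((bohrMeasure V).prod (bohrMeasure W)) = meanValue u := by
  let L : AP (WithLp 2 (V × W)) →L[ℝ] ℝ := LinearMap.mkContinuous
    { toFun := fun u => ∫ q, gelfandProd u q ∂((bohrMeasure V).prod (bohrMeasure W))
      map_add' := fun u v => by
        rw [← integral_add (integrable_gelfandProd u) (integrable_gelfandProd v)]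
        exact integral_congr_ae (ae_of_all _ fun q => map_add (prodCharacter q.1 q.2) u v)
      map_smul' := fun c u => by
        rw [RingHom.id_apply, ← integral_smul]
        exact integral_congr_ae (ae_of_all _ fun q => map_smul (prodCharacter q.1 q.2) c u) } 1
    fun u => by
      refine (norm_integral_le_of_norm_le_const (C := ‖u‖)
        (ae_of_all _ fun q => abs_character_le (prodCharacter q.1 q.2) u)).trans ?_
      simp
  refine eq_meanValue L ?_ (fun c v => ?_) u
  · change ∫ q, gelfandProd (1 : AP (WithLp 2 (V × W))) q ∂_ = 1
    have : ∀ q : BohrSpace V × BohrSpace W, gelfandProd (1 : AP (WithLp 2 (V × W))) q = 1 :=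
      fun q => map_one (prodCharacter q.1 q.2)
    simp [this]
  · have e : v.shift c
        = (v.shift (WithLp.toLp 2 (0, c.snd))).shift (WithLp.toLp 2 (c.fst, 0)) := by
      have e0 : WithLp.toLp 2 (c.fst, (0 : W)) + WithLp.toLp 2 ((0 : V), c.snd) = c := by
        rw [← WithLp.toLp_add, Prod.mk_add_mk, add_zero, zero_add]; rfl
      ext y
      rw [AP.shift_apply, AP.shift_apply, AP.shift_apply, add_assoc, e0]
    change ∫ q, gelfandProd (v.shift c) q ∂_ = ∫ q, gelfandProd v q ∂_
    rw [e, integral_gelfandProd_shift_left, integral_gelfandProd_shift_right]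

end ProductMean

section Extension
variable {V : Type*} [NormedAddCommGroup V] [NormedSpace ℝ V] [FiniteDimensional ℝ V]
  [MeasureSpace V] [BorelSpace V] [(volume : Measure V).IsAddHaarMeasure]
  {p : ℝ≥0∞} [Fact (1 ≤ p)]

/-- The extension by continuity to `𝓑^p_AP(V)` of a map defined on `AP(V)`. -/
noncomputable def extendBes {X : Type*} [TopologicalSpace X] [Nonempty X] (T : AP V → X)
    (u : Bes V p) : X :=
  limUnder (comap (AP.toBes p) (𝓝 u)) T

theorem AP.toBes_sub (g h : AP V) : (g - h).toBes p = g.toBes p - h.toBes p := rfl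

theorem AP.norm_toBes (g : AP V) : ‖g.toBes p‖ = (besNorm p g).toReal := rfl

theorem AP.denseRange_toBes : DenseRange (AP.toBes p : AP V → Bes V p) := by
  intro u
  obtain ⟨u, rfl⟩ := SeparationQuotient.surjective_mk u
  refine Metric.mem_closure_iff.2 fun η hη => ?_
  obtain ⟨g, hg⟩ := u.2.2 (ENNReal.ofReal η) (by simpa using hη)
  refine ⟨_, ⟨g, rfl⟩, ?_⟩
  rw [dist_eq_norm]
  change (besNorm p (u.1 - ⇑g)).toReal < η
  exact (ENNReal.lt_ofReal_iff_toReal_lt (hg.trans_le le_top).ne).1 hg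

/-- The extension by continuity of an isometric map is given by an honest limit. -/
theorem tendsto_extendBes {X : Type*} [MetricSpace X] [CompleteSpace X] [Nonempty X]
    {T : AP V → X} (hT : ∀ g h, dist (T g) (T h) = dist (g.toBes p) (h.toBes p)) (u : Bes V p) :
    Tendsto T (comap (AP.toBes p) (𝓝 u)) (𝓝 (extendBes T u)) := by
  have hne : NeBot (comap (AP.toBes p) (𝓝 u)) :=
    forall_mem_nonempty_iff_neBot.1 fun t ht => by
      obtain ⟨U, hU, hUt⟩ := mem_comap.1 ht
      obtain ⟨g, hg⟩ := AP.denseRange_toBes.exists_mem_open isOpen_interior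
        ⟨u, mem_interior_iff_mem_nhds.2 hU⟩
      exact ⟨g, hUt (show AP.toBes p g ∈ U from interior_subset hg)⟩
  refine tendsto_nhds_limUnder (cauchy_map_iff_exists_tendsto.1
    (Metric.cauchy_iff.2 ⟨inferInstance, fun η hη => ?_⟩))
  refine ⟨_, image_mem_map (preimage_mem_comap (ball_mem_nhds u (half_pos hη))), ?_⟩
  rintro _ ⟨g, hg, rfl⟩ _ ⟨h, hh, rfl⟩
  rw [hT]
  linarith [dist_triangle_right (g.toBes p) (h.toBes p) u, mem_ball.1 hg, mem_ball.1 hh]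

/-- `|g|^q` is almost periodic, and the characters commute with this operation. -/
theorem AP.exists_rpow (g : AP V) {q : ℝ} (hq : 0 ≤ q) :
    ∃ h : AP V, (∀ y, h y = |g y| ^ q) ∧ ∀ s : BohrSpace V, s h = |s g| ^ q := by
  let φ : C(BohrSpace V, ℝ) := ⟨fun s => |s g| ^ q,
    ((gelfand g).continuous.abs).rpow_const fun _ => Or.inr hq⟩
  have hs : ∀ s : BohrSpace V, s (gelfand.symm φ) = |s g| ^ q := fun s => by
    have := gelfand_apply (gelfand.symm φ) s
    rw [AlgEquiv.apply_symm_apply] at this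
    exact this.symm
  exact ⟨gelfand.symm φ, fun y => hs (dirac y), hs⟩

theorem AP.norm_toBes_eq (hp : p ≠ ∞) (g h : AP V) (hh : ∀ y, h y = |g y| ^ p.toReal) :
    ‖g.toBes p‖ = meanValue h ^ (p.toReal)⁻¹ := by
  have hp0 : p ≠ 0 := (zero_lt_one.trans_le (Fact.out : 1 ≤ p)).ne'
  have hp1 : 0 < p.toReal := ENNReal.toReal_pos hp0 hp
  have hlim : Tendsto (fun r : ℝ => eLpNorm g p (unifBall V r)) atTop
      (𝓝 (ENNReal.ofReal (meanValue h ^ (p.toReal)⁻¹))) := by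
    have h1 := ENNReal.tendsto_ofReal
      ((tendsto_meanValue h).rpow_const (p := (p.toReal)⁻¹) (Or.inr (by positivity)))
    refine h1.congr' ?_
    filter_upwards [eventually_gt_atTop 0] with r hr
    have := isProbabilityMeasure_unifBall (V := V) hr
    have hm : MemLp g p (unifBall V r) := MemLp.of_bound
      g.toBCF.continuous.aestronglyMeasurable ‖g‖ (ae_of_all _ fun y => g.abs_apply_le y)
    rw [hm.eLpNorm_eq_integral_rpow_norm hp0 hp]
    simp only [hh, Real.norm_eq_abs]
  rw [AP.norm_toBes, besNorm, hlim.limsup_eq, ENNReal.toReal_ofReal]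
  refine Real.rpow_nonneg (meanValue_nonneg _ fun y => ?_) _
  rw [hh]; positivity

theorem norm_toLp_eq_integral {X : Type*} [MeasurableSpace X] {μ : Measure X} (hp : p ≠ ∞)
    {f : X → ℝ} (hf : MemLp f p μ) :
    ‖hf.toLp f‖ = (∫ x, |f x| ^ p.toReal ∂μ) ^ (p.toReal)⁻¹ := by
  have hp0 : p ≠ 0 := (zero_lt_one.trans_le (Fact.out : 1 ≤ p)).ne'
  rw [Lp.norm_toLp, hf.eLpNorm_eq_integral_rpow_norm hp0 hp, ENNReal.toReal_ofReal]
  · simp only [Real.norm_eq_abs]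
  · exact Real.rpow_nonneg (integral_nonneg fun _ => by positivity) _

theorem memLp_gelfand (g : AP V) : MemLp (gelfand g) p (bohrMeasure V) :=
  MemLp.of_bound (gelfand g).continuous.aestronglyMeasurable ‖g‖
    (ae_of_all _ fun s => abs_character_le s g)

variable (p) in
/-- The Gelfand transform of an almost periodic function as an element of `L^p(K)`. -/
noncomputable def gelfandLp (g : AP V) : Lp ℝ p (bohrMeasure V) := (memLp_gelfand g).toLp _

theorem dist_gelfandLp (hp : p ≠ ∞) (g h : AP V) :
    dist (gelfandLp p g) (gelfandLp p h) = dist (g.toBes p) (h.toBes p) := by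
  rw [dist_eq_norm, dist_eq_norm, ← AP.toBes_sub]
  have e : gelfandLp p g - gelfandLp p h = gelfandLp p (g - h) := by
    rw [gelfandLp, gelfandLp, ← MemLp.toLp_sub]
    exact MemLp.toLp_congr _ _ (ae_of_all _ fun s => (map_sub s g h).symm)
  rw [e]
  obtain ⟨w, hw, hws⟩ := (g - h).exists_rpow (q := p.toReal) ENNReal.toReal_nonneg
  rw [AP.norm_toBes_eq hp _ w hw, ← integral_gelfand, gelfandLp, norm_toLp_eq_integral hp]
  simp only [gelfand_apply, hws]

/-- The transformation `𝒢₁ : 𝓑^p_AP(V) → L^p(K_V)`, `u ↦ û`: the extension by continuity of the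
Gelfand transformation. -/
noncomputable def hat (u : Bes V p) : Lp ℝ p (bohrMeasure V) := extendBes (gelfandLp p) u

theorem tendsto_hat (hp : p ≠ ∞) (u : Bes V p) :
    Tendsto (gelfandLp p) (comap (AP.toBes p) (𝓝 u)) (𝓝 (hat u)) :=
  tendsto_extendBes (dist_gelfandLp hp) u

end Extension

section ExtensionProd
variable {V W : Type*} [NormedAddCommGroup V] [InnerProductSpace ℝ V] [FiniteDimensional ℝ V]
  [MeasurableSpace V] [BorelSpace V] [NormedAddCommGroup W] [InnerProductSpace ℝ W]
  [FiniteDimensional ℝ W] [MeasurableSpace W] [BorelSpace W] {p : ℝ≥0∞} [Fact (1 ≤ p)]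

variable (p) in
/-- The Gelfand transform of an almost periodic function of two variables as an element of
`L^p(K_V × K_W)`. -/
noncomputable def gelfandProdLp (g : AP (WithLp 2 (V × W))) :
    Lp ℝ p ((bohrMeasure V).prod (bohrMeasure W)) :=
  (memLp_continuousMap_prod (gelfandProd g) p _).toLp _

theorem dist_gelfandProdLp (hp : p ≠ ∞) (g h : AP (WithLp 2 (V × W))) :
    dist (gelfandProdLp p g) (gelfandProdLp p h) = dist (g.toBes p) (h.toBes p) := by
  rw [dist_eq_norm, dist_eq_norm, ← AP.toBes_sub]
  have e : gelfandProdLp p g - gelfandProdLp p h = gelfandProdLp p (g - h) := by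
    rw [gelfandProdLp, gelfandProdLp, ← MemLp.toLp_sub]
    exact MemLp.toLp_congr _ _ (ae_of_all _ fun q => (map_sub (prodCharacter q.1 q.2) g h).symm)
  rw [e]
  obtain ⟨w, hw, hws⟩ := (g - h).exists_rpow (q := p.toReal) ENNReal.toReal_nonneg
  rw [AP.norm_toBes_eq hp _ w hw, ← integral_gelfandProd, gelfandProdLp, norm_toLp_eq_integral hp]
  congr 1
  exact integral_congr_ae (ae_of_all _ fun q => (hws (prodCharacter q.1 q.2)).symm)

/-- The transformation `𝒢₁ : 𝓑^p_AP(V × W) → L^p(K_V × K_W)`, `u ↦ û`: the extension by continuity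
of the Gelfand transformation. -/
noncomputable def hatProd (u : Bes (WithLp 2 (V × W)) p) :
    Lp ℝ p ((bohrMeasure V).prod (bohrMeasure W)) :=
  extendBes (gelfandProdLp p) u

theorem tendsto_hatProd (hp : p ≠ ∞) (u : Bes (WithLp 2 (V × W)) p) :
    Tendsto (gelfandProdLp p) (comap (AP.toBes p) (𝓝 u)) (𝓝 (hatProd u)) :=
  tendsto_extendBes (dist_gelfandProdLp hp) u

end ExtensionProd

section PartialIntegral
variable {X Y : Type*} [MeasurableSpace X] [MeasurableSpace Y] {μ : Measure X} {ν : Measure Y}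
  [IsProbabilityMeasure μ] [IsProbabilityMeasure ν] {p : ℝ≥0∞}

theorem memLp_partialIntegral (hp : 1 ≤ p) {f : X × Y → ℝ} (hf : MemLp f p (μ.prod ν)) :
    MemLp (fun x => ∫ y, f (x, y) ∂ν) p μ := by
  refine ⟨hf.1.integral_prod_right', ?_⟩
  by_cases hpt : p = ∞
  · subst hpt
    have h := ae_le_eLpNormEssSup (f := f) (μ := μ.prod ν)
    have h2 : ∀ᵐ x ∂μ, ‖∫ y, f (x, y) ∂ν‖ₑ ≤ eLpNormEssSup f (μ.prod ν) := by
      filter_upwards [Measure.ae_ae_of_ae_prod h] with x hx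
      refine (enorm_integral_le_lintegral_enorm _).trans ((lintegral_mono_ae hx).trans ?_)
      simp
    rw [eLpNorm_exponent_top]
    refine (essSup_le_of_ae_le _ h2).trans_lt ?_
    rw [← eLpNorm_exponent_top]; exact hf.2
  · have hp0 : p ≠ 0 := (zero_lt_one.trans_le hp).ne'
    have hp1 : 0 < p.toReal := ENNReal.toReal_pos hp0 hpt
    rw [eLpNorm_lt_top_iff_lintegral_rpow_enorm_lt_top hp0 hpt]
    have hfin := hf.2
    rw [eLpNorm_lt_top_iff_lintegral_rpow_enorm_lt_top hp0 hpt,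
      lintegral_prod _ (hf.1.enorm.pow_const _)] at hfin
    refine (lintegral_mono_ae ?_).trans_lt hfin
    filter_upwards [hf.1.prodMk_left] with x hx
    have h1 : ‖∫ y, f (x, y) ∂ν‖ₑ ≤ eLpNorm (fun y => f (x, y)) p ν := by
      refine (enorm_integral_le_lintegral_enorm _).trans ?_
      rw [← eLpNorm_one_eq_lintegral_enorm]
      exact eLpNorm_le_eLpNorm_of_exponent_le hp hx
    rw [eLpNorm_eq_lintegral_rpow_enorm_toReal hp0 hpt] at h1
    calc _ ≤ _ := ENNReal.rpow_le_rpow h1 hp1.le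
      _ = _ := by rw [← ENNReal.rpow_mul, one_div, inv_mul_cancel₀ hp1.ne', ENNReal.rpow_one]

/-- The partial integral `x ↦ ∫ f(x, y) dν(y)`, as a map from `L^p(X × Y)` to `L^p(X)`. -/
noncomputable def partialIntegral [hp : Fact (1 ≤ p)] (f : Lp ℝ p (μ.prod ν)) : Lp ℝ p μ :=
  (memLp_partialIntegral hp.out (Lp.memLp f)).toLp fun x => ∫ y, f (x, y) ∂ν

end PartialIntegral

section ConstInSecond
variable {V W : Type*} [NormedAddCommGroup V] [InnerProductSpace ℝ V] [FiniteDimensional ℝ V]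
  [MeasurableSpace V] [BorelSpace V] [NormedAddCommGroup W] [InnerProductSpace ℝ W]
  [FiniteDimensional ℝ W] [MeasurableSpace W] [BorelSpace W] {p : ℝ≥0∞}

theorem quasiMeasurePreserving_fst :
    Measure.QuasiMeasurePreserving (fun q : WithLp 2 (V × W) => q.fst) volume volume :=
  Measure.quasiMeasurePreserving_fst.comp
    (WithLp.volume_preserving_ofLp V W).quasiMeasurePreserving

variable (V W) in
/-- The ratio of the volumes of a cylinder and of the ball inscribed in it. -/
noncomputable def ballRatio : ℝ≥0∞ :=
  volume (ball (0 : V) 1) * volume (ball (0 : W) 1) * (volume (ball (0 : WithLp 2 (V × W)) 1))⁻¹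

theorem ballRatio_ne_top : ballRatio V W ≠ ∞ :=
  ENNReal.mul_ne_top (ENNReal.mul_ne_top measure_ball_lt_top.ne measure_ball_lt_top.ne)
    (ENNReal.inv_ne_top.2 (measure_ball_pos _ _ one_pos).ne')

theorem map_fst_unifBall_le {r : ℝ} (hr : 0 < r) :
    (unifBall (WithLp 2 (V × W)) r).map (fun q => q.fst) ≤ ballRatio V W • unifBall V r := by
  refine Measure.le_iff.2 fun S hS => ?_
  have hm : Measurable fun q : WithLp 2 (V × W) => q.fst := quasiMeasurePreserving_fst.measurable
  have hsub : ball (0 : WithLp 2 (V × W)) r ∩ (fun q => q.fst) ⁻¹' S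
      ⊆ WithLp.ofLp ⁻¹' ((ball (0 : V) r ∩ S) ×ˢ ball (0 : W) r) := by
    rintro q ⟨hq, hqS⟩
    rw [mem_ball_zero_iff] at hq
    refine ⟨⟨?_, hqS⟩, ?_⟩
    · exact mem_ball_zero_iff.2 ((WithLp.norm_fst_le _ q).trans_lt hq)
    · exact mem_ball_zero_iff.2 ((WithLp.norm_snd_le _ q).trans_lt hq)
  have hvol : volume (ball (0 : WithLp 2 (V × W)) r ∩ (fun q => q.fst) ⁻¹' S)
      ≤ volume (ball (0 : V) r ∩ S) * volume (ball (0 : W) r) := by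
    refine (measure_mono hsub).trans_eq ?_
    rw [(WithLp.volume_preserving_ofLp V W).measure_preimage
      ((measurableSet_ball.inter hS).prod measurableSet_ball).nullMeasurableSet]
    exact Measure.prod_prod _ _
  have hvW := Measure.addHaar_ball_of_pos volume (0 : W) hr
  have hvV := Measure.addHaar_ball_of_pos volume (0 : V) hr
  have hvVW := Measure.addHaar_ball_of_pos volume (0 : WithLp 2 (V × W)) hr
  have hdim : Module.finrank ℝ (WithLp 2 (V × W)) = Module.finrank ℝ V + Module.finrank ℝ W := by
    rw [← Module.finrank_prod, (WithLp.linearEquiv 2 ℝ (V × W)).finrank_eq]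
  rw [hdim, pow_add, ENNReal.ofReal_mul (by positivity)] at hvVW
  have key : (volume (ball (0 : WithLp 2 (V × W)) r))⁻¹ * volume (ball (0 : W) r)
      = ballRatio V W * (volume (ball (0 : V) r))⁻¹ := by
    rw [hvW, hvV, hvVW, ballRatio]
    have a0 : ENNReal.ofReal (r ^ Module.finrank ℝ V) ≠ 0 := by simp; positivity
    have b0 : ENNReal.ofReal (r ^ Module.finrank ℝ W) ≠ 0 := by simp; positivity
    have v0 : volume (ball (0 : V) 1) ≠ 0 := (measure_ball_pos _ _ one_pos).ne'
    have c0 : volume (ball (0 : WithLp 2 (V × W)) 1) ≠ 0 := (measure_ball_pos _ _ one_pos).ne'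
    have vt : volume (ball (0 : V) 1) ≠ ∞ := measure_ball_lt_top.ne
    have wt : volume (ball (0 : W) 1) ≠ ∞ := measure_ball_lt_top.ne
    have ct : volume (ball (0 : WithLp 2 (V × W)) 1) ≠ ∞ := measure_ball_lt_top.ne
    have a1 := ENNReal.ofReal_ne_top (r := r ^ Module.finrank ℝ V)
    have b1 := ENNReal.ofReal_ne_top (r := r ^ Module.finrank ℝ W)
    generalize ENNReal.ofReal (r ^ Module.finrank ℝ V) = a at *
    generalize ENNReal.ofReal (r ^ Module.finrank ℝ W) = b at *
    generalize volume (ball (0 : V) 1) = v at *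
    generalize volume (ball (0 : W) 1) = w at *
    generalize volume (ball (0 : WithLp 2 (V × W)) 1) = c at *
    lift a to NNReal using a1
    lift b to NNReal using b1
    lift v to NNReal using vt
    lift w to NNReal using wt
    lift c to NNReal using ct
    rw [ENNReal.coe_ne_zero] at a0 b0 v0 c0
    have hl : a * b * c ≠ 0 := by positivity
    have hr' : a * v ≠ 0 := by positivity
    rw [← ENNReal.coe_mul, ← ENNReal.coe_mul, ← ENNReal.coe_mul, ← ENNReal.coe_mul,
      ← ENNReal.coe_mul, ← ENNReal.coe_inv hl, ← ENNReal.coe_inv c0, ← ENNReal.coe_inv hr',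
      ← ENNReal.coe_mul, ← ENNReal.coe_mul, ← ENNReal.coe_mul, ENNReal.coe_inj]
    field_simp
  rw [Measure.map_apply hm hS]
  simp only [unifBall, Measure.smul_apply, smul_eq_mul, Measure.restrict_apply hS,
    Measure.restrict_apply (hm hS)]
  rw [inter_comm, inter_comm S]
  calc _ ≤ (volume (ball (0 : WithLp 2 (V × W)) r))⁻¹
        * (volume (ball (0 : V) r ∩ S) * volume (ball (0 : W) r)) := by gcongr
    _ = (volume (ball (0 : WithLp 2 (V × W)) r))⁻¹ * volume (ball (0 : W) r)
        * volume (ball (0 : V) r ∩ S) := by ring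
    _ ≤ _ := by rw [key, mul_assoc]

theorem besNorm_comp_fst_le {u : V → ℝ} (hu : AEStronglyMeasurable u volume) :
    besNorm p (fun q : WithLp 2 (V × W) => u q.fst)
      ≤ (ballRatio V W) ^ (1 / p).toReal * besNorm p u := by
  have hC : (ballRatio V W) ^ (1 / p).toReal ≠ ∞ :=
    ENNReal.rpow_ne_top_of_nonneg ENNReal.toReal_nonneg ballRatio_ne_top
  rw [besNorm, besNorm, ← ENNReal.limsup_const_mul_of_ne_top hC]
  refine limsup_le_limsup ?_ (by isBoundedDefault) (by isBoundedDefault)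
  filter_upwards [eventually_gt_atTop 0] with r hr
  have hq := quasiMeasurePreserving_fst (V := V) (W := W)
  have hac : (unifBall (WithLp 2 (V × W)) r).map (fun q => q.fst) ≪ volume :=
    ((unifBall_absolutelyContinuous r).map hq.measurable).trans hq.absolutelyContinuous
  have h1 := eLpNorm_map_measure (p := p) (hu.mono_ac hac) hq.measurable.aemeasurable
  change eLpNorm (u ∘ fun q : WithLp 2 (V × W) => q.fst) p (unifBall _ r) ≤ _
  rw [← h1]
  exact (eLpNorm_mono_measure u (map_fst_unifBall_le hr)).trans (eLpNorm_smul_measure_le _ _ _ _)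

/-- An almost periodic function of the first variable as a function of both variables. -/
noncomputable def AP.compFst (g : AP V) : AP (WithLp 2 (V × W)) :=
  AP.mk (g.toBCF.compContinuous ⟨fun q : WithLp 2 (V × W) => q.fst, by fun_prop⟩) <|
    isAlmostPeriodic_of_intertwine
      (fun g : AP V => g.toBCF.compContinuous ⟨fun q : WithLp 2 (V × W) => q.fst, by fun_prop⟩)
      (LipschitzWith.mk_one fun u v => (BoundedContinuousFunction.dist_le dist_nonneg).2 fun _ =>
        BoundedContinuousFunction.dist_coe_le_dist (f := u.toBCF) (g := v.toBCF) _).continuous g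
      fun b => ⟨b.fst, by ext q; rfl⟩

@[simp] theorem AP.compFst_apply (g : AP V) (q : WithLp 2 (V × W)) : g.compFst q = g q.fst := rfl

variable [hp : Fact (1 ≤ p)]

theorem comp_fst_mem_besSubmodule {u : V → ℝ} (hu : u ∈ besSubmodule V p) :
    (fun q : WithLp 2 (V × W) => u q.fst) ∈ besSubmodule (WithLp 2 (V × W)) p := by
  refine ⟨hu.1.comp_quasiMeasurePreserving quasiMeasurePreserving_fst, fun η hη => ?_⟩
  have hC : (ballRatio V W) ^ (1 / p).toReal ≠ ∞ :=
    ENNReal.rpow_ne_top_of_nonneg ENNReal.toReal_nonneg ballRatio_ne_top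
  set C := (ballRatio V W) ^ (1 / p).toReal
  obtain ⟨g, hg⟩ := hu.2 (η / (C + 1)) (ENNReal.div_pos hη.ne' (by simp [hC]))
  refine ⟨g.compFst, ?_⟩
  refine (besNorm_comp_fst_le (hu.1.sub g.aestronglyMeasurable)).trans_lt ?_
  have h1 : besNorm p (u - ⇑g) ≠ ∞ := (hg.trans_le le_top).ne
  rw [ENNReal.lt_div_iff_mul_lt (Or.inl (by simp)) (Or.inl (by simp [hC]))] at hg
  refine lt_of_le_of_lt ?_ hg
  rw [mul_comm]
  gcongr
  exact le_self_add

/-- A function `u(y)` in `B^p_AP(V)` as the function `(y, w) ↦ u(y)` in `B^p_AP(V × W)`. -/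
def BesFun.compFst (u : BesFun V p) : BesFun (WithLp 2 (V × W)) p :=
  ⟨fun q => u.1 q.fst, comp_fst_mem_besSubmodule u.2⟩

theorem BesFun.continuous_compFst :
    Continuous (BesFun.compFst : BesFun V p → BesFun (WithLp 2 (V × W)) p) := by
  have hC : (ballRatio V W) ^ (1 / p).toReal ≠ ∞ :=
    ENNReal.rpow_ne_top_of_nonneg ENNReal.toReal_nonneg ballRatio_ne_top
  refine (LipschitzWith.of_dist_le_mul (K := ((ballRatio V W) ^ (1 / p).toReal).toNNReal)
    fun u v => ?_).continuous
  rw [dist_eq_norm, dist_eq_norm, BesFun.norm_def, BesFun.norm_def]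
  have h := besNorm_comp_fst_le (W := W) (p := p) (u := (u - v).1) (u - v).2.1
  have h2 := ENNReal.toReal_mono (ENNReal.mul_ne_top hC (besNorm_lt_top (u - v).2).ne) h
  rw [ENNReal.toReal_mul] at h2
  exact h2

/-- The embedding of `𝓑^p_AP(V)` into `𝓑^p_AP(V × W)`: the class of `u(y)` is sent to the class of
`(y, w) ↦ u(y)`. -/
noncomputable def constInSecond : Bes V p → Bes (WithLp 2 (V × W)) p :=
  SeparationQuotient.lift (fun u => SeparationQuotient.mk u.compFst) fun _ _ h =>
    SeparationQuotient.mk_eq_mk.2 (h.map BesFun.continuous_compFst)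

end ConstInSecond

section Sigma

/-- The Euclidean space `ℝ^N` of the variables `x` and `y`. -/
abbrev Space (N : ℕ) : Type := EuclideanSpace ℝ (Fin N)

/-- The Euclidean space `ℝ^{N+1} = ℝ^N × ℝ` of the microscopic variables `(y, τ)`. -/
abbrev MicroSpaceTime (N : ℕ) : Type := WithLp 2 (Space N × ℝ)

/-- The cylinder `Q = Ω × (0, T)`. -/
def cyl {N : ℕ} (Ω : Set (Space N)) (T : ℝ) : Set (Space N × ℝ) := Ω ×ˢ Ioo 0 T

/-- `u_ε → u₀` in `L^p(Q)`-weak Σ, along a filter `l` on the index set of the family, the scale of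
the member with index `i` being `ε i`. The exponent `p'` is the conjugate of `p`, and the inner
integral on the right is over `K_y × K_τ`. -/
structure WeakSigmaConverges {N : ℕ} {ι : Type*} (l : Filter ι) (ε : ι → ℝ)
    (Q : Set (Space N × ℝ)) (p : ℝ≥0∞) [Fact (1 ≤ p)] (u : ι → Space N × ℝ → ℝ)
    (u₀ : Space N × ℝ → Bes (MicroSpaceTime N) p) : Prop where
  memLp (i : ι) : MemLp (u i) p (volume.restrict Q)
  memLp_limit : MemLp u₀ p (volume.restrict Q)
  tendsto (p' : ℝ≥0∞) (hp' : p⁻¹ + p'⁻¹ = 1) (f : Space N × ℝ → AP (MicroSpaceTime N))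
    (hf : MemLp f p' (volume.restrict Q)) :
    Tendsto
      (fun i => ∫ z in Q, u i z * f z (WithLp.toLp 2 ((ε i)⁻¹ • z.1, (ε i)⁻¹ * z.2))) l
      (𝓝 (∫ z in Q, ∫ k, hatProd (u₀ z) k * gelfandProd (f z) k
        ∂((bohrMeasure (Space N)).prod (bohrMeasure ℝ))))

/-- The time primitive `w(x, t) = ∫₀ᵗ v(x, τ) dτ`. -/
noncomputable def timePrimitive {N : ℕ} (v : Space N × ℝ → ℝ) (z : Space N × ℝ) : ℝ :=
  ∫ τ in (0 : ℝ)..z.2, v (z.1, τ)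

end Sigma

end APSigma

open APSigma

namespace APSigma

section WeakLOne
variable {α : Type*} [MeasurableSpace α] {μ : Measure α} [SFinite μ]

/-- The measurable functions with values in `[0, 1]`, with the distance of `L¹`. -/
abbrev UnitFun (μ : Measure α) [SFinite μ] : Type _ :=
  Icc (0 : Lp ℝ 1 μ.toFinite) ((memLp_const (1 : ℝ)).toLp fun _ => 1)

theorem UnitFun.ae_mem (φ : UnitFun μ) : ∀ᵐ x ∂μ, 0 ≤ φ.1 x ∧ φ.1 x ≤ 1 := by
  have h0 := (Lp.coeFn_nonneg _).2 φ.2.1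
  have h1 := (Lp.coeFn_le _ _).2 φ.2.2
  have h2 := (memLp_const (μ := μ.toFinite) (p := 1) (1 : ℝ)).coeFn_toLp
  rw [← ae_toFinite (μ := μ)]
  filter_upwards [h0, h1, h2] with x a b c
  exact ⟨a, b.trans_eq c⟩

theorem UnitFun.aestronglyMeasurable (φ : UnitFun μ) : AEStronglyMeasurable φ.1 μ :=
  (Lp.aestronglyMeasurable φ.1).mono_ac (absolutelyContinuous_toFinite μ)

theorem integrable_mul_of_ae_abs_le_one {u h : α → ℝ} (hu : Integrable u μ)
    (hm : AEStronglyMeasurable h μ) (hb : ∀ᵐ x ∂μ, |h x| ≤ 1) :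
    Integrable (fun x => u x * h x) μ :=
  hu.mul_bdd (c := 1) hm hb

theorem UnitFun.ae_abs_le (φ : UnitFun μ) : ∀ᵐ x ∂μ, |φ.1 x| ≤ 1 := by
  filter_upwards [φ.ae_mem] with x hx
  rw [abs_of_nonneg hx.1]; exact hx.2

theorem UnitFun.continuous_integral {u : α → ℝ} (hu : Integrable u μ) :
    Continuous fun φ : UnitFun μ => ∫ x, u x * φ.1 x ∂μ := by
  refine continuous_iff_seqContinuous.2 fun φ ψ hφ => ?_
  refine tendsto_of_subseq_tendsto fun ns hns => ?_
  have h1 : Tendsto (fun n => (φ (ns n)).1) atTop (𝓝 ψ.1) :=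
    (continuous_subtype_val.tendsto ψ).comp (hφ.comp hns)
  obtain ⟨ms, -, hms⟩ := (tendstoInMeasure_of_tendsto_Lp h1).exists_seq_tendsto_ae
  rw [ae_toFinite] at hms
  refine ⟨ms, tendsto_integral_of_dominated_convergence (fun x => ‖u x‖)
    (fun n => hu.1.mul (φ _).aestronglyMeasurable) hu.norm (fun n => ?_) ?_⟩
  · filter_upwards [(φ (ns (ms n))).ae_abs_le] with x hx
    rw [norm_mul]
    exact mul_le_of_le_one_right (norm_nonneg _) hx
  · filter_upwards [hms] with x hx
    exact hx.const_mul _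

/-- A `[0, 1]`-valued measurable function as an element of `UnitFun`. -/
noncomputable def UnitFun.mk (f : α → ℝ) (hf : AEStronglyMeasurable f μ)
    (hb : ∀ᵐ x ∂μ, 0 ≤ f x ∧ f x ≤ 1) : UnitFun μ :=
  have hm : MemLp f 1 μ.toFinite := MemLp.of_bound (hf.mono_ac (toFinite_absolutelyContinuous μ)) 1
    (by rw [ae_toFinite]; filter_upwards [hb] with x hx; rw [Real.norm_of_nonneg hx.1]; exact hx.2)
  ⟨hm.toLp f, by
    rw [← ae_toFinite (μ := μ)] at hb
    refine ⟨(Lp.coeFn_nonneg _).1 ?_, (Lp.coeFn_le _ _).1 ?_⟩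
    · filter_upwards [hm.coeFn_toLp, hb] with x h1 h2
      rw [h1]; exact h2.1
    · filter_upwards [hm.coeFn_toLp, hb, (memLp_const (μ := μ.toFinite) (p := 1) (1 : ℝ)).coeFn_toLp]
        with x h1 h2 h3
      rw [h1, h3]; exact h2.2⟩

theorem UnitFun.coeFn_mk {f : α → ℝ} (hf : AEStronglyMeasurable f μ)
    (hb : ∀ᵐ x ∂μ, 0 ≤ f x ∧ f x ≤ 1) : (UnitFun.mk f hf hb).1 =ᵐ[μ] f := by
  have h := MemLp.coeFn_toLp (μ := μ.toFinite) (p := 1) (f := f) (MemLp.of_bound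
    (hf.mono_ac (toFinite_absolutelyContinuous μ)) 1 (by
      rw [ae_toFinite]; filter_upwards [hb] with x hx; rw [Real.norm_of_nonneg hx.1]; exact hx.2))
  exact (absolutelyContinuous_toFinite μ).ae_eq h

theorem UnitFun.dist_mk_le {f h : α → ℝ} (hf : AEStronglyMeasurable f μ)
    (hb : ∀ᵐ x ∂μ, 0 ≤ f x ∧ f x ≤ 1) (φ : UnitFun μ) (hh : Integrable h μ.toFinite)
    (hle : ∀ᵐ x ∂μ, |f x - φ.1 x| ≤ h x) :
    dist (UnitFun.mk f hf hb) φ ≤ ∫ x, h x ∂μ.toFinite := by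
  rw [Subtype.dist_eq, L1.dist_eq_integral_dist]
  have hc := UnitFun.coeFn_mk hf hb
  rw [← ae_toFinite (μ := μ)] at hle
  have hc' : (UnitFun.mk f hf hb).1 =ᵐ[μ.toFinite] f := (toFinite_absolutelyContinuous μ).ae_eq hc
  refine integral_mono_of_nonneg (ae_of_all _ fun _ => dist_nonneg) hh ?_
  filter_upwards [hc', hle] with x h1 h2
  rw [h1, Real.dist_eq]; exact h2

/-- The indefinite integrals of a sequence that converges weakly in `L¹` are equicontinuous. -/
theorem exists_forall_abs_integral_sub_le {u : ℕ → α → ℝ} (hu : ∀ n, Integrable (u n) μ)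
    (hconv : ∀ φ : α → ℝ, AEStronglyMeasurable φ μ → (∀ᵐ x ∂μ, |φ x| ≤ 1) →
      ∃ L, Tendsto (fun n => ∫ x, u n x * φ x ∂μ) atTop (𝓝 L)) {η : ℝ} (hη : 0 < η) :
    ∃ m, ∃ δ > 0, ∀ h : α → ℝ, AEStronglyMeasurable h μ → (∀ᵐ x ∂μ, 0 ≤ h x ∧ h x ≤ 1) →
      ∫ x, h x ∂μ.toFinite < δ →
      ∀ n ≥ m, |(∫ x, u n x * h x ∂μ) - ∫ x, u m x * h x ∂μ| ≤ η := by
  have hne : Nonempty (UnitFun μ) :=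
    ⟨UnitFun.mk 0 aestronglyMeasurable_const (ae_of_all _ fun _ => by simp)⟩
  have hcompl : CompleteSpace (UnitFun μ) := isClosed_Icc.completeSpace_coe
  let C : ℕ → Set (UnitFun μ) := fun m => ⋂ n ≥ m, {φ |
    |(∫ x, u n x * φ.1 x ∂μ) - ∫ x, u m x * φ.1 x ∂μ| ≤ η / 2}
  have hC : ∀ m, IsClosed (C m) := fun m => isClosed_biInter fun n _ =>
    isClosed_le (((UnitFun.continuous_integral (hu n)).sub
      (UnitFun.continuous_integral (hu m))).abs) continuous_const
  have hU : ⋃ m, C m = univ := by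
    refine eq_univ_of_forall fun φ => ?_
    obtain ⟨L, hL⟩ := hconv φ.1 φ.aestronglyMeasurable φ.ae_abs_le
    obtain ⟨m, hm⟩ := Metric.cauchySeq_iff'.1 hL.cauchySeq (η / 2) (by positivity)
    refine mem_iUnion.2 ⟨m, mem_iInter₂.2 fun n hn => ?_⟩
    exact (hm n hn).le
  obtain ⟨m, φ, hφ⟩ := nonempty_interior_of_iUnion_of_closed hC hU
  obtain ⟨δ, hδ, hball⟩ := Metric.isOpen_iff.1 isOpen_interior φ hφ
  refine ⟨m, δ, hδ, fun h hm hb hlt n hn => ?_⟩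
  have hφm := φ.aestronglyMeasurable
  have hφb := φ.ae_mem
  have hhi : Integrable h μ.toFinite := Integrable.of_bound
    (hm.mono_ac (toFinite_absolutelyContinuous μ)) 1 (by
      rw [ae_toFinite]; filter_upwards [hb] with x hx; rw [Real.norm_of_nonneg hx.1]; exact hx.2)
  have ham : AEStronglyMeasurable (fun x => min (φ.1 x + h x) 1) μ :=
    (hφm.add hm).inf aestronglyMeasurable_const
  have hbm : AEStronglyMeasurable (fun x => min (φ.1 x) (1 - h x)) μ :=
    hφm.inf (aestronglyMeasurable_const.sub hm)
  have hab : ∀ᵐ x ∂μ, 0 ≤ min (φ.1 x + h x) 1 ∧ min (φ.1 x + h x) 1 ≤ 1 := by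
    filter_upwards [hφb, hb] with x h1 h2
    exact ⟨le_min (add_nonneg h1.1 h2.1) zero_le_one, min_le_right _ _⟩
  have hbb : ∀ᵐ x ∂μ, 0 ≤ min (φ.1 x) (1 - h x) ∧ min (φ.1 x) (1 - h x) ≤ 1 := by
    filter_upwards [hφb, hb] with x h1 h2
    exact ⟨le_min h1.1 (by linarith [h2.2]), (min_le_left _ _).trans h1.2⟩
  have hA : UnitFun.mk _ ham hab ∈ C m := by
    refine interior_subset (hball ?_)
    refine mem_ball.2 ((UnitFun.dist_mk_le ham hab φ hhi ?_).trans_lt hlt)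
    filter_upwards [hφb, hb] with x h1 h2
    rw [abs_le]
    rcases min_cases (φ.1 x + h x) 1 with h | h <;> constructor <;> linarith [h1.2, h2.1]
  have hB : UnitFun.mk _ hbm hbb ∈ C m := by
    refine interior_subset (hball ?_)
    refine mem_ball.2 ((UnitFun.dist_mk_le hbm hbb φ hhi ?_).trans_lt hlt)
    filter_upwards [hφb, hb] with x h1 h2
    rw [abs_le]
    rcases min_cases (φ.1 x) (1 - h x) with h | h <;> constructor <;> linarith [h1.2, h2.1]
  have hA' := mem_iInter₂.1 hA n hn
  have hB' := mem_iInter₂.1 hB n hn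
  simp only [mem_ofPred_eq] at hA' hB'
  have hsplit : ∀ k, ∫ x, u k x * h x ∂μ = (∫ x, u k x * (UnitFun.mk _ ham hab).1 x ∂μ)
      - ∫ x, u k x * (UnitFun.mk _ hbm hbb).1 x ∂μ := fun k => by
    rw [← integral_sub
      (integrable_mul_of_ae_abs_le_one (hu k) (UnitFun.aestronglyMeasurable _) (UnitFun.ae_abs_le _))
      (integrable_mul_of_ae_abs_le_one (hu k) (UnitFun.aestronglyMeasurable _) (UnitFun.ae_abs_le _))]
    refine integral_congr_ae ?_
    filter_upwards [UnitFun.coeFn_mk ham hab, UnitFun.coeFn_mk hbm hbb] with x h1 h2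
    rw [h1, h2, ← mul_sub]
    congr 1
    rcases min_cases (φ.1 x + h x) 1 with k | k <;>
      rcases min_cases (φ.1 x) (1 - h x) with k2 | k2 <;> linarith
  rw [hsplit n, hsplit m]
  rw [abs_le] at hA' hB' ⊢
  constructor <;> linarith [hA'.1, hA'.2, hB'.1, hB'.2]

theorem tendsto_integral_mul_of_nonneg {u : ℕ → α → ℝ} (hu : ∀ n, Integrable (u n) μ)
    (hconv : ∀ φ : α → ℝ, AEStronglyMeasurable φ μ → (∀ᵐ x ∂μ, |φ x| ≤ 1) →
      ∃ L, Tendsto (fun n => ∫ x, u n x * φ x ∂μ) atTop (𝓝 L)) {h : ℕ → α → ℝ}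
    (hm : ∀ n, AEStronglyMeasurable (h n) μ) (hb : ∀ n, ∀ᵐ x ∂μ, 0 ≤ h n x ∧ h n x ≤ 1)
    (hlim : ∀ᵐ x ∂μ, Tendsto (fun n => h n x) atTop (𝓝 0)) :
    Tendsto (fun n => ∫ x, u n x * h n x ∂μ) atTop (𝓝 0) := by
  refine Metric.tendsto_nhds.2 fun η hη => ?_
  obtain ⟨m, δ, hδ, hmδ⟩ := exists_forall_abs_integral_sub_le hu hconv (η := η / 2) (by positivity)
  have hb' : ∀ n, ∀ᵐ x ∂μ, ‖h n x‖ ≤ 1 := fun n => by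
    filter_upwards [hb n] with x hx
    rw [Real.norm_of_nonneg hx.1]; exact hx.2
  have h1 : Tendsto (fun n => ∫ x, h n x ∂μ.toFinite) atTop (𝓝 0) := by
    have := tendsto_integral_of_dominated_convergence (μ := μ.toFinite) (F := h) (f := fun _ => 0)
      (fun _ => 1) (fun n => (hm n).mono_ac (toFinite_absolutelyContinuous μ)) (integrable_const _)
      (fun n => by rw [ae_toFinite]; exact hb' n) (by rw [ae_toFinite]; exact hlim)
    simpa using this
  have h2 : Tendsto (fun n => ∫ x, u m x * h n x ∂μ) atTop (𝓝 0) := by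
    have := tendsto_integral_of_dominated_convergence (μ := μ) (F := fun n x => u m x * h n x)
      (f := fun _ => 0) (fun x => ‖u m x‖) (fun n => (hu m).1.mul (hm n)) (hu m).norm
      (fun n => by
        filter_upwards [hb' n] with x hx
        rw [norm_mul]; exact mul_le_of_le_one_right (norm_nonneg _) hx)
      (by filter_upwards [hlim] with x hx; simpa using hx.const_mul (u m x))
    simpa using this
  filter_upwards [(tendsto_order.1 h1).2 δ hδ, Metric.tendsto_nhds.1 h2 (η / 2) (by positivity),
    eventually_ge_atTop m] with n k1 k2 k3
  have k4 := hmδ (h n) (hm n) (hb n) k1 n k3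
  rw [Real.dist_eq, sub_zero] at k2 ⊢
  rw [abs_lt] at k2 ⊢
  rw [abs_le] at k4
  constructor <;> linarith [k2.1, k2.2, k4.1, k4.2]

/-- If `u n` converges weakly in `L¹` and `h n` is bounded by `1` and tends to zero almost
everywhere, then `∫ u n * h n` tends to zero. -/
theorem tendsto_integral_mul_of_abs_le_one {u : ℕ → α → ℝ} (hu : ∀ n, Integrable (u n) μ)
    (hconv : ∀ φ : α → ℝ, AEStronglyMeasurable φ μ → (∀ᵐ x ∂μ, |φ x| ≤ 1) →
      ∃ L, Tendsto (fun n => ∫ x, u n x * φ x ∂μ) atTop (𝓝 L)) {h : ℕ → α → ℝ}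
    (hm : ∀ n, AEStronglyMeasurable (h n) μ) (hb : ∀ n, ∀ᵐ x ∂μ, |h n x| ≤ 1)
    (hlim : ∀ᵐ x ∂μ, Tendsto (fun n => h n x) atTop (𝓝 0)) :
    Tendsto (fun n => ∫ x, u n x * h n x ∂μ) atTop (𝓝 0) := by
  have hpm : ∀ n, AEStronglyMeasurable (fun x => max (h n x) 0) μ := fun n =>
    (hm n).sup aestronglyMeasurable_const
  have hnm : ∀ n, AEStronglyMeasurable (fun x => max (-h n x) 0) μ := fun n =>
    (hm n).neg.sup aestronglyMeasurable_const
  have hpb : ∀ n, ∀ᵐ x ∂μ, 0 ≤ max (h n x) 0 ∧ max (h n x) 0 ≤ 1 := fun n => by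
    filter_upwards [hb n] with x hx
    exact ⟨le_max_right _ _, max_le (abs_le.1 hx).2 zero_le_one⟩
  have hnb : ∀ n, ∀ᵐ x ∂μ, 0 ≤ max (-h n x) 0 ∧ max (-h n x) 0 ≤ 1 := fun n => by
    filter_upwards [hb n] with x hx
    exact ⟨le_max_right _ _, max_le (by linarith [(abs_le.1 hx).1]) zero_le_one⟩
  have abs_of : ∀ {a : ℝ}, 0 ≤ a ∧ a ≤ 1 → |a| ≤ 1 := fun {a} ha => by
    rw [abs_of_nonneg ha.1]; exact ha.2
  have h1 := tendsto_integral_mul_of_nonneg hu hconv hpm hpb (by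
    filter_upwards [hlim] with x hx
    simpa using hx.max (tendsto_const_nhds (x := (0 : ℝ))))
  have h2 := tendsto_integral_mul_of_nonneg hu hconv hnm hnb (by
    filter_upwards [hlim] with x hx
    simpa using hx.neg.max (tendsto_const_nhds (x := (0 : ℝ))))
  have h3 := h1.sub h2
  rw [sub_zero] at h3
  refine h3.congr fun n => ?_
  rw [← integral_sub
    (integrable_mul_of_ae_abs_le_one (hu n) (hpm n) ((hpb n).mono fun _ => abs_of))
    (integrable_mul_of_ae_abs_le_one (hu n) (hnm n) ((hnb n).mono fun _ => abs_of))]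
  refine integral_congr_ae (ae_of_all _ fun x => ?_)
  simp only
  rw [← mul_sub]
  congr 1
  rcases max_cases (h n x) 0 with k | k <;> rcases max_cases (-h n x) 0 with k2 | k2 <;> linarith

/-- If `u n` converges weakly in `L^p` and `h n` is bounded by a function of the dual space and tends
to zero almost everywhere, then `∫ u n * h n` tends to zero. -/
theorem tendsto_integral_mul_of_abs_le {p q : ℝ≥0∞} [hpq : ENNReal.HolderConjugate p q]
    {u : ℕ → α → ℝ} (hu : ∀ n, MemLp (u n) p μ)
    (hconv : ∀ φ : α → ℝ, MemLp φ q μ → ∃ L, Tendsto (fun n => ∫ x, u n x * φ x ∂μ) atTop (𝓝 L))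
    {h : ℕ → α → ℝ} {H : α → ℝ} (hH : MemLp H q μ)
    (hm : ∀ n, AEStronglyMeasurable (h n) μ) (hb : ∀ n, ∀ᵐ x ∂μ, |h n x| ≤ H x)
    (hlim : ∀ᵐ x ∂μ, Tendsto (fun n => h n x) atTop (𝓝 0)) :
    Tendsto (fun n => ∫ x, u n x * h n x ∂μ) atTop (𝓝 0) := by
  have hint : ∀ n, Integrable (fun x => u n x * H x) μ := fun n => (hu n).integrable_mul hH
  have key := tendsto_integral_mul_of_abs_le_one (h := fun n x => h n x / H x) hint
    (fun φ hφ hφb => ?_) (fun n => ((hm n).aemeasurable.div hH.1.aemeasurable).aestronglyMeasurable)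
    (fun n => ?_) ?_
  · refine key.congr fun n => integral_congr_ae ?_
    filter_upwards [hb n] with x hx
    by_cases h0 : H x = 0
    · have : h n x = 0 := abs_nonpos_iff.1 (h0 ▸ hx)
      simp [h0, this]
    · field_simp
  · obtain ⟨L, hL⟩ := hconv (fun x => H x * φ x)
      (hH.of_le_mul (c := 1) (hH.1.mul hφ) (by
        filter_upwards [hφb] with x hx
        rw [norm_mul, one_mul]
        exact mul_le_of_le_one_right (norm_nonneg _) hx))
    exact ⟨L, by simpa only [mul_assoc] using hL⟩
  · filter_upwards [hb n] with x hx
    rw [abs_div]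
    exact div_le_one_of_le₀ (hx.trans (le_abs_self _)) (abs_nonneg _)
  · filter_upwards [hlim] with x hx
    simpa using hx.div_const (H x)

end WeakLOne

section KernelIntegral
variable {X Y E F : Type*} [MeasurableSpace X] [MeasurableSpace Y] {μ : Measure X} {ν : Measure Y}
  [SFinite μ] [IsFiniteMeasure ν] [NormedAddCommGroup E] [NormedAddCommGroup F] {p q : ℝ≥0∞}

theorem ae_memLp_slice (hp0 : p ≠ 0) {f : X × Y → E} (hf : MemLp f p (μ.prod ν)) :
    ∀ᵐ x ∂μ, MemLp (fun y => f (x, y)) p ν := by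
  by_cases hpt : p = ∞
  · subst hpt
    have h := ae_le_eLpNormEssSup (f := f) (μ := μ.prod ν)
    filter_upwards [Measure.ae_ae_of_ae_prod h, hf.1.prodMk_left] with x hx hm
    refine ⟨hm, ?_⟩
    rw [eLpNorm_exponent_top]
    refine (essSup_le_of_ae_le _ hx).trans_lt ?_
    rw [← eLpNorm_exponent_top]; exact hf.2
  · have hfin := hf.2
    rw [eLpNorm_lt_top_iff_lintegral_rpow_enorm_lt_top hp0 hpt,
      lintegral_prod _ (hf.1.enorm.pow_const _)] at hfin
    filter_upwards [ae_lt_top' ((hf.1.enorm.pow_const _).lintegral_prod_right') hfin.ne,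
      hf.1.prodMk_left] with x hx hm
    exact ⟨hm, (eLpNorm_lt_top_iff_lintegral_rpow_enorm_lt_top hp0 hpt).2 hx⟩

theorem eLpNorm_integral_norm_le (hp : 1 ≤ p) {f : X × Y → E}
    (hf : AEStronglyMeasurable f (μ.prod ν)) :
    eLpNorm (fun x => ∫ y, ‖f (x, y)‖ ∂ν) p μ
      ≤ ν univ ^ (1 - 1 / p.toReal) * eLpNorm f p (μ.prod ν) := by
  have hp0 : p ≠ 0 := (zero_lt_one.trans_le hp).ne'
  have hle : ∀ᵐ x ∂μ, ‖∫ y, ‖f (x, y)‖ ∂ν‖ₑ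
      ≤ ν univ ^ (1 - 1 / p.toReal) * eLpNorm (fun y => f (x, y)) p ν := by
    filter_upwards [hf.prodMk_left] with x hx
    refine (enorm_integral_le_lintegral_enorm _).trans ?_
    simp only [enorm_norm]
    rw [← eLpNorm_one_eq_lintegral_enorm, mul_comm]
    simpa using eLpNorm_le_eLpNorm_mul_rpow_measure_univ hp hx
  have hC : ν univ ^ (1 - 1 / p.toReal) ≠ ∞ := by
    refine ENNReal.rpow_ne_top_of_nonneg ?_ (measure_ne_top ν _)
    by_cases hpt : p = ∞
    · simp [hpt]
    · have : 1 ≤ p.toReal := by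
        rw [← ENNReal.toReal_one]; exact ENNReal.toReal_mono hpt hp
      rw [sub_nonneg, div_le_one₀ (by linarith)]; exact this
  set C := ν univ ^ (1 - 1 / p.toReal)
  by_cases hpt : p = ∞
  · subst hpt
    rw [eLpNorm_exponent_top]
    refine essSup_le_of_ae_le _ ?_
    filter_upwards [hle, Measure.ae_ae_of_ae_prod (ae_le_eLpNormEssSup (f := f) (μ := μ.prod ν))]
      with x hx h2
    refine hx.trans ?_
    gcongr
    rw [eLpNorm_exponent_top, eLpNorm_exponent_top]
    exact essSup_le_of_ae_le _ h2
  · have hp1 : 0 < p.toReal := ENNReal.toReal_pos hp0 hpt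
    rw [eLpNorm_eq_lintegral_rpow_enorm_toReal hp0 hpt,
      eLpNorm_eq_lintegral_rpow_enorm_toReal hp0 hpt, lintegral_prod _ (hf.enorm.pow_const _)]
    have : C = (C ^ p.toReal) ^ (1 / p.toReal) := by
      rw [← ENNReal.rpow_mul, mul_one_div_cancel hp1.ne', ENNReal.rpow_one]
    rw [this, ← ENNReal.mul_rpow_of_nonneg _ _ (by positivity)]
    refine ENNReal.rpow_le_rpow ?_ (by positivity)
    rw [← lintegral_const_mul' _ _ (ENNReal.rpow_ne_top_of_nonneg hp1.le hC)]
    refine lintegral_mono_ae ?_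
    filter_upwards [hle] with x hx
    refine (ENNReal.rpow_le_rpow hx hp1.le).trans_eq ?_
    rw [ENNReal.mul_rpow_of_nonneg _ _ hp1.le, eLpNorm_eq_lintegral_rpow_enorm_toReal hp0 hpt,
      ← ENNReal.rpow_mul (∫⁻ _, _ ∂ν), one_div_mul_cancel hp1.ne', ENNReal.rpow_one]

theorem memLp_integral_norm (hp : 1 ≤ p) {f : X × Y → E} (hf : MemLp f p (μ.prod ν)) :
    MemLp (fun x => ∫ y, ‖f (x, y)‖ ∂ν) p μ := by
  refine ⟨hf.1.norm.integral_prod_right', (eLpNorm_integral_norm_le hp hf.1).trans_lt ?_⟩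
  refine ENNReal.mul_lt_top (ENNReal.rpow_lt_top_of_nonneg ?_ (measure_ne_top ν _)) hf.2
  by_cases hpt : p = ∞
  · simp [hpt]
  · have : 1 ≤ p.toReal := by
      rw [← ENNReal.toReal_one]; exact ENNReal.toReal_mono hpt hp
    rw [sub_nonneg, div_le_one₀ (by linarith)]; exact this

variable [NormedSpace ℝ E] [NormedSpace ℝ F]

/-- The integral `∫ 1_S(t, τ) f(x, τ) dν(τ)` as a function of `(x, t)`. -/
noncomputable def kernelIntegral (ν : Measure Y) (S : Set (Y × Y)) (f : X × Y → E) (z : X × Y) : E :=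
  ∫ τ, {τ | (z.2, τ) ∈ S}.indicator (fun τ => f (z.1, τ)) τ ∂ν

theorem norm_kernelIntegral_le (S : Set (Y × Y)) {f : X × Y → E} {z : X × Y}
    (hf : Integrable (fun τ => f (z.1, τ)) ν) :
    ‖kernelIntegral ν S f z‖ ≤ ∫ τ, ‖f (z.1, τ)‖ ∂ν := by
  refine (norm_integral_le_integral_norm _).trans
    (integral_mono_of_nonneg (ae_of_all _ fun _ => norm_nonneg _) hf.norm (ae_of_all _ fun τ => ?_))
  exact norm_indicator_le_norm_self _ _

theorem aestronglyMeasurable_kernelIntegral {S : Set (Y × Y)} (hS : MeasurableSet S)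
    {f : X × Y → E} (hf : AEStronglyMeasurable f (μ.prod ν)) :
    AEStronglyMeasurable (kernelIntegral ν S f) (μ.prod ν) := by
  have hq : Measure.QuasiMeasurePreserving (fun a : (X × Y) × Y => (a.1.1, a.2))
      ((μ.prod ν).prod ν) (μ.prod ν) :=
    ⟨by fun_prop, by
      have h := Measure.map_prod_map (μ.prod ν) ν (f := Prod.fst) (g := id) measurable_fst
        measurable_id
      rw [Measure.map_id] at h
      exact (Measure.absolutelyContinuous_of_eq h.symm).trans
        (Measure.quasiMeasurePreserving_fst.absolutelyContinuous.prod .rfl)⟩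
  have hm : MeasurableSet {a : (X × Y) × Y | (a.1.2, a.2) ∈ S} :=
    hS.preimage (by fun_prop : Measurable fun a : (X × Y) × Y => (a.1.2, a.2))
  exact ((hf.comp_quasiMeasurePreserving hq).indicator hm).integral_prod_right'

theorem ae_integrable_slice (hp : 1 ≤ p) {f : X × Y → E} (hf : MemLp f p (μ.prod ν)) :
    ∀ᵐ x ∂μ, Integrable (fun y => f (x, y)) ν :=
  (ae_memLp_slice (zero_lt_one.trans_le hp).ne' hf).mono fun _ h => h.integrable hp

theorem memLp_kernelIntegral (hp : 1 ≤ p) {S : Set (Y × Y)} (hS : MeasurableSet S)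
    {f : X × Y → E} (hf : MemLp f p (μ.prod ν)) :
    MemLp (kernelIntegral ν S f) p (μ.prod ν) := by
  refine ((memLp_integral_norm hp hf).comp_fst ν).mono
    (aestronglyMeasurable_kernelIntegral hS hf.1) ?_
  filter_upwards [Measure.quasiMeasurePreserving_fst.ae (ae_integrable_slice hp hf)] with z hz
  refine (norm_kernelIntegral_le S hz).trans (le_abs_self _)

theorem integrable_bilin [ENNReal.HolderConjugate p q] {α : Type*} [MeasurableSpace α]
    {m : Measure α} (L : E →L[ℝ] F →L[ℝ] ℝ) {f : α → E} {g : α → F} (hf : MemLp f p m)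
    (hg : MemLp g q m) : Integrable (fun x => L (f x) (g x)) m :=
  memLp_one_iff_integrable.1 (L.memLp_of_bilin 1 hf hg)

/-- The kernel integral operators of a set and of its transpose are adjoint. -/
theorem integral_bilin_kernelIntegral [CompleteSpace E] [CompleteSpace F]
    [hpq : ENNReal.HolderConjugate p q] (L : E →L[ℝ] F →L[ℝ] ℝ) {S : Set (Y × Y)}
    (hS : MeasurableSet S) {f : X × Y → E} {g : X × Y → F} (hf : MemLp f p (μ.prod ν))
    (hg : MemLp g q (μ.prod ν)) :
    ∫ z, L (kernelIntegral ν S f z) (g z) ∂(μ.prod ν)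
      = ∫ z, L (f z) (kernelIntegral ν (Prod.swap ⁻¹' S) g z) ∂(μ.prod ν) := by
  have hp : 1 ≤ p := ENNReal.HolderTriple.le p q 1
  have hq : 1 ≤ q := ENNReal.HolderTriple.le q p 1
  rw [integral_prod _ (integrable_bilin L (memLp_kernelIntegral hp hS hf) hg),
    integral_prod _ (integrable_bilin L hf
      (memLp_kernelIntegral hq (hS.preimage measurable_swap) hg))]
  refine integral_congr_ae ?_
  filter_upwards [ae_integrable_slice hp hf, ae_integrable_slice hq hg] with x hfx hgx
  have hSt : ∀ t, MeasurableSet {τ | (t, τ) ∈ S} := fun t => hS.preimage measurable_prodMk_left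
  have hSτ : ∀ τ, MeasurableSet {t | (t, τ) ∈ S} := fun t => hS.preimage measurable_prodMk_right
  have h1 : ∀ t, L (kernelIntegral ν S f (x, t)) (g (x, t))
      = ∫ τ, S.indicator (fun a => L (f (x, a.2)) (g (x, a.1))) (t, τ) ∂ν := fun t => by
    have := (L.flip (g (x, t))).integral_comp_comm (hfx.indicator (hSt t))
    rw [kernelIntegral, ← ContinuousLinearMap.flip_apply, ← this]
    refine integral_congr_ae (ae_of_all _ fun τ => ?_)
    by_cases h : (t, τ) ∈ S <;> simp [indicator, h]
  have h2 : ∀ τ, L (f (x, τ)) (kernelIntegral ν (Prod.swap ⁻¹' S) g (x, τ))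
      = ∫ t, S.indicator (fun a => L (f (x, a.2)) (g (x, a.1))) (t, τ) ∂ν := fun τ => by
    have := (L (f (x, τ))).integral_comp_comm (hgx.indicator (hSτ τ))
    rw [kernelIntegral]
    refine Eq.trans this.symm (integral_congr_ae (ae_of_all _ fun t => ?_))
    by_cases h : (t, τ) ∈ S <;> simp [indicator, h]
  simp only [h1, h2]
  refine integral_integral_swap (f := fun t τ =>
    S.indicator (fun a => L (f (x, a.2)) (g (x, a.1))) (t, τ)) (Integrable.indicator ?_ hS)
  exact (hgx.op_fst_snd (op := fun b a => L a b) (by fun_prop)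
    ⟨‖L‖, fun b a => (L.le_opNorm₂ a b).trans_eq (by ring)⟩ hfx)

end KernelIntegral

section TimeIntegral
variable {X E F : Type*} [MeasurableSpace X] {μ : Measure X} [SFinite μ] [NormedAddCommGroup E]
  [NormedSpace ℝ E] [NormedAddCommGroup F] [NormedSpace ℝ F] {p q : ℝ≥0∞} {T : ℝ}

theorem intervalIntegral_zero_eq_kernelIntegral (f : X × ℝ → E) {z : X × ℝ} (hz : z.2 ∈ Ioo 0 T) :
    ∫ τ in (0 : ℝ)..z.2, f (z.1, τ)
      = kernelIntegral (volume.restrict (Ioo 0 T)) {a | a.2 ≤ a.1} f z := by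
  have e : {τ | (z.2, τ) ∈ {a : ℝ × ℝ | a.2 ≤ a.1}} = Iic z.2 := rfl
  rw [kernelIntegral, e, integral_indicator measurableSet_Iic,
    Measure.restrict_restrict measurableSet_Iic, intervalIntegral.integral_of_le hz.1.le]
  congr 2
  ext τ
  simp only [mem_Ioc, mem_inter_iff, mem_Iic, mem_Ioo]
  constructor
  · exact fun h => ⟨h.2, h.1, h.2.trans_lt hz.2⟩
  · exact fun h => ⟨h.2.1, h.1⟩

theorem intervalIntegral_last_eq_kernelIntegral (f : X × ℝ → E) {z : X × ℝ} (hz : z.2 ∈ Ioo 0 T) :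
    ∫ t in z.2..T, f (z.1, t)
      = kernelIntegral (volume.restrict (Ioo 0 T)) (Prod.swap ⁻¹' {a | a.2 ≤ a.1}) f z := by
  have e : {t | (z.2, t) ∈ Prod.swap ⁻¹' {a : ℝ × ℝ | a.2 ≤ a.1}} = Ici z.2 := rfl
  rw [kernelIntegral, e, integral_indicator measurableSet_Ici,
    Measure.restrict_restrict measurableSet_Ici, intervalIntegral.integral_of_le hz.2.le,
    integral_Ioc_eq_integral_Ioo, ← integral_Ico_eq_integral_Ioo]
  congr 2
  ext τ
  simp only [mem_Ico, mem_inter_iff, mem_Ici, mem_Ioo]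
  constructor
  · exact fun h => ⟨h.1, hz.1.trans_le h.1, h.2⟩
  · exact fun h => ⟨h.1, h.2.2⟩

theorem ae_snd_mem_Ioo : ∀ᵐ z ∂(μ.prod (volume.restrict (Ioo (0 : ℝ) T))), z.2 ∈ Ioo 0 T :=
  Measure.quasiMeasurePreserving_snd.ae (ae_restrict_mem measurableSet_Ioo)

theorem measurableSet_snd_le_fst : MeasurableSet {a : ℝ × ℝ | a.2 ≤ a.1} :=
  measurableSet_le measurable_snd measurable_fst

theorem memLp_intervalIntegral_zero (hp : 1 ≤ p) {f : X × ℝ → E}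
    (hf : MemLp f p (μ.prod (volume.restrict (Ioo 0 T)))) :
    MemLp (fun z : X × ℝ => ∫ τ in (0 : ℝ)..z.2, f (z.1, τ)) p
      (μ.prod (volume.restrict (Ioo 0 T))) := by
  refine (memLp_congr_ae ?_).2 (memLp_kernelIntegral hp measurableSet_snd_le_fst hf)
  filter_upwards [ae_snd_mem_Ioo] with z hz
  exact intervalIntegral_zero_eq_kernelIntegral f hz

theorem memLp_intervalIntegral_last (hp : 1 ≤ p) {f : X × ℝ → E}
    (hf : MemLp f p (μ.prod (volume.restrict (Ioo 0 T)))) :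
    MemLp (fun z : X × ℝ => ∫ t in z.2..T, f (z.1, t)) p
      (μ.prod (volume.restrict (Ioo 0 T))) := by
  refine (memLp_congr_ae ?_).2
    (memLp_kernelIntegral hp (measurableSet_snd_le_fst.preimage measurable_swap) hf)
  filter_upwards [ae_snd_mem_Ioo] with z hz
  exact intervalIntegral_last_eq_kernelIntegral f hz

/-- Integration by parts in time for a bilinear pairing. -/
theorem integral_bilin_intervalIntegral [CompleteSpace E] [CompleteSpace F]
    [hpq : ENNReal.HolderConjugate p q] (L : E →L[ℝ] F →L[ℝ] ℝ) {f : X × ℝ → E} {g : X × ℝ → F}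
    (hf : MemLp f p (μ.prod (volume.restrict (Ioo 0 T))))
    (hg : MemLp g q (μ.prod (volume.restrict (Ioo 0 T)))) :
    ∫ z, L (∫ τ in (0 : ℝ)..z.2, f (z.1, τ)) (g z) ∂(μ.prod (volume.restrict (Ioo 0 T)))
      = ∫ z, L (f z) (∫ t in z.2..T, g (z.1, t)) ∂(μ.prod (volume.restrict (Ioo 0 T))) := by
  have h := integral_bilin_kernelIntegral L measurableSet_snd_le_fst hf hg
  have e1 := integral_congr_ae (μ := μ.prod (volume.restrict (Ioo 0 T)))
    (ae_snd_mem_Ioo.mono fun z hz =>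
      congrArg (fun a => L a (g z)) (intervalIntegral_zero_eq_kernelIntegral f hz))
  have e2 := integral_congr_ae (μ := μ.prod (volume.restrict (Ioo 0 T)))
    (ae_snd_mem_Ioo.mono fun z hz =>
      congrArg (fun a => L (f z) a) (intervalIntegral_last_eq_kernelIntegral g hz))
  exact e1.trans (h.trans e2.symm)

end TimeIntegral

section MeanInSecond

theorem AP.continuous_eval {V : Type*} [NormedAddCommGroup V] :
    Continuous fun q : AP V × V => q.1 q.2 :=
  (ContinuousEval.continuous_eval (F := V →ᵇ ℝ)).comp
    ((continuous_subtype_val.comp continuous_fst).prodMk continuous_snd)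

variable {V W : Type*} [NormedAddCommGroup V] [InnerProductSpace ℝ V] [FiniteDimensional ℝ V]
  [MeasurableSpace V] [BorelSpace V] [NormedAddCommGroup W] [InnerProductSpace ℝ W]
  [FiniteDimensional ℝ W] [MeasurableSpace W] [BorelSpace W]

theorem integrable_partialGelfand (c : AP (WithLp 2 (V × W))) :
    Integrable (fun r : BohrSpace W => c.partialGelfand r) (bohrMeasure W) :=
  c.continuous_partialGelfand.integrable_of_hasCompactSupport (HasCompactSupport.of_compactSpace _)

theorem norm_partialGelfand_le (r : BohrSpace W) (c : AP (WithLp 2 (V × W))) :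
    ‖c.partialGelfand r‖ ≤ ‖c‖ :=
  AP.norm_le _ (norm_nonneg c) fun _ => (abs_character_le r _).trans
    (AP.norm_le _ (norm_nonneg c) fun _ => c.abs_apply_le _)

/-- The mean value in the second variable of an almost periodic function of two variables. -/
noncomputable def avgSnd : AP (WithLp 2 (V × W)) →L[ℝ] AP V :=
  LinearMap.mkContinuous
    { toFun := fun c => ∫ r, c.partialGelfand r ∂(bohrMeasure W)
      map_add' := fun c d => by
        rw [← integral_add (integrable_partialGelfand c) (integrable_partialGelfand d)]
        refine integral_congr_ae (ae_of_all _ fun r => AP.ext fun y => ?_)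
        exact map_add r (c.slice y) (d.slice y)
      map_smul' := fun a c => by
        rw [RingHom.id_apply, ← integral_smul]
        refine integral_congr_ae (ae_of_all _ fun r => AP.ext fun y => ?_)
        exact map_smul r a (c.slice y) } 1
    fun c => by
      refine (norm_integral_le_of_norm_le_const (C := ‖c‖)
        (ae_of_all _ fun r => norm_partialGelfand_le r c)).trans ?_
      simp

theorem avgSnd_def (c : AP (WithLp 2 (V × W))) :
    avgSnd c = ∫ r, c.partialGelfand r ∂(bohrMeasure W) := rfl

theorem norm_avgSnd_le (c : AP (WithLp 2 (V × W))) : ‖avgSnd c‖ ≤ ‖c‖ := by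
  rw [avgSnd_def]
  refine (norm_integral_le_of_norm_le_const (C := ‖c‖)
    (ae_of_all _ fun r => norm_partialGelfand_le r c)).trans ?_
  simp

theorem avgSnd_apply (c : AP (WithLp 2 (V × W))) (y : V) : avgSnd c y = meanValue (c.slice y) := by
  rw [← integral_gelfand]
  exact ((evalCLM y).integral_comp_comm (integrable_partialGelfand c)).symm

theorem character_avgSnd (s : BohrSpace V) (c : AP (WithLp 2 (V × W))) :
    s (avgSnd c) = ∫ r, gelfandProd c (s, r) ∂(bohrMeasure W) :=
  ((WeakDual.CharacterSpace.toAlgHom s).toContinuousLinearMap.integral_comp_comm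
    (integrable_partialGelfand c)).symm

/-- The embedding of `AP(V)` into `AP(V × W)`. -/
noncomputable def compFstCLM : AP V →L[ℝ] AP (WithLp 2 (V × W)) :=
  LinearMap.mkContinuous
    { toFun := AP.compFst
      map_add' := fun _ _ => rfl
      map_smul' := fun _ _ => rfl } 1
    fun g => by
      rw [one_mul]
      exact AP.norm_le _ (norm_nonneg g) fun _ => g.abs_apply_le _

theorem gelfandProd_compFst (g : AP V) (k : BohrSpace V × BohrSpace W) :
    gelfandProd (g.compFst : AP (WithLp 2 (V × W))) k = k.1 g := by
  have h : (g.compFst : AP (WithLp 2 (V × W))).partialGelfand k.2 = g := by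
    ext y
    have e : (g.compFst : AP (WithLp 2 (V × W))).slice y = algebraMap ℝ (AP W) (g y) := rfl
    rw [AP.partialGelfand_apply, e, AlgHomClass.commutes]; rfl
  exact congrArg k.1 h

theorem abs_meanValue_sub_le (u v : AP W) : |meanValue u - meanValue v| ≤ dist u v := by
  have h := (tendsto_meanValue u).sub (tendsto_meanValue v)
  refine le_of_tendsto h.abs ?_
  filter_upwards [eventually_gt_atTop 0] with r hr
  have := isProbabilityMeasure_unifBall (V := W) hr
  rw [← integral_sub (integrable_unifBall _ hr) (integrable_unifBall _ hr), ← Real.norm_eq_abs]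
  refine (norm_integral_le_of_norm_le_const (C := dist u v) (ae_of_all _ fun y => ?_)).trans
    (by simp)
  exact BoundedContinuousFunction.dist_coe_le_dist (f := u.toBCF) (g := v.toBCF) y

theorem abs_integral_unifBall_sub_le (u v : AP W) {r : ℝ} (hr : 0 < r) :
    |(∫ y, u y ∂(unifBall W r)) - ∫ y, v y ∂(unifBall W r)| ≤ dist u v := by
  have := isProbabilityMeasure_unifBall (V := W) hr
  rw [← integral_sub (integrable_unifBall _ hr) (integrable_unifBall _ hr), ← Real.norm_eq_abs]
  refine (norm_integral_le_of_norm_le_const (C := dist u v) (ae_of_all _ fun y => ?_)).trans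
    (by simp)
  exact BoundedContinuousFunction.dist_coe_le_dist (f := u.toBCF) (g := v.toBCF) y

/-- The means in the second variable over large balls converge uniformly in the first variable and
in the centre of the ball. -/
theorem eventually_abs_integral_slice_sub_le (c : AP (WithLp 2 (V × W))) {η : ℝ} (hη : 0 < η) :
    ∀ᶠ r in atTop, ∀ (y : V) (w : W),
      |(∫ σ, c (WithLp.toLp 2 (y, σ + w)) ∂(unifBall W r)) - avgSnd c y| ≤ η := by
  obtain ⟨S, hS⟩ := c.exists_finset_shift (η := η / 3) (by positivity)
  have h : ∀ᶠ r in atTop, ∀ b ∈ S, |(∫ σ, (c.shift b).slice 0 σ ∂(unifBall W r))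
      - meanValue ((c.shift b).slice 0)| < η / 3 :=
    (Finset.eventually_all S).2 fun b _ =>
      Metric.tendsto_nhds.1 (tendsto_meanValue ((c.shift b).slice 0)) (η / 3) (by positivity)
  filter_upwards [h, eventually_gt_atTop 0] with r hr hr0 y w
  obtain ⟨b, hb, hd⟩ := hS (WithLp.toLp 2 (y, w))
  have hd' := (AP.dist_slice_le (0 : V) _ _).trans hd.le
  have e : (c.shift (WithLp.toLp 2 (y, w))).slice 0 = (c.slice y).shift w := by
    ext σ
    change c (WithLp.toLp 2 (0, σ) + WithLp.toLp 2 (y, w)) = c (WithLp.toLp 2 (y, σ + w))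
    rw [← WithLp.toLp_add]; simp
  rw [e] at hd'
  have k1 := (abs_integral_unifBall_sub_le _ _ hr0).trans hd'
  have k2 := (abs_meanValue_sub_le _ _).trans hd'
  have k3 := hr b hb
  rw [meanValue_shift] at k2
  rw [avgSnd_apply]
  change |(∫ σ, (c.slice y).shift w σ ∂(unifBall W r)) - _| ≤ η
  rw [abs_le] at k1 k2 ⊢
  rw [abs_lt] at k3
  constructor <;> linarith [k1.1, k1.2, k2.1, k2.2, k3.1, k3.2]

end MeanInSecond

section Oscillation
variable {V : Type*} [NormedAddCommGroup V] [InnerProductSpace ℝ V] [FiniteDimensional ℝ V]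
  [MeasurableSpace V] [BorelSpace V] {a b : ℝ}

/-- The difference at the scale `e` between an oscillating function of `t` and its mean value. -/
noncomputable def oscillation (f : ℝ → AP (WithLp 2 (V × ℝ))) (e : ℝ) (y : V) (t : ℝ) : ℝ :=
  f t (WithLp.toLp 2 (y, e⁻¹ * t)) - avgSnd (f t) y

theorem integral_oscillation_const (c : AP (WithLp 2 (V × ℝ))) {e : ℝ} (he : 0 < e) (hab : a < b)
    (y : V) : ∫ t in Ioo a b, oscillation (fun _ => c) e y t
      = (b - a) * ((∫ σ, c (WithLp.toLp 2 (y, σ + (a + b) / (2 * e)))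
          ∂(unifBall ℝ ((b - a) / (2 * e)))) - avgSnd c y) := by
  have hcont : Continuous fun t : ℝ => c (WithLp.toLp 2 (y, t)) :=
    (c.slice y).toBCF.continuous
  have hR : 0 < (b - a) / (2 * e) := div_pos (sub_pos.2 hab) (by positivity)
  have hne : b - a ≠ 0 := (sub_pos.2 hab).ne'
  have h1 : ∫ t in a..b, c (WithLp.toLp 2 (y, e⁻¹ * t))
      = e * ∫ σ in (e⁻¹ * a)..(e⁻¹ * b), c (WithLp.toLp 2 (y, σ)) := by
    have := intervalIntegral.integral_comp_mul_left (a := a) (b := b)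
      (fun σ => c (WithLp.toLp 2 (y, σ))) (inv_ne_zero he.ne')
    rw [this, inv_inv, smul_eq_mul]
  have h2 : ∫ σ, c (WithLp.toLp 2 (y, σ + (a + b) / (2 * e))) ∂(unifBall ℝ ((b - a) / (2 * e)))
      = (b - a)⁻¹ * e * ∫ σ in (e⁻¹ * a)..(e⁻¹ * b), c (WithLp.toLp 2 (y, σ)) := by
    have h3 := intervalIntegral.integral_comp_add_right (a := -((b - a) / (2 * e)))
      (b := (b - a) / (2 * e)) (fun σ => c (WithLp.toLp 2 (y, σ))) ((a + b) / (2 * e))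
    have e1 : -((b - a) / (2 * e)) + (a + b) / (2 * e) = e⁻¹ * a := by field_simp; ring
    have e2 : (b - a) / (2 * e) + (a + b) / (2 * e) = e⁻¹ * b := by field_simp; ring
    rw [e1, e2] at h3
    rw [integral_unifBall, Real.ball_eq_Ioo, zero_sub, zero_add, ← integral_Ioc_eq_integral_Ioo,
      ← intervalIntegral.integral_of_le (by linarith), h3]
    congr 1
    rw [Real.volume_real_Ioo_of_le (by linarith)]
    field_simp
    norm_num
  rw [h2, ← integral_Ioc_eq_integral_Ioo, ← intervalIntegral.integral_of_le hab.le]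
  simp only [oscillation]
  rw [intervalIntegral.integral_sub (by
      apply Continuous.intervalIntegrable
      exact hcont.comp (by fun_prop)) intervalIntegrable_const, h1,
    intervalIntegral.integral_const, smul_eq_mul]
  field_simp

theorem integrable_eval {V : Type*} [NormedAddCommGroup V] [MeasurableSpace V] [BorelSpace V]
    {α : Type*} [MeasurableSpace α] {m : Measure α} {f : α → AP V} (hf : Integrable f m) {φ : α → V}
    (hφ : AEStronglyMeasurable φ m) : Integrable (fun t => f t (φ t)) m :=
  hf.norm.mono' (AP.continuous_eval.comp_aestronglyMeasurable (hf.1.prodMk hφ))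
    (ae_of_all _ fun t => (f t).abs_apply_le _)

theorem integrable_oscillation {f : ℝ → AP (WithLp 2 (V × ℝ))}
    (hf : Integrable f (volume.restrict (Ioo a b))) (e : ℝ) (y : V) :
    Integrable (oscillation f e y) (volume.restrict (Ioo a b)) := by
  refine Integrable.sub (integrable_eval hf ?_)
    (integrable_eval (avgSnd.integrable_comp hf) aestronglyMeasurable_const)
  exact (by fun_prop : Continuous fun t : ℝ => WithLp.toLp 2 (y, e⁻¹ * t)).aestronglyMeasurable

theorem abs_oscillation_le (f : ℝ → AP (WithLp 2 (V × ℝ))) (e : ℝ) (y : V) (t : ℝ) :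
    |oscillation f e y t| ≤ 2 * ‖f t‖ := by
  have h1 := (f t).abs_apply_le (WithLp.toLp 2 (y, e⁻¹ * t))
  have h2 := ((avgSnd (f t)).abs_apply_le y).trans (norm_avgSnd_le (f t))
  rw [oscillation]
  exact (abs_sub _ _).trans (by linarith)

theorem oscillation_sub (f g : ℝ → AP (WithLp 2 (V × ℝ))) (e : ℝ) (y : V) (t : ℝ) :
    oscillation (fun t => f t - g t) e y t = oscillation f e y t - oscillation g e y t := by
  simp only [oscillation, map_sub, AP.sub_apply]; ring

theorem oscillation_add (f g : ℝ → AP (WithLp 2 (V × ℝ))) (e : ℝ) (y : V) (t : ℝ) :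
    oscillation (f + g) e y t = oscillation f e y t + oscillation g e y t := by
  simp only [oscillation, Pi.add_apply, map_add, AP.add_apply]; ring

variable (a b) in
/-- The integral over `(a, b)` of the oscillating function `t ↦ f(t)(y, t/e)` is close to that of its
mean value, uniformly in `y`. -/
def Averages (f : ℝ → AP (WithLp 2 (V × ℝ))) : Prop :=
  ∀ η > 0, ∀ᶠ e in 𝓝[>] (0 : ℝ), ∀ y : V, |∫ t in Ioo a b, oscillation f e y t| ≤ η

theorem Averages.add {f g : ℝ → AP (WithLp 2 (V × ℝ))}
    (hf : Integrable f (volume.restrict (Ioo a b))) (hg : Integrable g (volume.restrict (Ioo a b)))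
    (hf' : Averages a b f) (hg' : Averages a b g) : Averages a b (f + g) := fun η hη => by
  filter_upwards [hf' (η / 2) (by positivity), hg' (η / 2) (by positivity)] with e h1 h2 y
  simp only [oscillation_add]
  rw [integral_add (integrable_oscillation hf e y) (integrable_oscillation hg e y)]
  linarith [abs_add_le (∫ t in Ioo a b, oscillation f e y t) (∫ t in Ioo a b, oscillation g e y t),
    h1 y, h2 y]

theorem Averages.sub {f g : ℝ → AP (WithLp 2 (V × ℝ))}
    (hf : Integrable f (volume.restrict (Ioo a b))) (hg : Integrable g (volume.restrict (Ioo a b)))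
    (hf' : Averages a b f) (hg' : Averages a b g) :
    Averages a b (fun t => f t - g t) := fun η hη => by
  filter_upwards [hf' (η / 2) (by positivity), hg' (η / 2) (by positivity)] with e h1 h2 y
  simp only [oscillation_sub]
  rw [integral_sub (integrable_oscillation hf e y) (integrable_oscillation hg e y)]
  linarith [abs_sub (∫ t in Ioo a b, oscillation f e y t) (∫ t in Ioo a b, oscillation g e y t),
    h1 y, h2 y]

theorem Averages.of_approx {f : ℝ → AP (WithLp 2 (V × ℝ))}
    (hf : Integrable f (volume.restrict (Ioo a b)))
    (h : ∀ δ > 0, ∃ g, Integrable g (volume.restrict (Ioo a b)) ∧ Averages a b g ∧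
      ∫ t in Ioo a b, ‖f t - g t‖ ≤ δ) : Averages a b f := fun η hη => by
  obtain ⟨g, hg, hg', hfg⟩ := h (η / 4) (by positivity)
  filter_upwards [hg' (η / 2) (by positivity)] with e h1 y
  have h2 : |∫ t in Ioo a b, oscillation (fun t => f t - g t) e y t| ≤ 2 * (η / 4) := by
    have h3 : |∫ t in Ioo a b, oscillation (fun t => f t - g t) e y t|
        ≤ ∫ t in Ioo a b, 2 * ‖f t - g t‖ :=
      norm_integral_le_of_norm_le (f := oscillation (fun t => f t - g t) e y)
        (g := fun t => 2 * ‖f t - g t‖) ((hf.sub hg).norm.const_mul 2)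
        (ae_of_all _ fun t => abs_oscillation_le (fun t => f t - g t) e y t)
    rw [integral_const_mul] at h3
    linarith
  simp only [oscillation_sub] at h2
  rw [integral_sub (integrable_oscillation hf e y) (integrable_oscillation hg e y)] at h2
  have h3 := h1 y
  rw [abs_le] at h2 h3 ⊢
  constructor <;> linarith [h2.1, h2.2, h3.1, h3.2]

theorem averages_const (c : AP (WithLp 2 (V × ℝ))) : Averages a b fun _ => c := fun η hη => by
  rcases le_or_gt b a with hab | hab
  · exact Eventually.of_forall fun e y => by simp [Ioo_eq_empty hab.not_gt, hη.le]
  have hpos : 0 < b - a := sub_pos.2 hab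
  have hlim : Tendsto (fun e : ℝ => (b - a) / (2 * e)) (𝓝[>] 0) atTop := by
    have : (fun e : ℝ => (b - a) / (2 * e)) = fun e => (b - a) / 2 * e⁻¹ := by
      ext e; rw [div_mul_eq_div_div, div_eq_mul_inv]
    rw [this]
    exact tendsto_inv_nhdsGT_zero.const_mul_atTop (by positivity)
  filter_upwards [hlim.eventually (eventually_abs_integral_slice_sub_le c (η := η / (b - a))
    (by positivity)), self_mem_nhdsWithin] with e h1 he y
  rw [integral_oscillation_const c he hab, abs_mul, abs_of_pos hpos]
  exact (mul_le_mul_of_nonneg_left (h1 y _) hpos.le).trans_eq (by field_simp)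

theorem integrable_indicator_const (c : AP (WithLp 2 (V × ℝ))) {S : Set ℝ} (hS : MeasurableSet S) :
    Integrable (S.indicator fun _ => c) (volume.restrict (Ioo a b)) :=
  (integrable_const c).indicator hS

theorem averages_indicator (c : AP (WithLp 2 (V × ℝ))) {S : Set ℝ} (hS : MeasurableSet S) :
    Averages a b (S.indicator fun _ => c) := by
  induction S, hS using MeasurableSpace.induction_on_inter
    ((BorelSpace.measurable_eq (α := ℝ)).trans (borel_eq_generateFrom_Iio ℝ)) isPiSystem_Iio with
  | empty =>
    rw [indicator_empty]
    exact averages_const 0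
  | basic S hS =>
    obtain ⟨s, rfl⟩ := hS
    intro η hη
    filter_upwards [averages_const (a := a) (b := min s b) c η hη] with e he y
    have : oscillation ((Iio s).indicator fun _ => c) e y
        = (Iio s).indicator (oscillation (fun _ => c) e y) := by
      ext t
      by_cases ht : t < s
      · simp [oscillation, ht]
      · simp only [oscillation, indicator, mem_Iio, ht, if_false, map_zero]
        exact sub_self (0 : ℝ)
    rw [this, integral_indicator measurableSet_Iio, Measure.restrict_restrict measurableSet_Iio,
      Iio_inter_Ioo]
    exact he y
  | compl S hS h =>
    have := (averages_const (a := a) (b := b) c).sub (integrable_const c)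
      (integrable_indicator_const c hS) h
    convert this using 1
    ext1 t
    by_cases ht : t ∈ S <;> simp [indicator, ht]
  | iUnion S hd hS h =>
    have hacc : ∀ n, MeasurableSet (accumulate S n) := fun n =>
      MeasurableSet.biUnion (to_countable _) fun i _ => hS i
    have hP : ∀ n, Averages a b ((accumulate S n).indicator fun _ => c) := fun n => by
      induction n with
      | zero => simpa [accumulate_zero_nat] using h 0
      | succ n ih =>
        rw [accumulate_succ, indicator_union_of_disjoint (disjoint_accumulate hd n.lt_succ_self)]
        exact ih.add (integrable_indicator_const c (hacc n)) (integrable_indicator_const c (hS _))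
          (h _)
    have hU := MeasurableSet.iUnion hS
    refine Averages.of_approx (integrable_indicator_const c hU) fun δ hδ => ?_
    have hlim : Tendsto (fun n => (volume.restrict (Ioo a b)).real ((⋃ i, S i) \ accumulate S n)
        * ‖c‖) atTop (𝓝 0) := by
      have h1 := tendsto_measure_iUnion_accumulate (μ := volume.restrict (Ioo a b)) (f := S)
      have h2 := (ENNReal.tendsto_toReal (measure_ne_top _ _)).comp h1
      have h3 := ((tendsto_const_nhds (x := (volume.restrict (Ioo a b)).real (⋃ i, S i))).sub
        h2).mul_const ‖c‖
      rw [← Measure.real, sub_self, zero_mul] at h3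
      refine h3.congr fun n => ?_
      rw [measureReal_sdiff (accumulate_subset_iUnion n) (hacc n)]
      rfl
    obtain ⟨n, hn⟩ := ((tendsto_order.1 hlim).2 δ hδ).exists
    refine ⟨_, integrable_indicator_const c (hacc n), hP n, le_trans (le_of_eq ?_) hn.le⟩
    have e : (fun t => ‖(⋃ i, S i).indicator (fun _ => c) t
        - (accumulate S n).indicator (fun _ => c) t‖)
        = ((⋃ i, S i) \ accumulate S n).indicator fun _ => ‖c‖ := by
      ext t
      by_cases h1 : t ∈ accumulate S n
      · simp [indicator, h1, mem_iUnion.1 (accumulate_subset_iUnion n h1)]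
      · by_cases h2 : t ∈ ⋃ i, S i
        · simp only [indicator, h1, h2, if_true, if_false, sub_zero, Set.mem_sdiff, not_false_eq_true,
            and_self]
        · simp only [indicator, h1, h2, if_false, sub_zero, Set.mem_sdiff, false_and, norm_zero]
    rw [e, integral_indicator_const _ (MeasurableSet.diff hU (hacc n)), smul_eq_mul]

/-- Averaging of `t ↦ f(t)(y, t/e)` for integrable `f`. -/
theorem averages_of_integrable {f : ℝ → AP (WithLp 2 (V × ℝ))}
    (hf : Integrable f (volume.restrict (Ioo a b))) : Averages a b f := by
  refine Integrable.induction (Averages a b) (fun c S hS _ => averages_indicator c hS)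
    (fun f g _ hf hg hf' hg' => hf'.add hf hg hg') ?_ (fun f g hfg hf h => ?_) hf
  · refine isClosed_of_closure_subset fun f hf => ?_
    refine Averages.of_approx (L1.integrable_coeFn f) fun δ hδ => ?_
    obtain ⟨g, hg, hd⟩ := Metric.mem_closure_iff.1 hf δ hδ
    refine ⟨g, L1.integrable_coeFn g, hg, ?_⟩
    rw [L1.dist_eq_integral_dist] at hd
    simpa only [dist_eq_norm] using hd.le
  · intro η hη
    filter_upwards [h η hη] with e he y
    have : oscillation g e y =ᵐ[volume.restrict (Ioo a b)] oscillation f e y := by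
      filter_upwards [hfg] with t ht
      simp only [oscillation, ht]
    rw [integral_congr_ae this]
    exact he y

end Oscillation

section Completeness
variable {V : Type*} [NormedAddCommGroup V] [NormedSpace ℝ V] [FiniteDimensional ℝ V]
  [MeasureSpace V] [BorelSpace V] [(volume : Measure V).IsAddHaarMeasure]
  {p : ℝ≥0∞} [hp1 : Fact (1 ≤ p)]

theorem tendsto_volume_ball_atTop [Nontrivial V] :
    Tendsto (fun r : ℝ => volume (ball (0 : V) r)) atTop (𝓝 ∞) := by
  have hd : Module.finrank ℝ V ≠ 0 := Module.finrank_pos.ne'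
  have h1 : Tendsto (fun r : ℝ => ENNReal.ofReal (r ^ Module.finrank ℝ V)) atTop (𝓝 ∞) :=
    ENNReal.tendsto_ofReal_atTop.comp (tendsto_pow_atTop hd)
  have h2 := ENNReal.Tendsto.mul_const (b := volume (ball (0 : V) 1)) h1 (Or.inl (by simp))
  rw [ENNReal.top_mul (measure_ball_pos _ _ one_pos).ne'] at h2
  refine h2.congr' ?_
  filter_upwards [eventually_gt_atTop 0] with r hr
  rw [Measure.addHaar_ball_of_pos volume (0 : V) hr]

theorem besNorm_eq_zero_of_memLp [Nontrivial V] (hp : p ≠ ∞) {f : V → ℝ} (hf : MemLp f p volume) :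
    besNorm p f = 0 := by
  have hp0 : 0 < p.toReal := ENNReal.toReal_pos (zero_lt_one.trans_le hp1.out).ne' hp
  have hpos : 0 < (1 / p).toReal := by rw [one_div, ENNReal.toReal_inv]; positivity
  have h1 : Tendsto (fun r : ℝ => (volume (ball (0 : V) r))⁻¹ ^ (1 / p).toReal * eLpNorm f p volume)
      atTop (𝓝 0) := by
    have h2 := (continuous_inv.tendsto (∞ : ℝ≥0∞)).comp (tendsto_volume_ball_atTop (V := V))
    rw [ENNReal.inv_top] at h2
    have h3 := ((ENNReal.continuous_rpow_const (y := (1 / p).toReal)).tendsto 0).comp h2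
    rw [ENNReal.zero_rpow_of_pos hpos] at h3
    have h4 := ENNReal.Tendsto.mul_const (b := eLpNorm f p volume) h3 (Or.inr hf.2.ne)
    rwa [zero_mul] at h4
  refine (tendsto_of_tendsto_of_tendsto_of_le_of_le tendsto_const_nhds h1 (fun _ => zero_le)
    fun r => ?_).limsup_eq
  refine (eLpNorm_smul_measure_of_ne_top hp _ _).trans_le ?_
  rw [smul_eq_mul]
  gcongr
  exact Measure.restrict_le_self

theorem besNorm_of_subsingleton [Subsingleton V] (f : V → ℝ) : besNorm p f = ‖f 0‖ₑ := by
  have hf : f = fun _ => f 0 := by ext y; rw [Subsingleton.elim y 0]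
  refine Tendsto.limsup_eq (tendsto_const_nhds.congr' ?_)
  filter_upwards [eventually_gt_atTop 0] with r hr
  have := isProbabilityMeasure_unifBall (V := V) hr
  conv_rhs => rw [hf]
  rw [eLpNorm_const _ (zero_lt_one.trans_le hp1.out).ne' (NeZero.ne _)]
  simp

/-- On a point space, a fast Cauchy sequence of almost periodic functions has a limit for the
Besicovitch seminorm. -/
theorem exists_besNorm_limit_of_subsingleton [Subsingleton V] {g : ℕ → AP V}
    (hg : ∀ n, besNorm p (⇑(g (n + 1)) - ⇑(g n)) < 2⁻¹ ^ n) :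
    ∃ u : V → ℝ, AEStronglyMeasurable u volume ∧
      Tendsto (fun n => besNorm p (u - ⇑(g n))) atTop (𝓝 0) := by
  have hc : CauchySeq fun n => g n 0 := by
    refine cauchySeq_of_edist_le_geometric 2⁻¹ 1 (by simp) (by simp) fun n => ?_
    rw [edist_comm, edist_eq_enorm_sub, one_mul]
    have := hg n
    rw [besNorm_of_subsingleton] at this
    exact this.le
  obtain ⟨L, hL⟩ := cauchySeq_tendsto_of_complete hc
  refine ⟨fun _ => L, aestronglyMeasurable_const, ?_⟩
  simp only [besNorm_of_subsingleton, Pi.sub_apply]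
  have h := ((tendsto_const_nhds (x := L)).sub hL).enorm
  simpa using h

/-- A fast Cauchy sequence `g n` of almost periodic functions has a limit for the Besicovitch
seminorm, obtained by gluing the `g n` along spheres of rapidly growing radii. -/
theorem exists_besNorm_limit_of_nontrivial [Nontrivial V] (hp : p ≠ ∞) {g : ℕ → AP V}
    (hg : ∀ n, besNorm p (⇑(g (n + 1)) - ⇑(g n)) < 2⁻¹ ^ n) :
    ∃ u : V → ℝ, AEStronglyMeasurable u volume ∧
      Tendsto (fun n => besNorm p (u - ⇑(g n))) atTop (𝓝 0) := by
  have hR : ∀ n : ℕ, ∃ R : ℝ, (n : ℝ) < R ∧ ∀ r ≥ R,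
      eLpNorm (⇑(g (n + 1)) - ⇑(g n)) p (unifBall V r) < 2⁻¹ ^ n := fun n => by
    obtain ⟨R, hR⟩ := eventually_atTop.1
      ((eventually_lt_of_limsup_lt (hg n)).and (eventually_gt_atTop (n : ℝ)))
    exact ⟨R, (hR R le_rfl).2, fun r hr => (hR r hr).1⟩
  choose R hnR hR using hR
  let d : ℕ → V → ℝ := fun n => (ball (0 : V) (R n))ᶜ.indicator (⇑(g (n + 1)) - ⇑(g n))
  let S : ℕ → V → ℝ := fun n => ⇑(g 0) + ∑ j ∈ Finset.range n, d j
  have hdiffm : ∀ n, AEStronglyMeasurable (⇑(g (n + 1)) - ⇑(g n)) (volume : Measure V) := fun n =>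
    (g (n + 1)).aestronglyMeasurable.sub (g n).aestronglyMeasurable
  have hdm : ∀ n, AEStronglyMeasurable (d n) (volume : Measure V) := fun n =>
    (hdiffm n).indicator measurableSet_ball.compl
  have hSm : ∀ n, AEStronglyMeasurable (S n) (volume : Measure V) := fun n =>
    (g 0).aestronglyMeasurable.add (Finset.aestronglyMeasurable_sum _ fun j _ => hdm j)
  have hd : ∀ n r, eLpNorm (d n) p (unifBall V r) ≤ 2⁻¹ ^ n := fun n r => by
    rcases le_or_gt (R n) r with h | h
    · exact (eLpNorm_indicator_le _).trans (hR n r h).le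
    · have : d n =ᵐ[unifBall V r] 0 := by
        refine (Measure.smul_absolutelyContinuous).ae_le ?_
        filter_upwards [ae_restrict_mem measurableSet_ball] with y hy
        exact indicator_of_notMem (notMem_compl_iff.2 (ball_subset_ball h.le hy)) _
      rw [eLpNorm_congr_ae this]
      simp
  have hconst : ∀ y : V, ∃ N, ∀ n ≥ N, S n y = S N y := fun y => by
    obtain ⟨N, hN⟩ := exists_nat_gt ‖y‖
    refine ⟨N, fun n hn => ?_⟩
    induction n, hn using Nat.le_induction with
    | base => rfl
    | succ n hn ih =>
      have hz : d n y = 0 := indicator_of_notMem (notMem_compl_iff.2 (by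
        rw [mem_ball_zero_iff]
        have : (N : ℝ) ≤ n := by exact_mod_cast hn
        linarith [hnR n])) _
      have : S (n + 1) y = S n y + d n y := by
        simp only [S, Finset.sum_range_succ, Pi.add_apply]; ring
      rw [this, hz, add_zero, ih]
  choose N hN using hconst
  have hlim : ∀ y, Tendsto (fun n => S n y) atTop (𝓝 (S (N y) y)) := fun y =>
    tendsto_const_nhds.congr' (eventually_atTop.2 ⟨N y, fun n hn => (hN y n hn).symm⟩)
  let u : V → ℝ := fun y => S (N y) y
  have hum : AEStronglyMeasurable u (volume : Measure V) :=
    aestronglyMeasurable_of_tendsto_ae _ hSm (ae_of_all _ hlim)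
  refine ⟨u, hum, ?_⟩
  have h1 : ∀ n r, eLpNorm (u - S n) p (unifBall V r) ≤ 2 * 2⁻¹ ^ n := fun n r => by
    have hac := unifBall_absolutelyContinuous (V := V) r
    refine (Lp.eLpNorm_lim_le_liminf_eLpNorm (p := p) (μ := unifBall V r) (f := fun m => S m - S n)
      (fun m => ((hSm m).sub (hSm n)).mono_ac hac) (u - S n)
      (ae_of_all _ fun y => (hlim y).sub_const (S n y))).trans ?_
    refine liminf_le_of_frequently_le' (Eventually.frequently ?_)
    filter_upwards [eventually_ge_atTop n] with m hm
    have e : S m - S n = ∑ j ∈ Finset.Ico n m, d j := by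
      rw [Finset.sum_Ico_eq_sub _ hm]; simp only [S]; abel
    rw [e]
    refine (eLpNorm_sum_le (fun j _ => (hdm j).mono_ac hac) hp1.out).trans
      ((Finset.sum_le_sum fun j _ => hd j r).trans ?_)
    refine (ENNReal.sum_le_tsum (f := fun j => if n ≤ j then (2⁻¹ : ℝ≥0∞) ^ j else 0)
      (Finset.Ico n m)).trans' (Finset.sum_le_sum fun j hj => ?_) |>.trans ?_
    · rw [if_pos (Finset.mem_Ico.1 hj).1]
    · rw [← ENNReal.summable.sum_add_tsum_nat_add' (k := n)]
      have z : ∑ j ∈ Finset.range n, (if n ≤ j then (2⁻¹ : ℝ≥0∞) ^ j else 0) = 0 :=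
        Finset.sum_eq_zero fun j hj => if_neg (not_le.2 (Finset.mem_range.1 hj))
      rw [z, zero_add]
      simp only [le_add_iff_nonneg_left, zero_le, if_true, pow_add]
      rw [ENNReal.tsum_mul_right, ENNReal.tsum_geometric, ENNReal.one_sub_inv_two, inv_inv]
  have h2 : ∀ n, besNorm p (S n - ⇑(g n)) = 0 := fun n => by
    refine besNorm_eq_zero_of_memLp hp ?_
    have e : S n - ⇑(g n)
        = -∑ j ∈ Finset.range n, (ball (0 : V) (R j)).indicator (⇑(g (j + 1)) - ⇑(g j)) := by
      have hs := Finset.sum_range_sub (fun j => (g j : V → ℝ)) n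
      have hs2 : ∀ j : ℕ, (ball (0 : V) (R j)).indicator (⇑(g (j + 1)) - ⇑(g j)) + d j
          = ⇑(g (j + 1)) - ⇑(g j) := fun j => indicator_self_add_compl _ _
      rw [← Finset.sum_congr rfl fun j _ => hs2 j, Finset.sum_add_distrib] at hs
      have hs3 := eq_sub_of_add_eq hs
      simp only [S]
      rw [hs3]; abel
    have hmem : ∀ j : ℕ, MemLp ((ball (0 : V) (R j)).indicator (⇑(g (j + 1)) - ⇑(g j))) p
        volume := fun j => by
      refine (memLp_indicator_iff_restrict measurableSet_ball).2 ?_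
      have : IsFiniteMeasure (volume.restrict (ball (0 : V) (R j))) :=
        ⟨by simpa using measure_ball_lt_top⟩
      exact MemLp.of_bound (hdiffm j).restrict ‖g (j + 1) - g j‖
        (ae_of_all _ fun y => (g (j + 1) - g j).abs_apply_le y)
    rw [e]
    exact MemLp.neg (memLp_finsetSum' (Finset.range n) fun j _ => hmem j)
  have h3 : ∀ n, besNorm p (u - ⇑(g n)) ≤ 2 * 2⁻¹ ^ n := fun n => by
    have e : u - ⇑(g n) = (u - S n) + (S n - ⇑(g n)) := by abel
    rw [e]
    refine (besNorm_add_le hp1.out (hum.sub (hSm n))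
      ((hSm n).sub (g n).aestronglyMeasurable)).trans ?_
    rw [h2, add_zero]
    exact limsup_le_of_le (by isBoundedDefault) (Eventually.of_forall fun r => h1 n r)
  refine tendsto_of_tendsto_of_tendsto_of_le_of_le tendsto_const_nhds ?_ (fun _ => zero_le) h3
  have h4 := ENNReal.Tendsto.const_mul (a := 2)
    (ENNReal.tendsto_pow_atTop_nhds_zero_of_lt_one (r := 2⁻¹) (by simp)) (Or.inr (by simp))
  rwa [mul_zero] at h4

/-- A fast Cauchy sequence of almost periodic functions has a limit in `B^p_AP(V)`. -/
theorem exists_tendsto_toBes (hp : p ≠ ∞) {g : ℕ → AP V}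
    (hg : ∀ n, dist ((g (n + 1)).toBes p) ((g n).toBes p) < 2⁻¹ ^ n) :
    ∃ u : Bes V p, Tendsto (fun n => (g n).toBes p) atTop (𝓝 u) := by
  have hg' : ∀ n, besNorm p (⇑(g (n + 1)) - ⇑(g n)) < 2⁻¹ ^ n := fun n => by
    have h := hg n
    rw [dist_eq_norm, ← AP.toBes_sub, AP.norm_toBes] at h
    have h2 := (ENNReal.lt_ofReal_iff_toReal_lt (besNorm_AP_lt_top p (g (n + 1) - g n)).ne).2 h
    rwa [ENNReal.ofReal_pow (by positivity), ENNReal.ofReal_inv_of_pos two_pos,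
      ENNReal.ofReal_ofNat] at h2
  obtain ⟨u, hum, hu⟩ : ∃ u : V → ℝ, AEStronglyMeasurable u volume ∧
      Tendsto (fun n => besNorm p (u - ⇑(g n))) atTop (𝓝 0) := by
    rcases subsingleton_or_nontrivial V with h | h
    · exact exists_besNorm_limit_of_subsingleton hg'
    · exact exists_besNorm_limit_of_nontrivial hp hg'
  have hmem : u ∈ besSubmodule V p := ⟨hum, fun η hη => by
    obtain ⟨n, hn⟩ := ((tendsto_order.1 hu).2 η hη).exists
    exact ⟨g n, hn⟩⟩
  refine ⟨SeparationQuotient.mk (⟨u, hmem⟩ : BesFun V p), ?_⟩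
  rw [tendsto_iff_dist_tendsto_zero]
  have h := (ENNReal.tendsto_toReal ENNReal.zero_ne_top).comp hu
  refine h.congr fun n => ?_
  rw [dist_comm, dist_eq_norm]
  rfl

end Completeness

section GelfandIsometry
variable {V : Type*} [NormedAddCommGroup V] [NormedSpace ℝ V] [FiniteDimensional ℝ V]
  [MeasureSpace V] [BorelSpace V] [(volume : Measure V).IsAddHaarMeasure]
  {p : ℝ≥0∞} [hp1 : Fact (1 ≤ p)]

theorem neBot_comap_toBes (u : Bes V p) : NeBot (comap (AP.toBes p) (𝓝 u)) :=
  comap_neBot fun t ht => by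
    obtain ⟨_, hx, g, rfl⟩ := mem_closure_iff_nhds.1 (AP.denseRange_toBes u) t ht
    exact ⟨g, hx⟩

theorem isometry_extendBes {X : Type*} [MetricSpace X] [CompleteSpace X] [Nonempty X]
    {T : AP V → X} (hT : ∀ g h, dist (T g) (T h) = dist (g.toBes p) (h.toBes p)) :
    Isometry (extendBes T : Bes V p → X) := by
  refine Isometry.of_dist_eq fun u v => ?_
  have := neBot_comap_toBes u
  have := neBot_comap_toBes v
  have h1 := ((tendsto_extendBes hT u).comp tendsto_fst).dist
    ((tendsto_extendBes hT v).comp (tendsto_snd (f := comap (AP.toBes p) (𝓝 u))))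
  have h2 := ((tendsto_comap (f := AP.toBes p) (x := 𝓝 u)).comp tendsto_fst).dist
    ((tendsto_comap (f := AP.toBes p) (x := 𝓝 v)).comp
      (tendsto_snd (f := comap (AP.toBes p) (𝓝 u))))
  exact tendsto_nhds_unique h1 (h2.congr fun q => (hT q.1 q.2).symm)

theorem extendBes_toBes {X : Type*} [MetricSpace X] [CompleteSpace X] [Nonempty X]
    {T : AP V → X} (hT : ∀ g h, dist (T g) (T h) = dist (g.toBes p) (h.toBes p)) (g : AP V) :
    extendBes T (g.toBes p) = T g := by
  have := neBot_comap_toBes (g.toBes p)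
  refine tendsto_nhds_unique (tendsto_extendBes hT (g.toBes p)) ?_
  rw [tendsto_iff_dist_tendsto_zero]
  simp only [hT]
  exact tendsto_iff_dist_tendsto_zero.1 tendsto_comap

theorem AP.toBes_zero : (0 : AP V).toBes p = 0 := rfl

theorem isometry_hat (hp : p ≠ ∞) : Isometry (hat : Bes V p → Lp ℝ p (bohrMeasure V)) :=
  isometry_extendBes (dist_gelfandLp hp)

theorem hat_toBes (hp : p ≠ ∞) (g : AP V) : hat (g.toBes p) = gelfandLp p g :=
  extendBes_toBes (dist_gelfandLp hp) g

theorem gelfandLp_zero : gelfandLp p (0 : AP V) = 0 := by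
  rw [gelfandLp, ← MemLp.toLp_zero MemLp.zero']
  exact MemLp.toLp_congr _ _ (ae_of_all _ fun s => map_zero s)

theorem norm_hat (hp : p ≠ ∞) (u : Bes V p) : ‖hat u‖ = ‖u‖ := by
  have h := (isometry_hat hp).dist_eq u 0
  rwa [← AP.toBes_zero, hat_toBes hp, gelfandLp_zero, AP.toBes_zero, dist_zero_right,
    dist_zero_right] at h

theorem denseRange_gelfandLp (hp : p ≠ ∞) :
    DenseRange (gelfandLp p : AP V → Lp ℝ p (bohrMeasure V)) := by
  have : (bohrMeasure V).Regular := RealRMK.regular_rieszMeasure _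
  refine (ContinuousMap.toLp_denseRange ℝ (bohrMeasure V) ℝ hp).mono ?_
  rintro _ ⟨φ, rfl⟩
  refine ⟨gelfand.symm φ, ?_⟩
  refine Lp.ext ((memLp_gelfand _).coeFn_toLp.trans ?_)
  rw [AlgEquiv.apply_symm_apply]
  exact (ContinuousMap.coeFn_toLp _ φ).symm

/-- The transformation `u ↦ û` maps `𝓑^p_AP(V)` onto `L^p(K)`. -/
theorem hat_surjective (hp : p ≠ ∞) :
    Function.Surjective (hat : Bes V p → Lp ℝ p (bohrMeasure V)) := fun F => by
  have h : ∀ n : ℕ, ∃ g : AP V, dist F (gelfandLp p g) < 2⁻¹ ^ n / 2 := fun n => by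
    obtain ⟨_, ⟨g, rfl⟩, hg⟩ := Metric.mem_closure_iff.1 (denseRange_gelfandLp hp F) (2⁻¹ ^ n / 2)
      (by positivity)
    exact ⟨g, hg⟩
  choose g hg using h
  obtain ⟨u, hu⟩ := exists_tendsto_toBes (p := p) (g := g) hp fun n => by
    rw [← dist_gelfandLp hp]
    have h1 := hg n
    have h2 := hg (n + 1)
    have h3 := dist_triangle_left (gelfandLp p (g (n + 1))) (gelfandLp p (g n)) F
    have h4 : (2⁻¹ : ℝ) ^ (n + 1) ≤ 2⁻¹ ^ n := by
      rw [pow_succ]; exact mul_le_of_le_one_right (by positivity) (by norm_num)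
    linarith
  refine ⟨u, ?_⟩
  have h1 := ((isometry_hat hp).continuous.tendsto u).comp hu
  simp only [Function.comp_def, hat_toBes hp] at h1
  refine tendsto_nhds_unique h1 ?_
  rw [tendsto_iff_dist_tendsto_zero]
  refine squeeze_zero (fun _ => dist_nonneg) (fun n => ?_)
    (tendsto_pow_atTop_nhds_zero_of_lt_one (r := (2⁻¹ : ℝ)) (by norm_num) (by norm_num))
  rw [dist_comm]
  have : (0 : ℝ) ≤ 2⁻¹ ^ n := by positivity
  linarith [hg n]

end GelfandIsometry

section Pairing
variable {p : ℝ≥0∞} [hp1 : Fact (1 ≤ p)]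

theorem integrable_mul_of_bounded {α : Type*} [MeasurableSpace α] {m : Measure α}
    [IsProbabilityMeasure m] (F : Lp ℝ p m) {φ : α → ℝ} (hφ : AEStronglyMeasurable φ m) {C : ℝ}
    (hC : ∀ x, |φ x| ≤ C) : Integrable (fun x => F x * φ x) m :=
  ((Lp.memLp F).integrable hp1.out).mul_bdd (c := C) hφ (ae_of_all _ hC)

theorem abs_integral_mul_le {α : Type*} [MeasurableSpace α] {m : Measure α}
    [IsProbabilityMeasure m] (F : Lp ℝ p m) {φ : α → ℝ} {C : ℝ} (hC : ∀ x, |φ x| ≤ C) :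
    |∫ x, F x * φ x ∂m| ≤ ‖F‖ * C := by
  have hF := (Lp.memLp F).integrable hp1.out
  have h1 : |∫ x, F x * φ x ∂m| ≤ ∫ x, ‖F x‖ * C ∂m :=
    norm_integral_le_of_norm_le (f := fun x => F x * φ x) (hF.norm.mul_const C)
      (ae_of_all _ fun x => by
        rw [norm_mul]; exact mul_le_mul_of_nonneg_left (hC x) (norm_nonneg _))
  rw [integral_mul_const] at h1
  have hC0 : 0 ≤ C := by
    obtain ⟨x⟩ : Nonempty α := nonempty_of_isProbabilityMeasure m
    exact (abs_nonneg _).trans (hC x)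
  refine h1.trans (mul_le_mul_of_nonneg_right ?_ hC0)
  rw [integral_norm_eq_lintegral_enorm hF.1, ← eLpNorm_one_eq_lintegral_enorm, Lp.norm_def]
  exact ENNReal.toReal_mono (Lp.eLpNorm_ne_top F)
    (eLpNorm_le_eLpNorm_of_exponent_le hp1.out hF.1)

theorem integral_add_mul {α : Type*} [MeasurableSpace α] {m : Measure α}
    [IsProbabilityMeasure m] (F G : Lp ℝ p m) {φ : α → ℝ} (hφ : AEStronglyMeasurable φ m) {C : ℝ}
    (hC : ∀ x, |φ x| ≤ C) :
    ∫ x, (F + G : Lp ℝ p m) x * φ x ∂m = (∫ x, F x * φ x ∂m) + ∫ x, G x * φ x ∂m := by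
  rw [← integral_add (integrable_mul_of_bounded F hφ hC) (integrable_mul_of_bounded G hφ hC)]
  refine integral_congr_ae ?_
  filter_upwards [Lp.coeFn_add F G] with x hx
  rw [hx, Pi.add_apply, add_mul]

theorem integral_smul_mul {α : Type*} [MeasurableSpace α] {m : Measure α} (a : ℝ) (F : Lp ℝ p m)
    (φ : α → ℝ) : ∫ x, (a • F : Lp ℝ p m) x * φ x ∂m = a * ∫ x, F x * φ x ∂m := by
  rw [← integral_const_mul]
  refine integral_congr_ae ?_
  filter_upwards [Lp.coeFn_smul a F] with x hx
  rw [hx, Pi.smul_apply, smul_eq_mul, mul_assoc]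

theorem continuous_integral_mul {α : Type*} [MeasurableSpace α] {m : Measure α}
    [IsProbabilityMeasure m] {φ : α → ℝ} (hφ : AEStronglyMeasurable φ m) {C : ℝ}
    (hC : ∀ x, |φ x| ≤ C) : Continuous fun F : Lp ℝ p m => ∫ x, F x * φ x ∂m :=
  (LinearMap.mkContinuous (σ := RingHom.id ℝ)
    { toFun := fun F : Lp ℝ p m => ∫ x, F x * φ x ∂m
      map_add' := fun F G => integral_add_mul F G hφ hC
      map_smul' := fun a F => integral_smul_mul a F φ } C
    fun F => (abs_integral_mul_le F hC).trans_eq (mul_comm _ _)).continuous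

section
variable {V : Type*} [NormedAddCommGroup V] [NormedSpace ℝ V] [FiniteDimensional ℝ V]
  [MeasureSpace V] [BorelSpace V] [(volume : Measure V).IsAddHaarMeasure]

theorem aestronglyMeasurable_gelfand (g : AP V) :
    AEStronglyMeasurable (gelfand g) (bohrMeasure V) :=
  (gelfand g).continuous.aestronglyMeasurable

variable (p V) in
/-- The pairing `(F, g) ↦ ∫ F ĝ` of `L^p(K)` and `AP(V)`. -/
noncomputable def gelfandPairing : Lp ℝ p (bohrMeasure V) →L[ℝ] AP V →L[ℝ] ℝ :=
  LinearMap.mkContinuous₂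
    (LinearMap.mk₂ ℝ (fun F g => ∫ s, F s * gelfand g s ∂(bohrMeasure V))
      (fun F G g => integral_add_mul F G (aestronglyMeasurable_gelfand g)
        fun s => abs_character_le s g)
      (fun a F g => integral_smul_mul a F _)
      (fun F g h => by
        rw [← integral_add
          (integrable_mul_of_bounded F (aestronglyMeasurable_gelfand g)
            fun s => abs_character_le s g)
          (integrable_mul_of_bounded F (aestronglyMeasurable_gelfand h)
            fun s => abs_character_le s h)]
        simp only [map_add, ContinuousMap.add_apply, mul_add])
      (fun a F g => by
        rw [smul_eq_mul, ← integral_const_mul]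
        simp only [map_smul, ContinuousMap.smul_apply, smul_eq_mul]
        exact integral_congr_ae (ae_of_all _ fun s => by ring))) 1
    fun F g => by
      rw [one_mul]
      exact abs_integral_mul_le F fun s => abs_character_le s g

theorem gelfandPairing_apply (F : Lp ℝ p (bohrMeasure V)) (g : AP V) :
    gelfandPairing p V F g = ∫ s, F s * gelfand g s ∂(bohrMeasure V) := rfl

end

section PartialIntegral
variable {X Y : Type*} [MeasurableSpace X] [MeasurableSpace Y] {μ : Measure X} {ν : Measure Y}
  [IsProbabilityMeasure μ] [IsProbabilityMeasure ν]

theorem coeFn_partialIntegral (f : Lp ℝ p (μ.prod ν)) :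
    partialIntegral f =ᵐ[μ] fun x => ∫ y, f (x, y) ∂ν :=
  (memLp_partialIntegral hp1.out (Lp.memLp f)).coeFn_toLp

theorem partialIntegral_sub (f g : Lp ℝ p (μ.prod ν)) :
    partialIntegral (f - g) = partialIntegral f - partialIntegral g := by
  refine Lp.ext ?_
  filter_upwards [coeFn_partialIntegral (f - g), coeFn_partialIntegral f, coeFn_partialIntegral g,
    Lp.coeFn_sub (partialIntegral f) (partialIntegral g),
    Measure.ae_ae_of_ae_prod (Lp.coeFn_sub f g), ae_integrable_slice hp1.out (Lp.memLp f),
    ae_integrable_slice hp1.out (Lp.memLp g)] with x h1 h2 h3 h4 h5 h6 h7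
  rw [h1, h4, Pi.sub_apply, h2, h3, ← integral_sub h6 h7]
  exact integral_congr_ae h5

theorem norm_partialIntegral_le (f : Lp ℝ p (μ.prod ν)) : ‖partialIntegral f‖ ≤ ‖f‖ := by
  rw [Lp.norm_def, Lp.norm_def]
  refine ENNReal.toReal_mono (Lp.eLpNorm_ne_top f) ?_
  rw [eLpNorm_congr_ae (coeFn_partialIntegral f)]
  have h := eLpNorm_integral_norm_le (ν := ν) hp1.out (Lp.memLp f).1
  rw [measure_univ, ENNReal.one_rpow, one_mul] at h
  refine le_trans (eLpNorm_mono fun x => ?_) h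
  exact (norm_integral_le_integral_norm _).trans (le_abs_self _)

theorem continuous_partialIntegral :
    Continuous (partialIntegral : Lp ℝ p (μ.prod ν) → Lp ℝ p μ) :=
  (LipschitzWith.mk_one fun f g => by
    rw [dist_eq_norm, dist_eq_norm, ← partialIntegral_sub]
    exact norm_partialIntegral_le _).continuous

end PartialIntegral

variable {V W : Type*} [NormedAddCommGroup V] [InnerProductSpace ℝ V] [FiniteDimensional ℝ V]
  [MeasurableSpace V] [BorelSpace V] [NormedAddCommGroup W] [InnerProductSpace ℝ W]
  [FiniteDimensional ℝ W] [MeasurableSpace W] [BorelSpace W]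

theorem isometry_hatProd (hp : p ≠ ∞) : Isometry
    (hatProd : Bes (WithLp 2 (V × W)) p → Lp ℝ p ((bohrMeasure V).prod (bohrMeasure W))) :=
  isometry_extendBes (dist_gelfandProdLp hp)

theorem hatProd_toBes (hp : p ≠ ∞) (g : AP (WithLp 2 (V × W))) :
    hatProd (g.toBes p) = gelfandProdLp p g :=
  extendBes_toBes (dist_gelfandProdLp hp) g

theorem gelfandProdLp_zero : gelfandProdLp p (0 : AP (WithLp 2 (V × W))) = 0 := by
  rw [gelfandProdLp, ← MemLp.toLp_zero MemLp.zero']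
  exact MemLp.toLp_congr _ _ (ae_of_all _ fun k => map_zero (prodCharacter k.1 k.2))

theorem norm_hatProd (hp : p ≠ ∞) (u : Bes (WithLp 2 (V × W)) p) : ‖hatProd u‖ = ‖u‖ := by
  have h := (isometry_hatProd hp).dist_eq u 0
  rwa [← AP.toBes_zero, hatProd_toBes hp, gelfandProdLp_zero, AP.toBes_zero, dist_zero_right,
    dist_zero_right] at h

theorem continuous_constInSecond :
    Continuous (constInSecond : Bes V p → Bes (WithLp 2 (V × W)) p) :=
  SeparationQuotient.continuous_lift
    (SeparationQuotient.continuous_mk.comp BesFun.continuous_compFst)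

theorem constInSecond_toBes (g : AP V) :
    (constInSecond (g.toBes p) : Bes (WithLp 2 (V × W)) p) = g.compFst.toBes p := rfl

theorem norm_constInSecond_le (u : Bes V p) :
    ‖(constInSecond u : Bes (WithLp 2 (V × W)) p)‖
      ≤ ((ballRatio V W) ^ (1 / p).toReal).toReal * ‖u‖ := by
  obtain ⟨u, rfl⟩ := SeparationQuotient.surjective_mk u
  have hC : (ballRatio V W) ^ (1 / p).toReal ≠ ∞ :=
    ENNReal.rpow_ne_top_of_nonneg ENNReal.toReal_nonneg ballRatio_ne_top
  have h := ENNReal.toReal_mono (ENNReal.mul_ne_top hC (besNorm_lt_top u.2).ne)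
    (besNorm_comp_fst_le (W := W) (p := p) u.2.1)
  rw [ENNReal.toReal_mul] at h
  exact h

theorem aestronglyMeasurable_gelfandProd (c : AP (WithLp 2 (V × W))) :
    AEStronglyMeasurable (gelfandProd c) ((bohrMeasure V).prod (bohrMeasure W)) :=
  (measurable_continuousMap_prod _).aestronglyMeasurable

theorem abs_gelfandProd_le (c : AP (WithLp 2 (V × W))) (k : BohrSpace V × BohrSpace W) :
    |gelfandProd c k| ≤ ‖c‖ :=
  abs_character_le (prodCharacter k.1 k.2) c

theorem integral_hatProd_constInSecond (hp : p ≠ ∞) (w : Bes V p) (c : AP (WithLp 2 (V × W))) :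
    ∫ k, hatProd (constInSecond w) k * gelfandProd c k ∂((bohrMeasure V).prod (bohrMeasure W))
      = gelfandPairing p V (hat w) (avgSnd c) := by
  induction w using AP.denseRange_toBes.induction_on with
  | hp =>
    refine isClosed_eq ?_ ?_
    · exact (continuous_integral_mul (aestronglyMeasurable_gelfandProd c)
        (abs_gelfandProd_le c)).comp
          ((isometry_hatProd hp).continuous.comp continuous_constInSecond)
    · exact ((gelfandPairing p V).flip (avgSnd c)).continuous.comp (isometry_hat hp).continuous
  | ih g =>
    have h1 : hatProd (constInSecond (g.toBes p)) =ᵐ[(bohrMeasure V).prod (bohrMeasure W)]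
        gelfandProd (g.compFst : AP (WithLp 2 (V × W))) := by
      rw [constInSecond_toBes, hatProd_toBes hp]
      exact (memLp_continuousMap_prod _ _ _).coeFn_toLp
    have h2 : hat (g.toBes p) =ᵐ[bohrMeasure V] gelfand g := by
      rw [hat_toBes hp]
      exact (memLp_gelfand g).coeFn_toLp
    have e1 : ∫ k, hatProd (constInSecond (g.toBes p)) k * gelfandProd c k
          ∂((bohrMeasure V).prod (bohrMeasure W))
        = ∫ k, (gelfandProd (g.compFst : AP (WithLp 2 (V × W))) * gelfandProd c) k
          ∂((bohrMeasure V).prod (bohrMeasure W)) := by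
      refine integral_congr_ae ?_
      filter_upwards [h1] with k hk
      rw [hk]; rfl
    rw [e1, gelfandPairing_apply, integral_prod _
      ((memLp_continuousMap_prod _ 1 _).integrable le_rfl)]
    refine integral_congr_ae ?_
    filter_upwards [h2] with s hs
    simp only [ContinuousMap.mul_apply, gelfandProd_compFst]
    rw [hs, integral_const_mul, ← character_avgSnd]
    rfl

theorem integral_mul_gelfandProd_compFst
    (F : Lp ℝ p ((bohrMeasure V).prod (bohrMeasure W))) (g : AP V) :
    ∫ k, F k * gelfandProd (g.compFst : AP (WithLp 2 (V × W))) k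
        ∂((bohrMeasure V).prod (bohrMeasure W))
      = gelfandPairing p V (partialIntegral F) g := by
  rw [gelfandPairing_apply, integral_prod _ (integrable_mul_of_bounded F
    (aestronglyMeasurable_gelfandProd _) (abs_gelfandProd_le _))]
  refine integral_congr_ae ?_
  filter_upwards [coeFn_partialIntegral F] with s hs
  simp only [gelfandProd_compFst]
  rw [integral_mul_const, hs]
  rfl

end Pairing

section TimePrimitive
variable {N : ℕ} {Ω : Set (Space N)} {T : ℝ} {p : ℝ≥0∞} [hp1 : Fact (1 ≤ p)]

theorem restrict_cyl : (volume : Measure (Space N × ℝ)).restrict (cyl Ω T)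
    = (volume.restrict Ω).prod (volume.restrict (Ioo 0 T)) := by
  rw [Measure.prod_restrict]; rfl

theorem memLp_partialIntegral_hatProd (hp : p ≠ ∞) {α : Type*} [MeasurableSpace α] {m : Measure α}
    {q : ℝ≥0∞} {v : α → Bes (MicroSpaceTime N) p} (hv : MemLp v q m) :
    MemLp (fun z => partialIntegral (hatProd (v z))) q m :=
  hv.of_le ((continuous_partialIntegral.comp (isometry_hatProd hp).continuous)
    |>.comp_aestronglyMeasurable hv.1)
    (ae_of_all _ fun _ => (norm_partialIntegral_le _).trans_eq (norm_hatProd hp _))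

theorem memLp_constInSecond {α : Type*} [MeasurableSpace α] {m : Measure α} {q : ℝ≥0∞}
    {w : α → Bes (Space N) p} (hw : MemLp w q m) :
    MemLp (fun z => (constInSecond (w z) : Bes (MicroSpaceTime N) p)) q m :=
  hw.of_le_mul (continuous_constInSecond.comp_aestronglyMeasurable hw.1)
    (ae_of_all _ fun z => norm_constInSecond_le (w z))

theorem exists_memLp_hat_eq (hp : p ≠ ∞) {α : Type*} [MeasurableSpace α] {m : Measure α}
    {q : ℝ≥0∞} {W : α → Lp ℝ p (bohrMeasure (Space N))} (hW : MemLp W q m) :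
    ∃ w : α → Bes (Space N) p, MemLp w q m ∧ ∀ z, hat (w z) = W z := by
  have hinv := Function.surjInv_eq (hat_surjective (V := Space N) hp)
  set inv := Function.surjInv (hat_surjective (V := Space N) hp)
  have hiso : Isometry inv := Isometry.of_dist_eq fun a b => by
    rw [← (isometry_hat hp).dist_eq, hinv, hinv]
  refine ⟨fun z => inv (W z), hW.of_le (hiso.continuous.comp_aestronglyMeasurable hW.1)
    (ae_of_all _ fun z => ?_), fun z => hinv _⟩
  rw [← norm_hat hp, hinv]

/-- The trace `z ↦ f(z, z / e)` of a function with values in `AP(ℝ^{N+1})`. -/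
noncomputable def microTrace (f : Space N × ℝ → AP (MicroSpaceTime N)) (e : ℝ) (z : Space N × ℝ) : ℝ :=
  f z (WithLp.toLp 2 (e⁻¹ • z.1, e⁻¹ * z.2))

theorem memLp_microTrace {q : ℝ≥0∞} {m : Measure (Space N × ℝ)}
    {f : Space N × ℝ → AP (MicroSpaceTime N)} (hf : MemLp f q m) (e : ℝ) :
    MemLp (microTrace f e) q m := by
  refine hf.of_le (AP.continuous_eval.comp_aestronglyMeasurable (hf.1.prodMk ?_))
    (ae_of_all _ fun z => (f z).abs_apply_le _)
  exact (by fun_prop : Continuous fun z : Space N × ℝ =>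
    WithLp.toLp 2 (e⁻¹ • z.1, e⁻¹ * z.2)).aestronglyMeasurable

/-- The function `(x, τ) ↦ ∫_τ^T M(f(x, t, y, ·)) dt` with values in `AP(ℝ^N)`. -/
noncomputable def backwardMean (T : ℝ) (f : Space N × ℝ → AP (MicroSpaceTime N))
    (z : Space N × ℝ) : AP (Space N) :=
  ∫ t in z.2..T, avgSnd (f (z.1, t))

theorem memLp_avgSnd {q : ℝ≥0∞} {m : Measure (Space N × ℝ)}
    {f : Space N × ℝ → AP (MicroSpaceTime N)} (hf : MemLp f q m) :
    MemLp (fun z => (avgSnd (f z) : AP (Space N))) q m :=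
  avgSnd.comp_memLp' hf

theorem integral_microTrace_sub_backwardMean {f : Space N × ℝ → AP (MicroSpaceTime N)}
    {z : Space N × ℝ} (hz : z.2 ∈ Ioo 0 T)
    (hf : Integrable (fun t => f (z.1, t)) (volume.restrict (Ioo 0 T))) (e : ℝ) :
    (∫ t in z.2..T, microTrace f e (z.1, t)) - microTrace (fun z => (backwardMean T f z).compFst) e z
      = ∫ t in Ioo z.2 T, oscillation (fun t => f (z.1, t)) e (e⁻¹ • z.1) t := by
  have hf' : Integrable (fun t => f (z.1, t)) (volume.restrict (Ioo z.2 T)) :=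
    hf.mono_measure (Measure.restrict_mono (Ioo_subset_Ioo_left hz.1.le) le_rfl)
  have h1 : microTrace (fun z => (backwardMean T f z).compFst) e z
      = ∫ t in Ioo z.2 T, avgSnd (f (z.1, t)) (e⁻¹ • z.1) := by
    have h2 := (evalCLM (e⁻¹ • z.1)).integral_comp_comm (avgSnd.integrable_comp hf')
    refine Eq.trans ?_ h2.symm
    simp only [microTrace, AP.compFst_apply, backwardMean]
    rw [intervalIntegral.integral_of_le hz.2.le, integral_Ioc_eq_integral_Ioo]
    rfl
  rw [h1, intervalIntegral.integral_of_le hz.2.le, integral_Ioc_eq_integral_Ioo, ← integral_sub]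
  · rfl
  · exact integrable_eval hf' (by fun_prop : Continuous fun t : ℝ =>
      WithLp.toLp 2 (e⁻¹ • z.1, e⁻¹ * t)).aestronglyMeasurable
  · exact integrable_eval (avgSnd.integrable_comp hf') aestronglyMeasurable_const

theorem abs_integral_oscillation_le {f : ℝ → AP (MicroSpaceTime N)} {τ : ℝ} (hτ : τ ∈ Ioo 0 T)
    (hf : Integrable f (volume.restrict (Ioo 0 T))) (e : ℝ) (y : Space N) :
    |∫ t in Ioo τ T, oscillation f e y t| ≤ 2 * ∫ t in Ioo 0 T, ‖f t‖ := by
  have hsub : volume.restrict (Ioo τ T) ≤ volume.restrict (Ioo 0 T) :=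
    Measure.restrict_mono (Ioo_subset_Ioo_left hτ.1.le) le_rfl
  have h : |∫ t in Ioo τ T, oscillation f e y t| ≤ ∫ t in Ioo τ T, 2 * ‖f t‖ :=
    norm_integral_le_of_norm_le (f := oscillation f e y) ((hf.mono_measure hsub).norm.const_mul 2)
      (ae_of_all _ fun t => abs_oscillation_le f e y t)
  rw [integral_const_mul] at h
  refine h.trans ?_
  gcongr
  · exact ae_of_all _ fun t => norm_nonneg _
  · exact hf.norm

variable {ι : Type*} {l : Filter ι} {ε : ι → ℝ} {v : ι → Space N × ℝ → ℝ}
  {v₀ : Space N × ℝ → Bes (MicroSpaceTime N) p}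

/-- In the limit, the backward time integral of an oscillating test function may be replaced by that
of its mean value in the microscopic time. -/
theorem tendsto_integral_mul_sub [l.IsCountablyGenerated] (hε : Tendsto ε l (𝓝[>] 0))
    (hv : WeakSigmaConverges l ε (cyl Ω T) p v v₀) {q : ℝ≥0∞} (hpq : p⁻¹ + q⁻¹ = 1)
    {f : Space N × ℝ → AP (MicroSpaceTime N)} (hf : MemLp f q (volume.restrict (cyl Ω T))) :
    Tendsto (fun i => ∫ z in cyl Ω T, v i z * ((∫ t in z.2..T, microTrace f (ε i) (z.1, t))
      - microTrace (fun z => (backwardMean T f z).compFst) (ε i) z)) l (𝓝 0) := by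
  have hpq' : ENNReal.HolderConjugate p q := ENNReal.holderConjugate_iff.2 hpq
  have hq : 1 ≤ q := ENNReal.HolderTriple.le q p 1
  rw [restrict_cyl] at hf
  refine tendsto_of_seq_tendsto fun x hx => ?_
  have hslice : ∀ᵐ z ∂((volume.restrict Ω).prod (volume.restrict (Ioo 0 T))),
      Integrable (fun t => f (z.1, t)) (volume.restrict (Ioo 0 T)) :=
    Measure.quasiMeasurePreserving_fst.ae (ae_integrable_slice hq hf)
  refine tendsto_integral_mul_of_abs_le (p := p) (q := q)
    (H := fun z => 2 * ∫ t in Ioo 0 T, ‖f (z.1, t)‖) (fun n => hv.memLp (x n)) (fun φ hφ => ?_) ?_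
    (fun n => ?_) (fun n => ?_) ?_
  · have h := hv.tendsto q hpq (fun z => φ z • (1 : AP (MicroSpaceTime N)))
      (hφ.of_le (hφ.1.smul_const _) (ae_of_all _ fun z => by rw [norm_smul, norm_one, mul_one]))
    refine ⟨_, (h.comp hx).congr fun n => ?_⟩
    simp only [Function.comp_apply, AP.smul_apply, AP.one_apply, mul_one]
  · rw [restrict_cyl]
    exact ((memLp_integral_norm hq hf).const_mul 2).comp_fst _
  · rw [restrict_cyl]
    refine (memLp_intervalIntegral_last hq (memLp_microTrace hf (ε (x n)))).1.sub
      (memLp_microTrace (q := q) ?_ _).1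
    exact compFstCLM.comp_memLp' (memLp_intervalIntegral_last hq (memLp_avgSnd hf))
  · rw [restrict_cyl]
    filter_upwards [hslice, ae_snd_mem_Ioo] with z h1 h2
    rw [integral_microTrace_sub_backwardMean h2 h1]
    exact abs_integral_oscillation_le h2 h1 _ _
  · rw [restrict_cyl]
    filter_upwards [hslice, ae_snd_mem_Ioo] with z h1 h2
    simp only [integral_microTrace_sub_backwardMean h2 h1]
    have hav := averages_of_integrable (a := z.2) (b := T) (h1.mono_measure
      (Measure.restrict_mono (Ioo_subset_Ioo_left h2.1.le) le_rfl))
    refine Metric.tendsto_nhds.2 fun η hη => ?_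
    filter_upwards [(hε.comp hx).eventually (hav (η / 2) (by positivity))] with n hn
    rw [Real.dist_eq, sub_zero]
    exact (hn _).trans_lt (half_lt_self hη)

theorem memLp_timePrimitive {u : Space N × ℝ → ℝ} (hu : MemLp u p (volume.restrict (cyl Ω T))) :
    MemLp (timePrimitive u) p (volume.restrict (cyl Ω T)) := by
  rw [restrict_cyl] at hu ⊢
  exact memLp_intervalIntegral_zero hp1.out hu

/-- Time primitives weakly Σ-converge to the time primitive of the mean value of the limit in the
microscopic time. -/
theorem WeakSigmaConverges.timePrimitive [l.IsCountablyGenerated] (hp : p ≠ ∞)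
    (hε : Tendsto ε l (𝓝[>] 0)) (hv : WeakSigmaConverges l ε (cyl Ω T) p v v₀)
    {w₀ : Space N × ℝ → Bes (Space N) p} (hw₀ : MemLp w₀ p (volume.restrict (cyl Ω T)))
    (hw : ∀ z, hat (w₀ z) = ∫ τ in (0 : ℝ)..z.2, partialIntegral (hatProd (v₀ (z.1, τ)))) :
    WeakSigmaConverges l ε (cyl Ω T) p (fun i => timePrimitive (v i))
      (fun z => constInSecond (w₀ z)) := by
  refine ⟨fun i => memLp_timePrimitive (hv.memLp i), memLp_constInSecond hw₀, fun q hpq f hf => ?_⟩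
  have hpq' : ENNReal.HolderConjugate p q := ENNReal.holderConjugate_iff.2 hpq
  have hq : 1 ≤ q := ENNReal.HolderTriple.le q p 1
  have hG : MemLp (fun z => ((backwardMean T f z).compFst : AP (MicroSpaceTime N))) q
      ((volume.restrict Ω).prod (volume.restrict (Ioo 0 T))) := by
    rw [restrict_cyl] at hf
    exact compFstCLM.comp_memLp' (memLp_intervalIntegral_last hq (memLp_avgSnd hf))
  have hlim := hv.tendsto q hpq (fun z => (backwardMean T f z).compFst)
    (by rw [restrict_cyl]; exact hG)
  have hsum := (tendsto_integral_mul_sub hε hv hpq hf).add hlim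
  rw [zero_add] at hsum
  have hVm : MemLp (fun z => partialIntegral (hatProd (v₀ z))) p
      ((volume.restrict Ω).prod (volume.restrict (Ioo 0 T))) := by
    rw [← restrict_cyl]; exact memLp_partialIntegral_hatProd hp hv.memLp_limit
  rw [restrict_cyl] at hf hsum ⊢
  have hlimit : ∫ z, ∫ k, hatProd (v₀ z) k * gelfandProd (backwardMean T f z).compFst k
        ∂((bohrMeasure (Space N)).prod (bohrMeasure ℝ))
        ∂((volume.restrict Ω).prod (volume.restrict (Ioo 0 T)))
      = ∫ z, ∫ k, hatProd (constInSecond (w₀ z)) k * gelfandProd (f z) k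
        ∂((bohrMeasure (Space N)).prod (bohrMeasure ℝ))
        ∂((volume.restrict Ω).prod (volume.restrict (Ioo 0 T))) := by
    simp only [integral_mul_gelfandProd_compFst, integral_hatProd_constInSecond hp, hw]
    exact (integral_bilin_intervalIntegral (gelfandPairing p (Space N)) hVm (memLp_avgSnd hf)).symm
  rw [hlimit] at hsum
  refine hsum.congr fun i => ?_
  have hvi := hv.memLp i
  rw [restrict_cyl] at hvi
  have hF := memLp_intervalIntegral_last hq (memLp_microTrace hf (ε i))
  have hGt := memLp_microTrace hG (ε i)
  have h1 := integral_bilin_intervalIntegral (ContinuousLinearMap.mul ℝ ℝ) hvi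
    (memLp_microTrace hf (ε i))
  refine Eq.trans ?_ h1.symm
  refine (integral_add (hvi.integrable_mul (hF.sub hGt)) (hvi.integrable_mul hGt)).symm.trans ?_
  refine integral_congr_ae (ae_of_all _ fun z => ?_)
  simp only [Pi.mul_apply, Pi.sub_apply, ContinuousLinearMap.mul_apply']
  ring

end TimePrimitive

end APSigma

open APSigma
theorem corollary4p2 {N : ℕ} (Ω : Set (Space N)) (hΩ : IsOpen Ω) (T : ℝ) (hT : 0 < T)
    (p : ℝ≥0∞) [Fact (1 ≤ p)] (hp : p ≠ ∞)
    {ι : Type*} (l : Filter ι) [l.IsCountablyGenerated] (ε : ι → ℝ) (hε : Tendsto ε l (𝓝[>] 0))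
    (v : ι → Space N × ℝ → ℝ) (v₀ : Space N × ℝ → Bes (MicroSpaceTime N) p)
    (hv : WeakSigmaConverges l ε (cyl Ω T) p v v₀) :
    ∃ w₀ : Space N × ℝ → Bes (Space N) p,
      MemLp w₀ p (volume.restrict (cyl Ω T)) ∧
      (∀ᵐ z ∂(volume.restrict (cyl Ω T)),
        IntervalIntegrable (fun τ => partialIntegral (hatProd (v₀ (z.1, τ)))) volume 0 z.2 ∧
        hat (w₀ z) = ∫ τ in (0 : ℝ)..z.2, partialIntegral (hatProd (v₀ (z.1, τ)))) ∧
      WeakSigmaConverges l ε (cyl Ω T) p (fun i => timePrimitive (v i))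
        (fun z => constInSecond (w₀ z)) := by
  have hp1 : 1 ≤ p := Fact.out
  have hV : MemLp (fun z => partialIntegral (hatProd (v₀ z))) p
      ((volume.restrict Ω).prod (volume.restrict (Ioo 0 T))) := by
    rw [← restrict_cyl]; exact memLp_partialIntegral_hatProd hp hv.memLp_limit
  obtain ⟨w₀, hw₀, hw⟩ := exists_memLp_hat_eq hp (memLp_intervalIntegral_zero hp1 hV)
  rw [← restrict_cyl] at hw₀
  refine ⟨w₀, hw₀, ?_, hv.timePrimitive hp hε hw₀ hw⟩
  rw [restrict_cyl]
  filter_upwards [Measure.quasiMeasurePreserving_fst.ae (ae_integrable_slice hp1 hV),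
    ae_snd_mem_Ioo] with z h1 h2
  refine ⟨?_, hw z⟩
  rw [intervalIntegrable_iff_integrableOn_Ioc_of_le h2.1.le]
  exact IntegrableOn.mono_set h1 fun τ hτ => ⟨hτ.1, hτ.2.trans_lt h2.2⟩
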